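/- Let $(\Upsilon,\preccurlyeq)$ be a Hausdorff tree: a partially ordered set in which, for every $t$, the set $(0,t]=\{s\in\Upsilon : s\preccurlyeq t\}$ is well-ordered, and in which every non-empty totally ordered subset has at most one minimal upper bound. Give $\Upsilon$ its order topology, generated by the sets $(0,t]$, $t\in\Upsilon$, and $(s,t]=(0,t]\setminus(0,s]$, $s\prec t$. Let $C_0(\Upsilon)$ be the Banach lattice of continuous real functions on $\Upsilon$ vanishing at infinity, with the supremum norm and the pointwise order, and $C_0(\Upsilon)^*$ its dual Banach lattice. Then the following are equivalent: 1. $C_0(\Upsilon)^*$ admits an equivalent dual p-UR norm; 2. $C_0(\Upsilon)^*$ admits an equivalent strictly convex dual lattice norm; 3. $C_0(\Upsilon)$ admits an equivalent Gâteaux smooth lattice norm; 4. $C_0(\Upsilon)^*$ admits an equivalent strictly convex dual norm; 5. there is a map $\rho:\Upsilon\to Y$ with $\rho(s)<\rho(t)$ whenever $s\prec t$; 6. $\Upsilon$ is a Gruenhage space. Here a dual norm on $X^*$ is one that is dual to an equivalent norm on $X$. A norm $\|\cdot\|$ is a lattice norm if $|x|\le|y|$ implies $\|x\|\le\|y\|$;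 strictly convex if $\|x\|=\|y\|=\frac12\|x+y\|$ implies $x=y$; Gâteaux smooth if it is Gâteaux differentiable at every non-zero point. A norm $\|\cdot\|$ on a Banach space $Z$ is p-UR if there is a linear subspace $F\subseteq Z^*$ separating the points of $Z$ such that, whenever $\|x_n\|=\|y_n\|=1$ for all $n$ and $\|x_n+y_n\|\to2$, we have $f(x_n-y_n)\to0$ for every $f\in F$. $Y$ is the set of all strictly increasing, continuous transfinite sequences $x=(x_\alpha)_{\alpha\le\beta}$ of real numbers with $0\le\beta<\omega_1$, ordered by: $x<y$ if and only if either $y$ strictly extends $x$, or there is an ordinal $\alpha$ at which both are defined, such that $x_\xi=y_\xi$ for all $\xi<\alpha$ and $y_\alpha<x_\alpha$. A topological space $X$ is Gruenhage if there are families $(\mathscr U_n)_{n\in\mathbb N}$ of open subsets of $X$ such that for all distinct $x,y\in X$ there are $n\in\mathbb N$ and $U\in\mathscr U_n$ such that $U\cap\{x,y\}$ is a singleton and at least one of $x$, $y$ lies in only finitely many members of $\mathscr U_n$. -/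

import Mathlib

open scoped ZeroAtInfty Ordinal

noncomputable section

/-! ### Trees and their order topology -/

/-- A tree: a partially ordered set in which the set of predecessors `(0, t] = {s | s ≤ t}` of
each element is well-ordered. -/
def IsOrderTree (Υ : Type*) [PartialOrder Υ] : Prop :=
  ∀ t : Υ, IsWellOrder (Set.Iic t) (· < ·)

/-- Hausdorff trees: every non-empty totally ordered subset has at most one minimal upper bound. -/
def IsHausdorffOrder (Υ : Type*) [PartialOrder Υ] : Prop :=
  ∀ C : Set Υ, C.Nonempty → IsChain (· ≤ ·) C →
    ∀ u v : Υ, Minimal (· ∈ upperBounds C) u → Minimal (· ∈ upperBounds C) v → u = v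

/-- The order topology of a tree, generated by the intervals `(s, t]`, `s < t`, together with
the intervals `(0, t] = {s | s ≤ t}`, where `0` is a symbol for an element below all of the tree
(so that minimal elements are isolated). -/
@[reducible]
def treeTopology (Υ : Type*) [PartialOrder Υ] : TopologicalSpace Υ :=
  TopologicalSpace.generateFrom
    ({U | ∃ s t : Υ, s < t ∧ U = Set.Ioc s t} ∪ {U | ∃ t : Υ, U = Set.Iic t})

/-! ### Gruenhage spaces -/

/-- Gruenhage spaces. -/
def IsGruenhage (X : Type*) [TopologicalSpace X] : Prop :=
  ∃ 𝒰 : ℕ → Set (Set X), (∀ n, ∀ U ∈ 𝒰 n, IsOpen U) ∧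
    ∀ x y : X, x ≠ y → ∃ n, ∃ U ∈ 𝒰 n,
      (∃ z, U ∩ {x, y} = {z}) ∧
      ({V | V ∈ 𝒰 n ∧ x ∈ V}.Finite ∨ {V | V ∈ 𝒰 n ∧ y ∈ V}.Finite)

/-! ### The linear order `Y` -/

/-- The elements of `Y`: strictly increasing, continuous transfinite sequences
`(x_α)_{α ≤ β}` of real numbers, where `β = len` is a countable ordinal. -/
structure OrderY where
  len : Ordinal.{0}
  len_lt : len < ω₁
  seq : Set.Iic len → ℝ
  strictMono : StrictMono seq
  continuous : Continuous seq

/-- `x < y` if either `y` strictly extends `x`, or `x` and `y` agree before some `α` at which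
both are defined and `y_α < x_α`. -/
instance : LT OrderY where
  lt x y :=
    (x.len < y.len ∧
      ∀ ξ (hx : ξ ≤ x.len) (hy : ξ ≤ y.len), x.seq ⟨ξ, hx⟩ = y.seq ⟨ξ, hy⟩) ∨
    (∃ α, ∃ (hαx : α ≤ x.len) (hαy : α ≤ y.len),
      (∀ ξ (hξ : ξ < α), x.seq ⟨ξ, hξ.le.trans hαx⟩ = y.seq ⟨ξ, hξ.le.trans hαy⟩) ∧
      y.seq ⟨α, hαy⟩ < x.seq ⟨α, hαx⟩)

/-! ### Renormings -/

section Norms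

variable {X : Type*} [NormedAddCommGroup X] [NormedSpace ℝ X]

/-- `N` is a norm on `X` equivalent to the given one. -/
def IsEquivalentNorm (N : Seminorm ℝ X) : Prop :=
  ∃ c C : ℝ, 0 < c ∧ 0 < C ∧ ∀ x, c * ‖x‖ ≤ N x ∧ N x ≤ C * ‖x‖

/-- `N` is an equivalent dual norm on `X*`: it is the norm dual to some equivalent norm on `X`. -/
def IsEquivalentDualNorm (N : Seminorm ℝ (StrongDual ℝ X)) : Prop :=
  IsEquivalentNorm N ∧
    ∃ p : Seminorm ℝ X, IsEquivalentNorm p ∧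
      ∀ φ : StrongDual ℝ X, IsLUB {r : ℝ | ∃ x, p x ≤ 1 ∧ φ x = r} (N φ)

/-- Strictly convex norms. -/
def IsStrictlyConvexNorm (N : Seminorm ℝ X) : Prop :=
  ∀ x y, N x = N y → N y = (1 / 2) * N (x + y) → x = y

/-- Pointwise uniformly rotund (p-UR) norms. -/
def IsPURNorm (N : Seminorm ℝ X) : Prop :=
  ∃ F : Submodule ℝ (StrongDual ℝ X),
    (∀ x : X, x ≠ 0 → ∃ f ∈ F, f x ≠ 0) ∧
    ∀ x y : ℕ → X, (∀ n, N (x n) = 1) → (∀ n, N (y n) = 1) →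
      Filter.Tendsto (fun n => N (x n + y n)) Filter.atTop (nhds 2) →
      ∀ f ∈ F, Filter.Tendsto (fun n => f (x n - y n)) Filter.atTop (nhds 0)

/-- Gâteaux smooth norms: at every nonzero point the directional derivatives exist and form a
continuous linear functional of the direction. -/
def IsGateauxSmoothNorm (N : Seminorm ℝ X) : Prop :=
  ∀ x : X, x ≠ 0 → ∃ D : StrongDual ℝ X, ∀ h : X, HasLineDerivAt ℝ (fun z => N z) (D h) x h

end Norms

/-! ### Lattice norms on `C₀(Ω)` and its dual -/

section Lattice

variable {Ω : Type*} [TopologicalSpace Ω]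

/-- Lattice norms on `C₀(Ω)` for the pointwise order: `|f| ≤ |g|` implies `N f ≤ N g`. -/
def IsLatticeNorm (N : Seminorm ℝ C₀(Ω, ℝ)) : Prop :=
  ∀ f g : C₀(Ω, ℝ), (∀ t, |f t| ≤ |g t|) → N f ≤ N g

/-- The modulus `|μ|` of `μ` in the dual Banach lattice `C₀(Ω)*`, evaluated at `f ≥ 0`:
`|μ|(f) = sup {μ(g) : |g| ≤ f}`. In terms of measures, this is the integral of `f` with respect
to the total variation of `μ`. -/
def dualModulus (μ : StrongDual ℝ C₀(Ω, ℝ)) (f : C₀(Ω, ℝ)) : ℝ :=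
  sSup {r : ℝ | ∃ g : C₀(Ω, ℝ), (∀ t, |g t| ≤ f t) ∧ μ g = r}

/-- Lattice norms on the dual of `C₀(Ω)`: `|μ| ≤ |ν|` implies `N μ ≤ N ν`. -/
def IsDualSpaceLatticeNorm (N : Seminorm ℝ (StrongDual ℝ C₀(Ω, ℝ))) : Prop :=
  ∀ μ ν : StrongDual ℝ C₀(Ω, ℝ),
    (∀ f : C₀(Ω, ℝ), (∀ t, 0 ≤ f t) → dualModulus μ f ≤ dualModulus ν f) → N μ ≤ N ν

end Lattice

end

/-! ### The order `Y` in terms of sets of reals -/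

/-- `a` is the least element of the symmetric difference of `A` and `B`, and it lies in `B`. -/
def IsFirstDiff (A B : Set ℝ) (a : ℝ) : Prop :=
  a ∈ B ∧ a ∉ A ∧ ∀ c < a, (c ∈ A ↔ c ∈ B)

namespace OrderY

/-- The set of values of a transfinite sequence. -/
def values (x : OrderY) : Set ℝ := Set.range x.seq

theorem mem_values {x : OrderY} {c : ℝ} :
    c ∈ x.values ↔ ∃ (ξ : Ordinal) (h : ξ ≤ x.len), x.seq ⟨ξ, h⟩ = c :=
  ⟨fun ⟨ξ, h⟩ => ⟨ξ.1, ξ.2, h⟩, fun ⟨ξ, h, e⟩ => ⟨⟨ξ, h⟩, e⟩⟩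

theorem seq_mem_values (x : OrderY) {ξ : Ordinal} (h : ξ ≤ x.len) : x.seq ⟨ξ, h⟩ ∈ x.values :=
  ⟨_, rfl⟩

theorem seq_lt_seq (x : OrderY) {ξ η : Ordinal} {hξ : ξ ≤ x.len} {hη : η ≤ x.len} :
    x.seq ⟨ξ, hξ⟩ < x.seq ⟨η, hη⟩ ↔ ξ < η := by
  rw [x.strictMono.lt_iff_lt]; rfl

theorem isCompact_values (x : OrderY) : IsCompact x.values := by
  have : CompactSpace (Set.Iic x.len) := by
    rw [← isCompact_iff_compactSpace, ← Set.Icc_bot]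
    exact isCompact_Icc
  exact isCompact_range x.continuous

theorem exists_isFirstDiff {x y : OrderY} (h : x < y) :
    ∃ a, IsFirstDiff x.values y.values a := by
  rcases h with ⟨hlen, heq⟩ | ⟨α, hαx, hαy, heq, hlt⟩
  · have hs : Order.succ x.len ≤ y.len := Order.succ_le_of_lt hlen
    refine ⟨y.seq ⟨_, hs⟩, y.seq_mem_values hs, ?_, fun c hc => ?_⟩
    · rw [mem_values]
      rintro ⟨ξ, hξ, e⟩
      rw [heq ξ hξ (hξ.trans hlen.le)] at e
      have := congrArg Subtype.val (y.strictMono.injective e)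
      simp only at this
      exact absurd (this ▸ hξ) (not_le.2 (Order.lt_succ _))
    · constructor
      · rw [mem_values]
        rintro ⟨ξ, hξ, e⟩
        rw [← e, heq ξ hξ (hξ.trans hlen.le)]
        exact y.seq_mem_values _
      · rw [mem_values]
        rintro ⟨ξ, hξ, e⟩
        rw [← e, seq_lt_seq, Order.lt_succ_iff] at hc
        rw [← e, ← heq ξ hc hξ]
        exact x.seq_mem_values _
  · refine ⟨y.seq ⟨_, hαy⟩, y.seq_mem_values hαy, ?_, fun c hc => ?_⟩
    · rw [mem_values]
      rintro ⟨ξ, hξ, e⟩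
      have h1 : ξ < α := by rwa [← e, seq_lt_seq] at hlt
      have h2 := heq ξ h1
      rw [e] at h2
      have := congrArg Subtype.val (y.strictMono.injective h2)
      simp only at this
      exact h1.ne this.symm
    · constructor
      · rw [mem_values]
        rintro ⟨ξ, hξ, e⟩
        have h1 : ξ < α := by
          have := hc.trans hlt
          rwa [← e, seq_lt_seq] at this
        rw [← e, heq ξ h1]
        exact y.seq_mem_values _
      · rw [mem_values]
        rintro ⟨ξ, hξ, e⟩
        rw [← e, seq_lt_seq] at hc
        rw [← e, ← heq ξ hc]
        exact x.seq_mem_values _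

theorem lt_of_isFirstDiff {x y : OrderY} {a : ℝ} (h : IsFirstDiff x.values y.values a) :
    x < y := by
  obtain ⟨hay, hax, hag⟩ := h
  obtain ⟨α, hα, rfl⟩ := mem_values.1 hay
  have key : ∀ ξ (hξ : ξ < α), ∃ hx : ξ ≤ x.len, x.seq ⟨ξ, hx⟩ = y.seq ⟨ξ, hξ.le.trans hα⟩ := by
    intro ξ
    induction ξ using WellFoundedLT.induction with
    | ind ξ ih =>
      intro hξ
      have h1 : y.seq ⟨ξ, hξ.le.trans hα⟩ < y.seq ⟨α, hα⟩ := y.seq_lt_seq.2 hξ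
      obtain ⟨η, hη, e⟩ := mem_values.1 ((hag _ h1).2 (y.seq_mem_values _))
      have hle : ξ ≤ η := by
        by_contra! hlt
        obtain ⟨_, e'⟩ := ih η hlt (hlt.trans hξ)
        rw [e'] at e
        have := congrArg Subtype.val (y.strictMono.injective e)
        exact hlt.ne this
      refine ⟨hle.trans hη, ?_⟩
      have h2 : x.seq ⟨ξ, hle.trans hη⟩ ≤ y.seq ⟨ξ, hξ.le.trans hα⟩ := by
        rw [← e]; exact x.strictMono.monotone hle
      obtain ⟨ζ, hζ, e2⟩ := mem_values.1 ((hag _ (h2.trans_lt h1)).1 (x.seq_mem_values _))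
      rcases h2.eq_or_lt with h3 | h3
      · exact h3
      · rw [← e2, seq_lt_seq] at h3
        obtain ⟨_, e3⟩ := ih ζ h3 (h3.trans hξ)
        rw [← e3] at e2
        exact absurd (congrArg Subtype.val (x.strictMono.injective e2)) h3.ne
  by_cases hαx : α ≤ x.len
  · refine Or.inr ⟨α, hαx, hα, fun ξ hξ => (key ξ hξ).2, ?_⟩
    by_contra! hle
    rcases hle.eq_or_lt with he | hlt
    · exact hax (he ▸ x.seq_mem_values hαx)
    · obtain ⟨ζ, hζ, e⟩ := mem_values.1 ((hag _ hlt).1 (x.seq_mem_values _))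
      rw [← e, seq_lt_seq] at hlt
      obtain ⟨_, e3⟩ := key ζ hlt
      rw [← e3] at e
      exact absurd (congrArg Subtype.val (x.strictMono.injective e)) hlt.ne
  · push Not at hαx
    exact Or.inl ⟨hαx.trans_le hα, fun ξ hx _ => (key ξ (hx.trans_lt hαx)).2⟩

end OrderY

theorem Set.IsWF.countable_of_real {A : Set ℝ} (hA : A.IsWF) : A.Countable := by
  refine (countable_setOfPred_isolated_right_within (s := A)).mono fun a ha => ?_
  refine ⟨ha, ?_⟩
  by_cases hne : (A ∩ Set.Ioi a).Nonempty
  · have hwf : (A ∩ Set.Ioi a).IsWF := hA.mono Set.inter_subset_left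
    rw [← Filter.empty_mem_iff_bot, mem_nhdsWithin]
    exact ⟨Set.Iio (hwf.min hne), isOpen_Iio, (hwf.min_mem hne).2,
      fun c hc => hwf.not_lt_min hne hc.2 hc.1⟩
  · rw [Set.not_nonempty_iff_eq_empty.1 hne, nhdsWithin_empty]

namespace OrderY

variable {A : Set ℝ}

theorem exists_values_eq (hA : IsCompact A) (hwf : A.IsWF) (hne : A.Nonempty) :
    ∃ x : OrderY, x.values = A := by
  have hwo : IsWellOrder A (· < ·) :=
    { wf := hwf }
  let M : A := ⟨sSup A, hA.sSup_mem hne⟩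
  have hM : ∀ a : A, a ≤ M := fun a => le_csSup hA.bddAbove a.2
  let β : Ordinal.{0} := Ordinal.typein (α := A) (· < ·) M
  have hβ : β < ω₁ := by
    refine (Ordinal.typein_lt_type (α := A) (· < ·) M).trans ?_
    rw [← Cardinal.ord_aleph, Cardinal.lt_ord, ← Cardinal.succ_aleph0, Order.lt_succ_iff,
      Ordinal.card_type, Cardinal.mk_le_aleph0_iff]
    exact hwf.countable_of_real
  let f : A ≃o Set.Iic β := StrictMono.orderIsoOfSurjective
    (fun a => ⟨Ordinal.typein (α := A) (· < ·) a, by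
      rw [Set.mem_Iic, Ordinal.typein_le_typein]; exact not_lt.2 (hM a)⟩)
    (fun a b hab => (Ordinal.typein_lt_typein (α := A) (· < ·)).2 hab)
    (fun ξ => by
      obtain ⟨a, ha⟩ := Ordinal.typein_surj (α := A) (· < ·)
        (lt_of_le_of_lt ξ.2 (Ordinal.typein_lt_type (α := A) (· < ·) M))
      exact ⟨a, Subtype.ext ha⟩)
  have hf : Continuous f := by
    rw [OrderTopology.continuous_iff]
    intro ξ
    rw [OrderIso.preimage_Ioi, OrderIso.preimage_Iio]
    exact ⟨isOpen_Ioi, isOpen_Iio⟩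
  have : CompactSpace A := isCompact_iff_compactSpace.1 hA
  have hfs : Continuous f.symm :=
    (Continuous.homeoOfEquivCompactToT2 (f := f.toEquiv) hf).symm.continuous
  refine ⟨⟨β, hβ, fun ξ => f.symm ξ, fun a b hab => f.symm.strictMono hab,
    continuous_subtype_val.comp hfs⟩, ?_⟩
  ext c
  constructor
  · rintro ⟨ξ, rfl⟩
    exact (f.symm ξ).2
  · intro hc
    exact ⟨f ⟨c, hc⟩, by simp⟩

end OrderY

/-! ### Hausdorff trees with their order topology -/

/-- Hausdorff trees equipped with their order topology. -/
class HausdorffTree (Υ : Type*) [PartialOrder Υ] [τ : TopologicalSpace Υ] : Prop where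
  topology_eq : τ = treeTopology Υ
  isOrderTree : IsOrderTree Υ
  isHausdorffOrder : IsHausdorffOrder Υ

namespace HausdorffTree

open Set

variable {Υ : Type*} [PartialOrder Υ] [TopologicalSpace Υ] [HausdorffTree Υ]

instance wellFoundedLT : WellFoundedLT Υ := by
  refine ⟨⟨fun t => ⟨t, fun s hst => ?_⟩⟩⟩
  have hwo := isOrderTree t
  have key : ∀ u : Iic t, Acc (· < ·) (u : Υ) := fun u => by
    induction u using hwo.wf.induction with
    | h u ih => exact ⟨_, fun v hv => ih ⟨v, hv.le.trans u.2⟩ hv⟩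
  exact key ⟨s, hst.le⟩

theorem le_total_of_le {s r t : Υ} (hs : s ≤ t) (hr : r ≤ t) : s ≤ r ∨ r ≤ s := by
  have hwo := isOrderTree t
  by_contra! hcon
  have h := hwo.trichotomous ⟨s, hs⟩ ⟨r, hr⟩ (fun h => hcon.1 h.le) (fun h => hcon.2 h.le)
  exact hcon.1 (congrArg Subtype.val h).le

theorem lt_or_le_of_le {s r t : Υ} (hs : s ≤ t) (hr : r ≤ t) : s < r ∨ r ≤ s := by
  rcases le_total_of_le hs hr with h | h
  · exact h.lt_or_eq.imp_right fun e => e.ge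
  · exact Or.inr h

/-- The least element of a non-empty set of predecessors of `t`. -/
theorem exists_isLeast {t : Υ} {S : Set Υ} (hS : S ⊆ Iic t) (hne : S.Nonempty) :
    ∃ u, IsLeast S u := by
  obtain ⟨u, hu, hmin⟩ := wellFounded_lt.has_min S hne
  refine ⟨u, hu, fun v hv => ?_⟩
  rcases lt_or_le_of_le (hS hv) (hS hu) with h | h
  · exact absurd h (hmin v hv)
  · exact h

theorem exists_meet {x y l : Υ} (hx : l ≤ x) (hy : l ≤ y) :
    ∃ w, ∀ u, u ≤ x ∧ u ≤ y ↔ u ≤ w := by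
  by_contra! hcon
  let C : Set Υ := Iic x ∩ Iic y
  have hmin : ∀ z, C ⊆ Iic z → (∀ z' , C ⊆ Iic z' → z' ≤ z → z' ∉ C) →
      ∃ u, u ≤ z ∧ Minimal (· ∈ upperBounds C) u ∧ u ∉ C := by
    intro z hz hz'
    obtain ⟨u, ⟨hu1, hu2⟩, hu3⟩ := exists_isLeast (t := z) (S := {u | C ⊆ Iic u ∧ u ≤ z})
      (fun u hu => hu.2) ⟨z, hz, le_rfl⟩
    exact ⟨u, hu2, ⟨fun c hc => hu1 hc, fun v hv hvu => hu3 ⟨fun c hc => hv hc, hvu.trans hu2⟩⟩,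
      hz' u hu1 hu2⟩
  have hno : ∀ z', C ⊆ Iic z' → z' ∉ C := by
    intro z' hz' hzC
    obtain ⟨u, hu⟩ := hcon z'
    rcases hu with ⟨h1, h2⟩ | ⟨h1, h2⟩
    · exact h2 (hz' h1)
    · exact h1 (h2.trans hzC.1) (h2.trans hzC.2)
  obtain ⟨u, hux, hu, huC⟩ := hmin x (fun c hc => hc.1) fun z' h _ => hno z' h
  obtain ⟨v, hvy, hv, hvC⟩ := hmin y (fun c hc => hc.2) fun z' h _ => hno z' h
  have huv := isHausdorffOrder C ⟨l, hx, hy⟩ (fun a ha b hb _ => le_total_of_le ha.1 hb.1) u v hu hv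
  exact huC ⟨hux, huv ▸ hvy⟩

theorem isOpen_Iic (t : Υ) : IsOpen (Iic t) := by
  rw [topology_eq (Υ := Υ)]
  exact TopologicalSpace.isOpen_generateFrom_of_mem (Or.inr ⟨t, rfl⟩)

theorem isOpen_Ioc (s t : Υ) : IsOpen (Ioc s t) := by
  by_cases h : s < t
  · rw [topology_eq (Υ := Υ)]
    exact TopologicalSpace.isOpen_generateFrom_of_mem (Or.inl ⟨s, t, h, rfl⟩)
  · rw [Ioc_eq_empty h]; exact isOpen_empty

theorem isOpen_Ioi (s : Υ) : IsOpen (Ioi s) := by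
  rw [isOpen_iff_mem_nhds]
  exact fun x hx => Filter.mem_of_superset ((isOpen_Ioc s x).mem_nhds ⟨hx, le_rfl⟩) fun y hy => hy.1

/-- Convergence of a filter in terms of intervals. -/
theorem le_nhds_of_forall {f : Filter Υ} {s : Υ} (h₀ : Iic s ∈ f) (h : ∀ r < s, Ioc r s ∈ f) :
    f ≤ nhds s := by
  rw [topology_eq (Υ := Υ), TopologicalSpace.nhds_generateFrom]
  refine le_iInf₂ fun g hg => Filter.le_principal_iff.2 ?_
  rcases hg with ⟨hsg, ⟨a, b, -, rfl⟩ | ⟨b, rfl⟩⟩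
  · exact Filter.mem_of_superset (h a hsg.1) fun u hu => ⟨hu.1, hu.2.trans hsg.2⟩
  · exact Filter.mem_of_superset h₀ fun u hu => le_trans hu hsg

theorem exists_Ioc_subset {s : Υ} {U : Set Υ} (hU : U ∈ nhds s) :
    Iic s ⊆ U ∨ ∃ r < s, Ioc r s ⊆ U := by
  by_contra! hcon
  obtain ⟨h₀, h⟩ := hcon
  by_cases hmin : ∃ r, r < s
  · have hdir : Filter.HasBasis (⨅ r : Iio s, Filter.principal (Ioc (r : Υ) s)) (fun _ => True)
        (fun r : Iio s => Ioc (r : Υ) s) := by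
      have : Nonempty (Iio s) := hmin.elim fun r hr => ⟨⟨r, hr⟩⟩
      refine Filter.hasBasis_iInf_principal ?_
      intro a b
      rcases le_total_of_le a.2.le b.2.le with hab | hab
      · exact ⟨b, Ioc_subset_Ioc_left hab, subset_rfl⟩
      · exact ⟨a, subset_rfl, Ioc_subset_Ioc_left hab⟩
    have hle : (⨅ r : Iio s, Filter.principal (Ioc (r : Υ) s)) ≤ nhds s := by
      refine le_nhds_of_forall ?_ fun r hr => hdir.mem_of_mem (i := ⟨r, hr⟩) trivial
      obtain ⟨r, hr⟩ := hmin
      exact Filter.mem_of_superset (hdir.mem_of_mem (i := ⟨r, hr⟩) trivial) fun u hu => hu.2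
    obtain ⟨r, -, hr⟩ := hdir.mem_iff.1 (hle hU)
    exact h r r.2 hr
  · refine h₀ ?_
    push Not at hmin
    intro u hu
    rcases (show u ≤ s from hu).lt_or_eq with hlt | rfl
    · exact absurd hlt (hmin u)
    · exact mem_of_mem_nhds hU

instance t2Space : T2Space Υ := by
  refine ⟨fun x y hxy => ?_⟩
  have hlt : ∀ x y : Υ, x < y → ∃ u v : Set Υ, IsOpen u ∧ IsOpen v ∧ x ∈ u ∧ y ∈ v ∧ Disjoint u v :=
    fun x y h => ⟨Iic x, Ioi x, isOpen_Iic x, isOpen_Ioi x, le_rfl, h,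
      Set.disjoint_left.2 fun z hz hz' => absurd (lt_of_lt_of_le hz' hz) (lt_irrefl _)⟩
  by_cases hle : x ≤ y
  · exact hlt x y (hle.lt_of_ne hxy)
  by_cases hle' : y ≤ x
  · obtain ⟨u, v, hu, hv, h1, h2, h3⟩ := hlt y x (hle'.lt_of_ne' hxy)
    exact ⟨v, u, hv, hu, h2, h1, h3.symm⟩
  by_cases hl : ∃ l, l ≤ x ∧ l ≤ y
  · obtain ⟨l, hlx, hly⟩ := hl
    obtain ⟨w, hw⟩ := exists_meet hlx hly
    have hwx := (hw w).2 le_rfl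
    refine ⟨Ioc w x, Ioc w y, isOpen_Ioc _ _, isOpen_Ioc _ _, ⟨?_, le_rfl⟩, ⟨?_, le_rfl⟩, ?_⟩
    · exact hwx.1.lt_of_ne fun e => hle (e ▸ hwx.2)
    · exact hwx.2.lt_of_ne fun e => hle' (e ▸ hwx.1)
    · exact Set.disjoint_left.2 fun z hz hz' =>
        absurd ((hw z).1 ⟨hz.2, hz'.2⟩) (not_le_of_gt hz.1)
  · exact ⟨Iic x, Iic y, isOpen_Iic _, isOpen_Iic _, le_rfl, le_rfl,
      Set.disjoint_left.2 fun z hz hz' => hl ⟨z, hz, hz'⟩⟩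

theorem isCompact_Iic (t : Υ) : IsCompact (Iic t) := by
  rw [isCompact_iff_ultrafilter_le_nhds]
  intro f hf
  rw [Filter.le_principal_iff] at hf
  obtain ⟨s, ⟨hst, hsf⟩, hs⟩ := exists_isLeast (t := t) (S := {s | s ≤ t ∧ Iic s ∈ f})
    (fun s hs => hs.1) ⟨t, le_rfl, hf⟩
  refine ⟨s, hst, le_nhds_of_forall hsf fun r hr => ?_⟩
  have hrf : Iic r ∉ f := fun h => absurd (hs ⟨hr.le.trans hst, h⟩) (not_le_of_gt hr)
  have := Ultrafilter.compl_mem_iff_notMem.2 hrf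
  filter_upwards [this, hsf] with u hu hus
  exact ⟨(lt_or_le_of_le hr.le hus).resolve_right hu, hus⟩

theorem isClopen_Iic (t : Υ) : IsClopen (Iic t) := ⟨(isCompact_Iic t).isClosed, isOpen_Iic t⟩

instance locallyCompactSpace : LocallyCompactSpace Υ := by
  have : WeaklyLocallyCompactSpace Υ :=
    ⟨fun t => ⟨Iic t, isCompact_Iic t, (isOpen_Iic t).mem_nhds le_rfl⟩⟩
  infer_instance

end HausdorffTree

/-! ### Trees with a strictly increasing map into `Y` are Gruenhage spaces -/

theorem isGruenhage_of_countable {X ι : Type*} [TopologicalSpace X] [Countable ι] [Nonempty ι]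
    (𝒰 : ι → Set (Set X)) (ho : ∀ i, ∀ U ∈ 𝒰 i, IsOpen U)
    (h : ∀ x y : X, x ≠ y → ∃ i, ∃ U ∈ 𝒰 i, (∃ z, U ∩ {x, y} = {z}) ∧
      ({V | V ∈ 𝒰 i ∧ x ∈ V}.Finite ∨ {V | V ∈ 𝒰 i ∧ y ∈ V}.Finite)) :
    IsGruenhage X := by
  obtain ⟨f, hf⟩ := exists_surjective_nat ι
  refine ⟨fun n => 𝒰 (f n), fun n => ho _, fun x y hxy => ?_⟩
  obtain ⟨i, hi⟩ := h x y hxy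
  obtain ⟨n, rfl⟩ := hf i
  exact ⟨n, hi⟩

namespace HausdorffTree

open Set

variable {Υ : Type*} [PartialOrder Υ]

section Levels

variable (A : Υ → Set ℝ)

/-- `A s` and `A t` agree up to `p`. -/
def LevelEq (p : ℝ) (s t : Υ) : Prop := ∀ c ≤ p, (c ∈ A s ↔ c ∈ A t)

/-- `A t` meets the interval `(p, q)`. -/
def Hits (p q : ℝ) (t : Υ) : Prop := ∃ c ∈ A t, p < c ∧ c < q

/-- On the way from `r` to `z`, the point `z` is the first one at which `A` meets `(p, q)`, and
`A` does not change below `p`. -/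
def IsEntry (p q : ℝ) (z r : Υ) : Prop :=
  r < z ∧ LevelEq A p r z ∧ Hits A p q z ∧ ∀ u, r ≤ u → u < z → ¬ Hits A p q u

variable {A} (hA : ∀ s t, s < t → ∃ a, IsFirstDiff (A s) (A t) a)
include hA

theorem LevelEq.of_le_of_le {p : ℝ} {s u t : Υ} (h : LevelEq A p s t) (hsu : s ≤ u) (hut : u ≤ t) :
    LevelEq A p s u := by
  rcases hsu.lt_or_eq with hsu | rfl
  swap; · exact fun _ _ => Iff.rfl
  obtain ⟨a, ha1, ha2, ha3⟩ := hA s u hsu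
  intro c hc
  by_contra hne
  have hac : a ≤ c := by by_contra! hca; exact hne (ha3 c hca)
  have hat : a ∉ A t := fun h' => ha2 ((h a (hac.trans hc)).2 h')
  rcases hut.lt_or_eq with hut | rfl
  swap; · exact hat ha1
  obtain ⟨b, hb1, hb2, hb3⟩ := hA u t hut
  have hba : b < a := by
    rcases lt_trichotomy b a with h' | rfl | h'
    · exact h'
    · exact absurd ha1 hb2
    · exact absurd ((hb3 a h').1 ha1) hat
  exact hb2 ((ha3 b hba).1 ((h b (hba.le.trans (hac.trans hc))).2 hb1))

theorem Hits.of_levelEq {p q : ℝ} {s t : Υ} (hs : Hits A p q s) (hst : s ≤ t)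
    (h : LevelEq A p s t) : Hits A p q t := by
  rcases hst.lt_or_eq with hst | rfl
  swap; · exact hs
  obtain ⟨a, ha1, ha2, ha3⟩ := hA s t hst
  have hpa : p < a := by by_contra! hap; exact ha2 ((h a hap).2 ha1)
  obtain ⟨c, hc, hpc, hcq⟩ := hs
  rcases lt_or_ge c a with hca | hac
  · exact ⟨c, (ha3 c hca).1 hc, hpc, hcq⟩
  · exact ⟨a, ha1, hpa, hac.trans_lt hcq⟩

theorem exists_rat_hits {s t : Υ} (hst : s < t) (hcl : IsClosed (A s)) :
    ∃ p q : ℚ, LevelEq A p s t ∧ Hits A p q t ∧ ¬ Hits A p q s := by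
  obtain ⟨a, ha1, ha2, ha3⟩ := hA s t hst
  obtain ⟨l, u, ⟨hl, hu⟩, hlu⟩ := mem_nhds_iff_exists_Ioo_subset.1 (hcl.isOpen_compl.mem_nhds ha2)
  obtain ⟨p, hp1, hp2⟩ := exists_rat_btwn hl
  obtain ⟨q, hq1, hq2⟩ := exists_rat_btwn hu
  exact ⟨p, q, fun c hc => ha3 c (hc.trans_lt hp2), ⟨a, ha1, hp2, hq1⟩,
    fun ⟨c, hc, hpc, hcq⟩ => hlu ⟨hp1.trans hpc, hcq.trans hq2⟩ hc⟩

variable [TopologicalSpace Υ] [HausdorffTree Υ]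

theorem exists_isEntry {p q : ℝ} {s t : Υ} (hst : s < t) (h : LevelEq A p s t)
    (ht : Hits A p q t) (hs : ¬ Hits A p q s) :
    ∃ z, IsEntry A p q z s ∧ z ≤ t ∧ LevelEq A p z t := by
  obtain ⟨z, ⟨hsz, hzt, hz⟩, hmin⟩ := exists_isLeast (t := t)
    (S := {u | s < u ∧ u ≤ t ∧ Hits A p q u}) (fun u hu => hu.2.1) ⟨t, hst, le_rfl, ht⟩
  have hl := h.of_le_of_le hA hsz.le hzt
  refine ⟨z, ⟨hsz, hl, hz, fun u hsu huz hu => ?_⟩, hzt, fun c hc => (hl c hc).symm.trans (h c hc)⟩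
  rcases hsu.lt_or_eq with hsu | rfl
  · exact absurd (hmin ⟨hsu, huz.le.trans hzt, hu⟩) (not_le_of_gt huz)
  · exact hs hu

variable (A) in
omit hA in
/-- The open neighbourhood `(r, z] ∪ {u ≥ z | A u and A z agree up to p}` of `z`. -/
def entryNhd (p : ℝ) (z r : Υ) : Set Υ := Ioc r z ∪ {u | z ≤ u ∧ LevelEq A p z u}

theorem isOpen_entryNhd {p : ℝ} {z r : Υ} (hr : r < z) : IsOpen (entryNhd A p z r) := by
  rw [isOpen_iff_mem_nhds]
  rintro u (hu | ⟨hzu, hu⟩)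
  · exact Filter.mem_of_superset ((isOpen_Ioc r z).mem_nhds hu) subset_union_left
  · rcases hzu.lt_or_eq with hzu | rfl
    · exact Filter.mem_of_superset ((isOpen_Ioc z u).mem_nhds ⟨hzu, le_rfl⟩)
        fun v hv => Or.inr ⟨hv.1.le, hu.of_le_of_le hA hv.1.le hv.2⟩
    · exact Filter.mem_of_superset ((isOpen_Ioc r z).mem_nhds ⟨hr, le_rfl⟩) subset_union_left

theorem eq_of_mem_entryNhd {p q : ℝ} {x z z' r r' : Υ} (hx : Hits A p q x)
    (hz : IsEntry A p q z r) (hz' : IsEntry A p q z' r') (hxz : x ∈ entryNhd A p z r)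
    (hxz' : x ∈ entryNhd A p z' r') : z = z' := by
  have key : ∀ {z r}, IsEntry A p q z r → x ∈ entryNhd A p z r → z ≤ x ∧ LevelEq A p z x := by
    rintro z r hz (hu | hu)
    · rcases hu.2.lt_or_eq with h | rfl
      · exact absurd hx (hz.2.2.2 x hu.1.le h)
      · exact ⟨le_rfl, fun _ _ => Iff.rfl⟩
    · exact hu
  have key2 : ∀ {z z' r r'}, IsEntry A p q z r → IsEntry A p q z' r' → z' ≤ x →
      LevelEq A p z x → ¬ z < z' := by
    intro z z' r r' hz hz' hx' hlx hlt
    have hl := hlx.of_le_of_le hA hlt.le hx'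
    obtain ⟨v, hrv, hzv, hv⟩ : ∃ v, r' ≤ v ∧ z ≤ v ∧ v < z' := by
      rcases le_total_of_le hz'.1.le hlt.le with h | h
      · exact ⟨z, h, le_rfl, hlt⟩
      · exact ⟨r', le_rfl, h, hz'.1⟩
    exact hz'.2.2.2 v hrv hv (hz.2.2.1.of_levelEq hA hzv (hl.of_le_of_le hA hzv hv.le))
  obtain ⟨h1, h2⟩ := key hz hxz
  obtain ⟨h3, h4⟩ := key hz' hxz'
  rcases le_total_of_le h1 h3 with h | h
  · exact h.eq_of_not_lt (key2 hz hz' h3 h2)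
  · exact (h.eq_of_not_lt (key2 hz' hz h1 h4)).symm

/-- A tree carrying an assignment of closed sets of reals that is strictly increasing with respect
to first differences is a Gruenhage space. -/
theorem isGruenhage_of_isFirstDiff (hcl : ∀ t, IsClosed (A t)) : IsGruenhage Υ := by
  classical
  let R : ℝ → ℝ → Υ → Υ := fun p q z => if h : ∃ r, IsEntry A p q z r then h.choose else z
  have hR : ∀ {p q z r}, IsEntry A p q z r → IsEntry A p q z (R p q z) := by
    intro p q z r h
    have h' : ∃ r, IsEntry A p q z r := ⟨r, h⟩
    simp only [R, dif_pos h']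
    exact h'.choose_spec
  let 𝒰 : Option ((ℚ × ℚ) × Bool) → Set (Set Υ) := fun i => match i with
    | none => {U | ∃ l : Υ, (∀ u, ¬ u < l) ∧ U = Ici l}
    | some ((p, q), true) => {U | ∃ z r, IsEntry A p q z r ∧ U = entryNhd A p z (R p q z)}
    | some ((p, q), false) => {U | ∃ z r, IsEntry A p q z r ∧ U = Ioo (R p q z) z}
  have hfin : ∀ {p q : ℚ} {x}, Hits A p q x → {V | V ∈ 𝒰 (some ((p, q), true)) ∧ x ∈ V}.Finite := by
    intro p q x hx
    refine Set.Subsingleton.finite ?_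
    rintro _ ⟨⟨z, r, hz, rfl⟩, hxz⟩ _ ⟨⟨z', r', hz', rfl⟩, hxz'⟩
    rw [eq_of_mem_entryNhd hA hx (hR hz) (hR hz') hxz hxz']
  have hsymm : ∀ {x y : Υ}, (∃ i, ∃ U ∈ 𝒰 i, (∃ z, U ∩ {x, y} = {z}) ∧
      ({V | V ∈ 𝒰 i ∧ x ∈ V}.Finite ∨ {V | V ∈ 𝒰 i ∧ y ∈ V}.Finite)) →
      ∃ i, ∃ U ∈ 𝒰 i, (∃ z, U ∩ {y, x} = {z}) ∧
      ({V | V ∈ 𝒰 i ∧ y ∈ V}.Finite ∨ {V | V ∈ 𝒰 i ∧ x ∈ V}.Finite) := by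
    rintro x y ⟨i, U, hU, h1, h2⟩
    exact ⟨i, U, hU, by rwa [Set.pair_comm], h2.symm⟩
  have hsing : ∀ {U : Set Υ} {x y : Υ}, x ∈ U → y ∉ U → ∃ z, U ∩ {x, y} = {z} := by
    intro U x y hx hy
    refine ⟨x, ?_⟩
    ext u
    simp only [mem_inter_iff, mem_insert_iff, mem_singleton_iff]
    constructor
    · rintro ⟨hu, rfl | rfl⟩
      · rfl
      · exact absurd hu hy
    · rintro rfl; exact ⟨hx, Or.inl rfl⟩
  have hlt : ∀ s t : Υ, s < t → ∃ i, ∃ U ∈ 𝒰 i, (∃ z, U ∩ {s, t} = {z}) ∧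
      ({V | V ∈ 𝒰 i ∧ s ∈ V}.Finite ∨ {V | V ∈ 𝒰 i ∧ t ∈ V}.Finite) := by
    intro s t hst
    obtain ⟨p, q, hl, ht, hs⟩ := exists_rat_hits hA hst (hcl s)
    obtain ⟨z, hz, hzt, hlz⟩ := exists_isEntry hA hst hl ht hs
    by_cases hsU : s ∈ entryNhd A p z (R p q z)
    · refine ⟨some ((p, q), false), _, ⟨z, s, hz, rfl⟩, hsing (x := s) ?_ ?_, Or.inr ?_⟩
      · rcases hsU with h | h
        · exact ⟨h.1, hz.1⟩
        · exact absurd h.1 (not_le_of_gt hz.1)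
      · exact fun h => absurd hzt (not_le_of_gt h.2)
      · convert Set.finite_empty
        rw [Set.eq_empty_iff_forall_notMem]
        rintro _ ⟨⟨z', r', hz', rfl⟩, h⟩
        exact (hR hz').2.2.2 t h.1.le h.2 ht
    · refine hsymm ⟨some ((p, q), true), _, ⟨z, s, hz, rfl⟩, hsing (x := t) ?_ hsU,
        Or.inl (hfin ht)⟩
      exact Or.inr ⟨hzt, hlz⟩
  refine isGruenhage_of_countable 𝒰 ?_ ?_
  · rintro (_ | ⟨⟨p, q⟩, _ | _⟩) U hU
    · obtain ⟨l, hl, rfl⟩ := hU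
      rw [isOpen_iff_mem_nhds]
      intro u hu
      refine Filter.mem_of_superset ((isOpen_Iic u).mem_nhds le_rfl) fun v hv => ?_
      exact (lt_or_le_of_le hv hu).resolve_left (hl v)
    · obtain ⟨z, r, hz, rfl⟩ := hU
      have : Ioo (R p q z) z = Ioc (R p q z) z ∩ {z}ᶜ := by
        ext u
        simp only [mem_Ioo, mem_inter_iff, mem_Ioc, mem_compl_iff, mem_singleton_iff]
        rw [lt_iff_le_and_ne (b := z)]
        tauto
      rw [this]
      exact (isOpen_Ioc _ _).inter isClosed_singleton.isOpen_compl
    · obtain ⟨z, r, hz, rfl⟩ := hU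
      exact isOpen_entryNhd hA (hR hz).1
  · intro x y hxy
    by_cases hle : x ≤ y
    · exact hlt x y (hle.lt_of_ne hxy)
    by_cases hle' : y ≤ x
    · exact hsymm (hlt y x (hle'.lt_of_ne' hxy))
    by_cases hcom : ∃ l, l ≤ x ∧ l ≤ y
    · obtain ⟨l, hlx, hly⟩ := hcom
      obtain ⟨w, hw⟩ := exists_meet hlx hly
      have hwxy := (hw w).2 le_rfl
      have hwx : w < x := hwxy.1.lt_of_ne fun e => hle (e ▸ hwxy.2)
      obtain ⟨p, q, hl, hx, hwn⟩ := exists_rat_hits hA hwx (hcl w)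
      obtain ⟨z, hz, hzx, hlz⟩ := exists_isEntry hA hwx hl hx hwn
      refine ⟨some ((p, q), true), _, ⟨z, w, hz, rfl⟩, hsing (x := x) (Or.inr ⟨hzx, hlz⟩) ?_,
        Or.inl (hfin hx)⟩
      rintro (h | h)
      · exact hle' (h.2.trans hzx)
      · exact absurd ((hw z).1 ⟨hzx, h.1⟩) (not_le_of_gt hz.1)
    · obtain ⟨l, hlx, hl⟩ := exists_isLeast (t := x) (S := Iic x) subset_rfl ⟨x, le_rfl⟩
      have hlmin : ∀ u, ¬ u < l := fun u hu =>
        absurd (hl (hu.le.trans hlx)) (not_le_of_gt hu)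
      refine ⟨none, Ici l, ⟨l, hlmin, rfl⟩, hsing (x := x) hlx fun h => hcom ⟨l, hlx, h⟩, Or.inl ?_⟩
      refine Set.Subsingleton.finite ?_
      rintro _ ⟨⟨m, hm, rfl⟩, hmx⟩ _ ⟨⟨m', hm', rfl⟩, hmx'⟩
      rcases le_total_of_le (show m ≤ x from hmx) (show m' ≤ x from hmx') with h | h
      · rw [h.eq_of_not_lt (hm' m)]
      · rw [h.eq_of_not_lt (hm m')]

end Levels

variable [TopologicalSpace Υ] [HausdorffTree Υ]

theorem isGruenhage_of_orderY (ρ : Υ → OrderY) (hρ : ∀ s t, s < t → ρ s < ρ t) :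
    IsGruenhage Υ :=
  isGruenhage_of_isFirstDiff (A := fun t => (ρ t).values)
    (fun s t hst => OrderY.exists_isFirstDiff (hρ s t hst))
    fun t => (ρ t).isCompact_values.isClosed

end HausdorffTree

/-! ### Interpolation in `C₀(X)` and functionals given by summable families -/

namespace ZeroAtInftyContinuousMap

open Set

variable {X : Type*} [TopologicalSpace X]

/-- A continuous function that vanishes off a compact set. -/
def ofIsCompact (f : X → ℝ) (hf : Continuous f) {K : Set X} (hK : IsCompact K)
    (h : ∀ x ∉ K, f x = 0) : C₀(X, ℝ) where
  toFun := f
  continuous_toFun := hf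
  zero_at_infty' := by
    refine tendsto_const_nhds.congr' ?_
    filter_upwards [hK.compl_mem_cocompact] with x hx
    exact (h x hx).symm

/-- The indicator function of a compact open set. -/
noncomputable def indicatorOne (K : Set X) (hK : IsClopen K) (hc : IsCompact K) : C₀(X, ℝ) :=
  ofIsCompact (K.indicator fun _ => 1) (continuous_const.indicator (by simp [hK.frontier_eq])) hc
    fun _ hx => indicator_of_notMem hx _

@[simp]
theorem indicatorOne_apply {K : Set X} {hK : IsClopen K} {hc : IsCompact K} (x : X) :
    indicatorOne K hK hc x = K.indicator (fun _ => (1 : ℝ)) x := rfl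

theorem abs_apply_le_norm (f : C₀(X, ℝ)) (x : X) : |f x| ≤ ‖f‖ := by
  rw [← Real.norm_eq_abs]
  exact f.toBCF.norm_coe_le_norm x

theorem norm_le_of_forall {f : C₀(X, ℝ)} {c : ℝ} (hc : 0 ≤ c) (h : ∀ x, |f x| ≤ c) : ‖f‖ ≤ c :=
  (BoundedContinuousFunction.norm_le hc).2 h

@[simp]
theorem sum_apply {ι : Type*} (s : Finset ι) (f : ι → C₀(X, ℝ)) (x : X) :
    (∑ i ∈ s, f i) x = ∑ i ∈ s, f i x := by
  classical
  induction s using Finset.induction_on with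
  | empty => simp
  | insert i s hi ih => rw [Finset.sum_insert hi, Finset.sum_insert hi, add_apply, ih]

theorem exists_bump [T2Space X] [LocallyCompactSpace X] {x : X} {U : Set X} (hU : IsOpen U)
    (hx : x ∈ U) :
    ∃ g : C₀(X, ℝ), g x = 1 ∧ (∀ y, 0 ≤ g y) ∧ (∀ y, g y ≤ 1) ∧ ∀ y ∉ U, g y = 0 := by
  obtain ⟨f, h1, h2, h3, h4⟩ := exists_continuous_one_zero_of_isCompact (isCompact_singleton (x := x))
    hU.isClosed_compl (by simpa using hx)
  refine ⟨ofIsCompact f f.continuous h3 fun y hy => image_eq_zero_of_notMem_tsupport hy, ?_,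
    fun y => (h4 y).1, fun y => (h4 y).2, fun y hy => h2 hy⟩
  exact h1 rfl

/-- Interpolation on a finite set, between two semicontinuous bounds. -/
theorem exists_interpolation [T2Space X] [LocallyCompactSpace X] {a b : X → ℝ}
    (ha : LowerSemicontinuous a) (hb : LowerSemicontinuous b) (ha₀ : ∀ x, 0 ≤ a x)
    (hb₀ : ∀ x, 0 ≤ b x) (F : Finset X) (c : X → ℝ)
    (hc : ∀ t ∈ F, c t = 0 ∨ (0 < c t ∧ c t < a t) ∨ (c t < 0 ∧ -c t < b t)) :
    ∃ f : C₀(X, ℝ), (∀ t ∈ F, f t = c t) ∧ ∀ x, -b x ≤ f x ∧ f x ≤ a x := by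
  classical
  obtain ⟨U, hU, hdisj⟩ := F.finite_toSet.t2_separation
  let V : X → Set X := fun t =>
    U t ∩ {x | c t = 0 ∨ (0 < c t ∧ c t < a x) ∨ (c t < 0 ∧ -c t < b x)}
  have hV : ∀ t, IsOpen (V t) := by
    intro t
    refine (hU t).2.inter ?_
    rcases lt_trichotomy (c t) 0 with h | h | h
    · have := hb.isOpen_preimage (-c t)
      simpa [h, h.ne, h.le, not_lt_of_gt h, preimage] using this
    · simp [h]
    · have := ha.isOpen_preimage (c t)
      simpa [h, h.ne', h.le, not_lt_of_gt h, preimage] using this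
  have hg : ∀ t, ∃ g : C₀(X, ℝ), (t ∈ F → g t = 1) ∧ (∀ y, 0 ≤ g y) ∧ (∀ y, g y ≤ 1) ∧
      ∀ y ∉ V t, g y = 0 := by
    intro t
    by_cases ht : t ∈ F
    · obtain ⟨g, h1, h2⟩ := exists_bump (hV t) ⟨(hU t).1, hc t ht⟩
      exact ⟨g, fun _ => h1, h2⟩
    · exact ⟨0, fun h => absurd h ht, by simp, by simp, by simp⟩
  choose g hg1 hg0 hgle hgV using hg
  have hone : ∀ t ∈ F, ∀ x ∈ V t, ∑ s ∈ F, c s * g s x = c t * g t x := by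
    intro t ht x hx
    refine Finset.sum_eq_single_of_mem t ht fun s hs hst => ?_
    rw [hgV s x fun hxs => ?_, mul_zero]
    exact Set.disjoint_left.1 (hdisj hs ht hst) hxs.1 hx.1
  refine ⟨∑ t ∈ F, c t • g t, fun t ht => ?_, fun x => ?_⟩
  · simp only [sum_apply, smul_apply, smul_eq_mul]
    rw [hone t ht t ⟨(hU t).1, hc t ht⟩, hg1 t ht, mul_one]
  · simp only [sum_apply, smul_apply, smul_eq_mul]
    by_cases hx : ∃ t ∈ F, x ∈ V t
    · obtain ⟨t, ht, hxt⟩ := hx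
      rw [hone t ht x hxt]
      have h0 := hg0 t x
      have h1 := hgle t x
      have ha0 := ha₀ x
      have hb0 := hb₀ x
      rcases hxt.2 with h | ⟨h, h'⟩ | ⟨h, h'⟩
      · rw [h]; constructor <;> linarith
      · constructor <;> nlinarith
      · constructor <;> nlinarith
    · push Not at hx
      rw [Finset.sum_eq_zero fun t ht => by rw [hgV t x (hx t ht), mul_zero]]
      exact ⟨neg_nonpos.2 (hb₀ x), ha₀ x⟩

/-- The functional `f ↦ ∑ m t * f t` can be made almost as large as possible on the order interval
between two semicontinuous bounds. -/
theorem exists_lt_tsum [T2Space X] [LocallyCompactSpace X] {m a b : X → ℝ} (hm : Summable m)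
    (ha : LowerSemicontinuous a) (hb : LowerSemicontinuous b) (ha₀ : ∀ x, 0 ≤ a x)
    (hb₀ : ∀ x, 0 ≤ b x) {B : ℝ} (haB : ∀ x, a x ≤ B) (hbB : ∀ x, b x ≤ B) {c : ℝ}
    (hc : c < ∑' t, (a t * (m t)⁺ + b t * (m t)⁻)) :
    ∃ f : C₀(X, ℝ), (∀ x, -b x ≤ f x ∧ f x ≤ a x) ∧ c < ∑' t, m t * f t := by
  set w : X → ℝ := fun t => a t * (m t)⁺ + b t * (m t)⁻ with hw
  have hw0 : ∀ t, 0 ≤ w t := fun t =>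
    add_nonneg (mul_nonneg (ha₀ t) (posPart_nonneg _)) (mul_nonneg (hb₀ t) (negPart_nonneg _))
  have hwle : ∀ t, w t ≤ B * |m t| := fun t => by
    rw [← posPart_add_negPart, mul_add]
    exact add_le_add (mul_le_mul_of_nonneg_right (haB t) (posPart_nonneg _))
      (mul_le_mul_of_nonneg_right (hbB t) (negPart_nonneg _))
  have hws : Summable w := Summable.of_nonneg_of_le hw0 hwle (hm.abs.mul_left B)
  set W := ∑' t, w t with hW
  set M := ∑' t, B * |m t| with hM
  have hT : 0 < (W - c) / 4 := by linarith
  set δ := (W - c) / 4 with hδ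
  obtain ⟨F, hF1, hF2⟩ : ∃ F : Finset X, W - δ < ∑ t ∈ F, w t ∧ M - δ < ∑ t ∈ F, B * |m t| := by
    have h1 := hws.hasSum.eventually (lt_mem_nhds (show W - δ < W by linarith))
    have h2 := (hm.abs.mul_left B).hasSum.eventually (lt_mem_nhds (show M - δ < M by linarith))
    exact (h1.and h2).exists
  have hFW : ∑ t ∈ F, w t ≤ W := hws.sum_le_tsum F fun t _ => hw0 t
  have hF0 : 0 ≤ ∑ t ∈ F, w t := Finset.sum_nonneg fun t _ => hw0 t
  obtain ⟨η, hη0, hη1, hηF⟩ : ∃ η : ℝ, 0 < η ∧ η < 1 ∧ η * ∑ t ∈ F, w t ≤ δ := by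
    have hW0 : 0 ≤ W := hF0.trans hFW
    refine ⟨δ / (W + 2 * δ + 1), by positivity, ?_, ?_⟩
    · rw [div_lt_one (by positivity)]; linarith
    · rw [div_mul_eq_mul_div, div_le_iff₀ (by positivity)]; nlinarith
  let k : X → ℝ := fun t => if 0 < m t then (1 - η) * a t else if m t < 0 then -((1 - η) * b t) else 0
  have hk : ∀ t, m t * k t = (1 - η) * w t := by
    intro t
    simp only [k, hw]
    rcases lt_trichotomy (m t) 0 with h | h | h
    · rw [if_neg (not_lt_of_gt h), if_pos h, posPart_eq_zero.2 h.le, negPart_eq_neg.2 h.le]; ring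
    · simp [h]
    · rw [if_pos h, posPart_eq_self.2 h.le, negPart_eq_zero.2 h.le]; ring
  obtain ⟨f, hfF, hf⟩ := exists_interpolation ha hb ha₀ hb₀ F k (by
    intro t _
    simp only [k]
    have h1 : 0 < 1 - η := by linarith
    split_ifs with h h'
    · rcases (ha₀ t).eq_or_lt with h0 | h0
      · left; rw [← h0, mul_zero]
      · right; left; exact ⟨mul_pos h1 h0, by nlinarith⟩
    · rcases (hb₀ t).eq_or_lt with h0 | h0
      · left; rw [← h0, mul_zero, neg_zero]
      · right; right; constructor
        · have := mul_pos h1 h0; linarith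
        · nlinarith
    · exact Or.inl rfl)
  refine ⟨f, hf, ?_⟩
  have hfB : ∀ t, |f t| ≤ B := fun t =>
    abs_le.2 ⟨by linarith [(hf t).1, hbB t], (hf t).2.trans (haB t)⟩
  have hmf : ∀ t, |m t * f t| ≤ B * |m t| := fun t => by
    rw [abs_mul, mul_comm]; exact mul_le_mul_of_nonneg_right (hfB t) (abs_nonneg _)
  have hmfs : Summable fun t => m t * f t :=
    Summable.of_norm_bounded (hm.abs.mul_left B) hmf
  have h1 : ∑ t ∈ F, (m t * f t + B * |m t|) ≤ ∑' t, (m t * f t + B * |m t|) :=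
    (hmfs.add (hm.abs.mul_left B)).sum_le_tsum F fun t _ => by
      linarith [neg_abs_le (m t * f t), hmf t]
  rw [hmfs.tsum_add (hm.abs.mul_left B), Finset.sum_add_distrib] at h1
  have h2 : ∑ t ∈ F, m t * f t = (1 - η) * ∑ t ∈ F, w t := by
    rw [Finset.mul_sum]
    exact Finset.sum_congr rfl fun t ht => by rw [hfF t ht, hk]
  rw [h2] at h1
  linarith

theorem summable_mul {m : X → ℝ} (hm : Summable m) (f : C₀(X, ℝ)) :
    Summable fun t => m t * f t :=
  Summable.of_norm_bounded (hm.abs.mul_left ‖f‖) fun t => by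
    rw [Real.norm_eq_abs, abs_mul, mul_comm]
    exact mul_le_mul_of_nonneg_right (f.abs_apply_le_norm t) (abs_nonneg _)

theorem abs_tsum_mul_le {m : X → ℝ} (hm : Summable m) (f : C₀(X, ℝ)) :
    |∑' t, m t * f t| ≤ (∑' t, |m t|) * ‖f‖ := by
  rw [← tsum_mul_right]
  refine (norm_tsum_le_tsum_norm (summable_mul hm f).norm).trans
    ((summable_mul hm f).norm.tsum_le_tsum (fun t => ?_) (hm.abs.mul_right ‖f‖))
  rw [Real.norm_eq_abs, abs_mul]
  exact mul_le_mul_of_nonneg_left (f.abs_apply_le_norm t) (abs_nonneg _)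

/-- The functional `f ↦ ∑ m t * f t`. -/
noncomputable def ofMass (m : X → ℝ) (hm : Summable m) : StrongDual ℝ C₀(X, ℝ) :=
  LinearMap.mkContinuous
    { toFun := fun f => ∑' t, m t * f t
      map_add' := fun f g => by
        simp only [add_apply, mul_add]
        exact (summable_mul hm f).tsum_add (summable_mul hm g)
      map_smul' := fun r f => by
        simp only [smul_apply, smul_eq_mul, RingHom.id_apply]
        rw [← tsum_mul_left]
        exact tsum_congr fun t => by ring }
    (∑' t, |m t|) fun f => abs_tsum_mul_le hm f

theorem ofMass_apply {m : X → ℝ} (hm : Summable m) (f : C₀(X, ℝ)) :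
    ofMass m hm f = ∑' t, m t * f t := rfl

end ZeroAtInftyContinuousMap

/-! ### The dual of `C₀(Υ)` for a tree `Υ` is `ℓ¹(Υ)` -/

namespace HausdorffTree

open Set ZeroAtInftyContinuousMap

variable {Υ : Type*} [PartialOrder Υ] [TopologicalSpace Υ] [HausdorffTree Υ]

/-- The indicator function of `(0, t]`. -/
noncomputable def ind (t : Υ) : C₀(Υ, ℝ) := indicatorOne (Iic t) (isClopen_Iic t) (isCompact_Iic t)

theorem ind_apply (t x : Υ) : ind t x = (Iic t).indicator (fun _ => (1 : ℝ)) x := rfl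

theorem ind_of_le {t x : Υ} (h : x ≤ t) : ind t x = 1 := by
  rw [ind_apply, indicator_of_mem (s := Iic t) h]

theorem ind_of_not_le {t x : Υ} (h : ¬ x ≤ t) : ind t x = 0 := by
  rw [ind_apply, indicator_of_notMem (s := Iic t) h]

theorem eq_zero_of_mem_span_ind {t : Υ} {g : C₀(Υ, ℝ)} (hg : g ∈ Submodule.span ℝ (ind '' Iic t))
    {x : Υ} (hx : ¬ x ≤ t) : g x = 0 := by
  induction hg using Submodule.span_induction with
  | mem g hg =>
    obtain ⟨r, hr, rfl⟩ := hg
    exact ind_of_not_le fun h => hx (h.trans hr)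
  | zero => rfl
  | add f g _ _ hf hg => rw [ZeroAtInftyContinuousMap.add_apply, hf, hg, add_zero]
  | smul c g _ hg => rw [ZeroAtInftyContinuousMap.smul_apply, hg, smul_zero]

theorem exists_step_approx (f : C₀(Υ, ℝ)) {ε : ℝ} (hε : 0 < ε) (t : Υ) :
    ∃ g ∈ Submodule.span ℝ (ind '' Iic t), ∀ x ≤ t, |f x - g x| ≤ ε := by
  induction t using WellFoundedLT.induction with
  | ind t ih =>
    have hU : {x | |f x - f t| < ε} ∈ nhds t := by
      have := Metric.continuous_iff'.1 f.continuous t ε hε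
      simp only [Real.dist_eq] at this
      exact this
    have hmem : ind t ∈ Submodule.span ℝ (ind '' Iic t) :=
      Submodule.subset_span ⟨t, le_rfl, rfl⟩
    rcases exists_Ioc_subset hU with h | ⟨r, hr, h⟩
    · refine ⟨f t • ind t, Submodule.smul_mem _ _ hmem, fun x hx => ?_⟩
      rw [ZeroAtInftyContinuousMap.smul_apply, ind_of_le hx, smul_eq_mul, mul_one]
      exact (h hx).le
    · obtain ⟨g, hg, hgr⟩ := ih r hr
      have hmono : ind '' Iic r ⊆ ind '' Iic t := image_mono (Iic_subset_Iic.2 hr.le)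
      refine ⟨g + f t • (ind t - ind r), Submodule.add_mem _ (Submodule.span_mono hmono hg)
        (Submodule.smul_mem _ _ (Submodule.sub_mem _ hmem
          (Submodule.subset_span ⟨r, hr.le, rfl⟩))), fun x hx => ?_⟩
      rw [ZeroAtInftyContinuousMap.add_apply, ZeroAtInftyContinuousMap.smul_apply,
        ZeroAtInftyContinuousMap.sub_apply, ind_of_le hx, smul_eq_mul]
      by_cases hxr : x ≤ r
      · rw [ind_of_le hxr, sub_self, mul_zero, add_zero]
        exact hgr x hxr
      · rw [ind_of_not_le hxr, eq_zero_of_mem_span_ind hg hxr, sub_zero, mul_one, zero_add]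
        exact (h ⟨(lt_or_le_of_le hr.le hx).resolve_right hxr, hx⟩).le

theorem mul_ind_mem_closure (f : C₀(Υ, ℝ)) (t : Υ) :
    f * ind t ∈ (Submodule.span ℝ (ind '' Iic t)).topologicalClosure := by
  rw [← SetLike.mem_coe, Submodule.topologicalClosure_coe, Metric.mem_closure_iff]
  intro ε hε
  obtain ⟨g, hg, hgt⟩ := exists_step_approx f (half_pos hε) t
  refine ⟨g, hg, ?_⟩
  rw [dist_eq_norm]
  refine (norm_le_of_forall (half_pos hε).le fun x => ?_).trans_lt (half_lt_self hε)
  rw [ZeroAtInftyContinuousMap.sub_apply, mul_apply]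
  by_cases hx : x ≤ t
  · rw [ind_of_le hx, mul_one]; exact hgt x hx
  · rw [ind_of_not_le hx, eq_zero_of_mem_span_ind hg hx]; simpa using (half_pos hε).le

theorem mem_closure_span_ind (S : Finset Υ) (f : C₀(Υ, ℝ)) (hf : ∀ x, (∀ t ∈ S, ¬ x ≤ t) → f x = 0) :
    f ∈ (Submodule.span ℝ (ind '' ⋃ t ∈ S, Iic t)).topologicalClosure := by
  classical
  induction S using Finset.induction_on generalizing f with
  | empty =>
    have : f = 0 := ext fun x => hf x (by simp)
    rw [this]; exact Submodule.zero_mem _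
  | insert t S ht ih =>
    have h1 : f - f * ind t ∈ (Submodule.span ℝ (ind '' ⋃ t ∈ S, Iic t)).topologicalClosure := by
      refine ih _ fun x hx => ?_
      rw [ZeroAtInftyContinuousMap.sub_apply, mul_apply]
      by_cases hxt : x ≤ t
      · rw [ind_of_le hxt, mul_one, sub_self]
      · rw [hf x (by simpa using ⟨hxt, hx⟩), zero_mul, sub_zero]
    have hm1 : ind '' (⋃ t ∈ S, Iic t) ⊆ ind '' (⋃ s ∈ insert t S, Iic s) :=
      image_mono (biUnion_subset_biUnion_left fun s hs => by simp [show s ∈ S from hs])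
    have hm2 : ind '' Iic t ⊆ ind '' (⋃ s ∈ insert t S, Iic s) :=
      image_mono (subset_biUnion_of_mem (u := fun s => Iic s)
        (show t ∈ insert t S by simp))
    have := Submodule.add_mem _
      (Submodule.topologicalClosure_mono (Submodule.span_mono hm1) h1)
      (Submodule.topologicalClosure_mono (Submodule.span_mono hm2) (mul_ind_mem_closure f t))
    rwa [sub_add_cancel] at this

theorem exists_finset_cover {K : Set Υ} (hK : IsCompact K) : ∃ S : Finset Υ, K ⊆ ⋃ t ∈ S, Iic t := by
  obtain ⟨S, hS⟩ := hK.elim_finite_subcover (fun t : Υ => Iic t) (fun t => isOpen_Iic t)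
    (fun x _ => mem_iUnion.2 ⟨x, le_rfl⟩)
  exact ⟨S, hS⟩

theorem isClopen_biUnion_Iic (S : Finset Υ) : IsClopen (⋃ t ∈ S, Iic t) :=
  S.finite_toSet.isClopen_biUnion fun t _ => isClopen_Iic t

theorem isCompact_biUnion_Iic (S : Finset Υ) : IsCompact (⋃ t ∈ S, Iic t) :=
  S.finite_toSet.isCompact_biUnion fun t _ => isCompact_Iic t

theorem closure_span_ind : (Submodule.span ℝ (range (ind : Υ → C₀(Υ, ℝ)))).topologicalClosure = ⊤ := by
  rw [eq_top_iff]
  intro f _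
  rw [← SetLike.mem_coe, ← (Submodule.isClosed_topologicalClosure _).closure_eq,
    Metric.mem_closure_iff]
  intro ε hε
  have hf := f.zero_at_infty'
  have hev : ∀ᶠ x in Filter.cocompact Υ, |f x| < ε / 2 := by
    have := hf.eventually (Metric.ball_mem_nhds 0 (half_pos hε))
    simpa [Real.dist_eq] using this
  obtain ⟨K, hK, hKf⟩ := Filter.mem_cocompact.1 hev
  obtain ⟨S, hS⟩ := exists_finset_cover hK
  refine ⟨f * indicatorOne _ (isClopen_biUnion_Iic S) (isCompact_biUnion_Iic S),
    Submodule.topologicalClosure_mono (Submodule.span_mono (image_subset_range _ _))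
      (mem_closure_span_ind S _ fun x hx => ?_), ?_⟩
  · rw [mul_apply, indicatorOne_apply, indicator_of_notMem, mul_zero]
    simpa using hx
  · rw [dist_eq_norm]
    refine (norm_le_of_forall (half_pos hε).le fun x => ?_).trans_lt (half_lt_self hε)
    rw [ZeroAtInftyContinuousMap.sub_apply, mul_apply, indicatorOne_apply]
    by_cases hx : x ∈ ⋃ t ∈ S, Iic t
    · rw [indicator_of_mem hx]; simpa using (half_pos hε).le
    · rw [indicator_of_notMem hx, mul_zero, sub_zero]
      exact (hKf (fun h => hx (hS h))).le

open Classical in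
/-- The mass of a functional at a point of the tree. -/
noncomputable def mass (μ : StrongDual ℝ C₀(Υ, ℝ)) : Υ → ℝ :=
  wellFounded_lt.fix fun t ih => μ (ind t) - ∑' s, if h : s < t then ih s h else 0

theorem mass_eq (μ : StrongDual ℝ C₀(Υ, ℝ)) (t : Υ) :
    mass μ t = μ (ind t) - ∑' s, (Iio t).indicator (mass μ) s := by
  rw [mass, WellFounded.fix_eq]
  congr 1

theorem tsum_abs_le_norm {m : Υ → ℝ} (hm : Summable m) {μ : StrongDual ℝ C₀(Υ, ℝ)} {K : Set Υ}
    (hK : IsOpen K) (hmK : ∀ x ∉ K, m x = 0)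
    (h : ∀ f : C₀(Υ, ℝ), (∀ x ∉ K, f x = 0) → μ f = ∑' t, m t * f t) :
    ∑' t, |m t| ≤ ‖μ‖ := by
  refine le_of_forall_lt fun c hc => ?_
  have hl : LowerSemicontinuous (K.indicator fun _ => (1 : ℝ)) :=
    hK.lowerSemicontinuous_indicator zero_le_one
  have h0 : ∀ x, 0 ≤ K.indicator (fun _ => (1 : ℝ)) x :=
    fun x => indicator_nonneg (fun _ _ => zero_le_one) x
  have h1 : ∀ x, K.indicator (fun _ => (1 : ℝ)) x ≤ 1 :=
    fun x => indicator_le_self' (f := fun _ => (1 : ℝ)) (fun _ _ => zero_le_one) x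
  obtain ⟨f, hf, hcf⟩ := exists_lt_tsum hm hl hl h0 h0 h1 h1 (c := c) (by
    refine hc.trans_le (le_of_eq (tsum_congr fun t => ?_))
    by_cases ht : t ∈ K
    · rw [indicator_of_mem ht, one_mul, one_mul, posPart_add_negPart]
    · simp [hmK t ht])
  have hfK : ∀ x ∉ K, f x = 0 := fun x hx => by
    have := hf x
    rw [indicator_of_notMem hx] at this
    linarith [this.1, this.2]
  rw [← h f hfK] at hcf
  have hf1 : ‖f‖ ≤ 1 := norm_le_of_forall zero_le_one fun x =>
    abs_le.2 ⟨by linarith [(hf x).1, h1 x], (hf x).2.trans (h1 x)⟩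
  calc c < μ f := hcf
    _ ≤ ‖μ‖ * ‖f‖ := (le_abs_self _).trans (μ.le_opNorm f)
    _ ≤ ‖μ‖ := mul_le_of_le_one_right (ContinuousLinearMap.opNorm_nonneg μ) hf1

theorem apply_ind_eq (μ : StrongDual ℝ C₀(Υ, ℝ)) {t : Υ}
    (ht : Summable ((Iic t).indicator (mass μ))) :
    μ (ind t) = ∑' s, (Iic t).indicator (mass μ) s := by
  classical
  have hdec : (Iic t).indicator (mass μ) =
      fun s => (Iio t).indicator (mass μ) s + ({t} : Set Υ).indicator (mass μ) s := by
    ext s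
    rw [← Iio_union_right, indicator_union_of_disjoint (by simp)]
  have h1 : Summable ((Iio t).indicator (mass μ)) := by
    have := ht.indicator (Iio t)
    rwa [indicator_indicator, inter_eq_left.2 Iio_subset_Iic_self] at this
  have h2 : HasSum (({t} : Set Υ).indicator (mass μ)) (mass μ t) := by
    convert hasSum_single t fun s hs => indicator_of_notMem (s := {t}) hs (mass μ)
    rw [indicator_of_mem (mem_singleton t)]
  rw [hdec, h1.tsum_add h2.summable, h2.tsum_eq, mass_eq μ t]
  ring

theorem sum_abs_mass_le {μ : StrongDual ℝ C₀(Υ, ℝ)} (S : Finset Υ)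
    (hS : ∀ t ∈ S, Summable ((Iic t).indicator (mass μ))) : ∑ t ∈ S, |mass μ t| ≤ ‖μ‖ := by
  classical
  set K : Set Υ := ⋃ t ∈ S, Iic t with hK
  have hsum : Summable (K.indicator (mass μ)) := by
    rw [← summable_abs_iff]
    refine Summable.of_nonneg_of_le (fun _ => abs_nonneg _) (fun x => ?_)
      (summable_sum fun t ht => (hS t ht).abs)
    by_cases hx : x ∈ K
    · obtain ⟨t, ht, hxt⟩ := mem_iUnion₂.1 hx
      rw [indicator_of_mem hx]
      refine le_trans (le_of_eq ?_) (Finset.single_le_sum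
        (f := fun i => |(Iic i).indicator (mass μ) x|) (fun _ _ => abs_nonneg _) ht)
      rw [indicator_of_mem hxt]
    · rw [indicator_of_notMem hx, abs_zero]
      exact Finset.sum_nonneg fun _ _ => abs_nonneg _
  have heq : ∀ f ∈ (Submodule.span ℝ (ind '' K)).topologicalClosure, μ f = ofMass _ hsum f := by
    intro f hf
    have hle : (Submodule.span ℝ (ind '' K)).topologicalClosure ≤
        LinearMap.ker (μ - ofMass _ hsum).toLinearMap := by
      refine Submodule.topologicalClosure_minimal _ ?_ (μ - ofMass _ hsum).isClosed_ker
      rw [Submodule.span_le]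
      rintro _ ⟨r, hr, rfl⟩
      obtain ⟨t, ht, hrt⟩ := mem_iUnion₂.1 hr
      have hr' : Summable ((Iic r).indicator (mass μ)) := by
        have := (hS t ht).indicator (Iic r)
        rwa [indicator_indicator, inter_eq_left.2 (Iic_subset_Iic.2 hrt)] at this
      have hrK : Iic r ⊆ K := fun x hx => mem_iUnion₂.2 ⟨t, ht, le_trans hx hrt⟩
      simp only [SetLike.mem_coe, LinearMap.mem_ker, ContinuousLinearMap.coe_coe,
        _root_.sub_apply]
      rw [apply_ind_eq μ hr', ofMass_apply, sub_eq_zero]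
      refine tsum_congr fun x => ?_
      rw [ind_apply]
      by_cases hx : x ∈ Iic r
      · rw [indicator_of_mem hx, indicator_of_mem hx, indicator_of_mem (hrK hx), mul_one]
      · rw [indicator_of_notMem hx, indicator_of_notMem hx, mul_zero]
    have := hle hf
    simpa [sub_eq_zero] using this
  have hbound := tsum_abs_le_norm hsum (isClopen_biUnion_Iic S).isOpen
    (fun x hx => indicator_of_notMem hx _) (μ := μ) fun f hf =>
      heq f (mem_closure_span_ind S f fun x hx => hf x (by simpa using hx))
  refine le_trans ?_ hbound
  refine le_trans (le_of_eq (Finset.sum_congr rfl fun t ht => ?_))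
    (hsum.abs.sum_le_tsum S fun _ _ => abs_nonneg _)
  rw [indicator_of_mem (mem_iUnion₂.2 ⟨t, ht, le_rfl⟩)]

theorem summable_indicator_mass (μ : StrongDual ℝ C₀(Υ, ℝ)) (t : Υ) :
    Summable ((Iic t).indicator (mass μ)) := by
  classical
  induction t using WellFoundedLT.induction with
  | ind t ih =>
    have h1 : Summable ((Iio t).indicator (mass μ)) := by
      rw [← summable_abs_iff]
      refine summable_of_sum_le (c := ‖μ‖) (fun _ => abs_nonneg _) fun S => ?_
      refine le_trans (le_of_eq ?_) (sum_abs_mass_le (S.filter (· < t))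
        fun s hs => ih s (Finset.mem_filter.1 hs).2)
      rw [Finset.sum_filter]
      refine Finset.sum_congr rfl fun s _ => ?_
      by_cases h : s < t
      · rw [if_pos h, indicator_of_mem (s := Iio t) h]
      · rw [if_neg h, indicator_of_notMem (s := Iio t) h, abs_zero]
    have h2 : Summable (({t} : Set Υ).indicator (mass μ)) :=
      (hasSum_single t fun s hs => indicator_of_notMem (s := {t}) hs (mass μ)).summable
    convert h1.add h2 using 1
    ext s
    rw [← Iio_union_right, indicator_union_of_disjoint (by simp)]

theorem summable_mass (μ : StrongDual ℝ C₀(Υ, ℝ)) : Summable (mass μ) := by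
  rw [← summable_abs_iff]
  exact summable_of_sum_le (fun _ => abs_nonneg _) fun S =>
    sum_abs_mass_le S fun t _ => summable_indicator_mass μ t

theorem ofMass_mass (μ : StrongDual ℝ C₀(Υ, ℝ)) : ofMass (mass μ) (summable_mass μ) = μ := by
  have hle : (⊤ : Submodule ℝ C₀(Υ, ℝ)) ≤
      LinearMap.ker (μ - ofMass _ (summable_mass μ)).toLinearMap := by
    rw [← closure_span_ind]
    refine Submodule.topologicalClosure_minimal _ ?_ (μ - ofMass _ _).isClosed_ker
    rw [Submodule.span_le]
    rintro _ ⟨r, rfl⟩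
    simp only [SetLike.mem_coe, LinearMap.mem_ker, ContinuousLinearMap.coe_coe,
      _root_.sub_apply]
    rw [apply_ind_eq μ (summable_indicator_mass μ r), ofMass_apply, sub_eq_zero]
    refine tsum_congr fun x => ?_
    rw [ind_apply]
    by_cases hx : x ∈ Iic r
    · rw [indicator_of_mem hx, indicator_of_mem hx, mul_one]
    · rw [indicator_of_notMem hx, indicator_of_notMem hx, mul_zero]
  ext f
  have := hle (Submodule.mem_top (x := f))
  simp only [LinearMap.mem_ker, ContinuousLinearMap.coe_coe,
      _root_.sub_apply, sub_eq_zero] at this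
  exact this.symm

theorem apply_eq_tsum (μ : StrongDual ℝ C₀(Υ, ℝ)) (f : C₀(Υ, ℝ)) :
    μ f = ∑' t, mass μ t * f t := by
  conv_lhs => rw [← ofMass_mass μ]
  rfl

theorem norm_eq_tsum (μ : StrongDual ℝ C₀(Υ, ℝ)) : ‖μ‖ = ∑' t, |mass μ t| := by
  refine le_antisymm ?_ ?_
  · refine μ.opNorm_le_bound (tsum_nonneg fun _ => abs_nonneg _) fun f => ?_
    rw [apply_eq_tsum]
    exact abs_tsum_mul_le (summable_mass μ) f
  · exact tsum_abs_le_norm (summable_mass μ) isOpen_univ (by simp) fun f _ => apply_eq_tsum μ f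

theorem eq_zero_of_forall_tsum_eq_zero {m : Υ → ℝ} (hm : Summable m)
    (h : ∀ f : C₀(Υ, ℝ), ∑' t, m t * f t = 0) : m = 0 := by
  have h1 := tsum_abs_le_norm hm isOpen_univ (by simp) (μ := 0)
    fun f _ => by rw [h f]; rfl
  rw [ContinuousLinearMap.opNorm_zero] at h1
  ext t
  have := hm.abs.le_tsum t fun _ _ => abs_nonneg _
  exact abs_nonpos_iff.1 (this.trans h1)

theorem mass_eq_of_forall {m : Υ → ℝ} (hm : Summable m) {μ : StrongDual ℝ C₀(Υ, ℝ)}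
    (h : ∀ f : C₀(Υ, ℝ), μ f = ∑' t, m t * f t) : mass μ = m := by
  refine sub_eq_zero.1 (eq_zero_of_forall_tsum_eq_zero ((summable_mass μ).sub hm) fun f => ?_)
  simp only [Pi.sub_apply, sub_mul]
  rw [(summable_mul (summable_mass μ) f).tsum_sub (summable_mul hm f), ← apply_eq_tsum, h, sub_self]

theorem mass_ofMass {m : Υ → ℝ} (hm : Summable m) : mass (ofMass m hm) = m :=
  mass_eq_of_forall hm fun f => ofMass_apply hm f

theorem mass_add (μ ν : StrongDual ℝ C₀(Υ, ℝ)) : mass (μ + ν) = mass μ + mass ν := by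
  refine mass_eq_of_forall ((summable_mass μ).add (summable_mass ν)) fun f => ?_
  simp only [add_mul]
  rw [(summable_mul (summable_mass μ) f).tsum_add (summable_mul (summable_mass ν) f),
    ← apply_eq_tsum, ← apply_eq_tsum]
  rfl

theorem mass_smul (c : ℝ) (μ : StrongDual ℝ C₀(Υ, ℝ)) : mass (c • μ) = c • mass μ := by
  refine mass_eq_of_forall ((summable_mass μ).mul_left c) fun f => ?_
  simp only [mul_assoc]
  rw [tsum_mul_left, ← apply_eq_tsum]
  rfl

theorem mass_injective : Function.Injective (mass : StrongDual ℝ C₀(Υ, ℝ) → Υ → ℝ) := by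
  intro μ ν h
  ext f
  rw [apply_eq_tsum, apply_eq_tsum, h]

theorem dualModulus_eq (μ : StrongDual ℝ C₀(Υ, ℝ)) {f : C₀(Υ, ℝ)} (hf : ∀ t, 0 ≤ f t) :
    dualModulus μ f = ∑' t, |mass μ t| * f t := by
  have hs : Summable fun t => |mass μ t| * f t := summable_mul (summable_mass μ).abs f
  have hub : ∀ r ∈ {r : ℝ | ∃ g : C₀(Υ, ℝ), (∀ t, |g t| ≤ f t) ∧ μ g = r},
      r ≤ ∑' t, |mass μ t| * f t := by
    rintro _ ⟨g, hg, rfl⟩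
    rw [apply_eq_tsum]
    refine (summable_mul (summable_mass μ) g).tsum_le_tsum (fun t => ?_) hs
    exact (le_abs_self _).trans (by
      rw [abs_mul]; exact mul_le_mul_of_nonneg_left (hg t) (abs_nonneg _))
  refine le_antisymm (csSup_le ⟨0, 0, by simpa using hf, map_zero μ⟩ hub) ?_
  refine le_of_forall_lt fun c hc => ?_
  obtain ⟨g, hg, hcg⟩ := exists_lt_tsum (summable_mass μ) f.continuous.lowerSemicontinuous
    f.continuous.lowerSemicontinuous hf hf (B := ‖f‖) (fun x => (le_abs_self _).trans
      (f.abs_apply_le_norm x)) (fun x => (le_abs_self _).trans (f.abs_apply_le_norm x)) (c := c) (by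
    refine hc.trans_le (le_of_eq (tsum_congr fun t => ?_))
    rw [← mul_add, posPart_add_negPart, mul_comm]; rfl)
  rw [← apply_eq_tsum] at hcg
  exact hcg.trans_le (le_csSup ⟨_, hub⟩ ⟨g, fun t => abs_le.2 (hg t), rfl⟩)

end HausdorffTree

/-! ### Sublinear functionals and their supporting functionals -/

section Sublinear

open scoped NNReal

variable {X : Type*} [NormedAddCommGroup X] [NormedSpace ℝ X]

/-- Sublinear functionals bounded above by a multiple of the norm. -/
structure IsBddSublinear (q : X → ℝ) : Prop where
  smul : ∀ c : ℝ, 0 < c → ∀ x, q (c • x) = c * q x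
  add_le : ∀ x y, q (x + y) ≤ q x + q y
  bound : ∃ C : ℝ, ∀ x, q x ≤ C * ‖x‖

namespace IsBddSublinear

variable {q : X → ℝ} (hq : IsBddSublinear q)
include hq

theorem map_zero : q 0 = 0 := by
  have := hq.smul 2 two_pos 0
  rw [smul_zero] at this
  linarith

theorem smul_of_nonneg {c : ℝ} (hc : 0 ≤ c) (x : X) : q (c • x) = c * q x := by
  rcases hc.eq_or_lt with rfl | hc
  · rw [zero_smul, zero_mul, hq.map_zero]
  · exact hq.smul c hc x

theorem neg_le (x : X) : -q (-x) ≤ q x := by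
  have := hq.add_le x (-x)
  rw [add_neg_cancel, hq.map_zero] at this
  linarith

theorem sub_le (x y : X) : q x - q y ≤ q (x - y) := by
  have := hq.add_le (x - y) y
  rw [sub_add_cancel] at this
  linarith

theorem exists_abs_le : ∃ C : ℝ, 0 < C ∧ ∀ x, |q x| ≤ C * ‖x‖ := by
  obtain ⟨C, hC⟩ := hq.bound
  have h : ∀ x, q x ≤ (|C| + 1) * ‖x‖ := fun x => (hC x).trans
    (mul_le_mul_of_nonneg_right ((le_abs_self C).trans (by linarith)) (norm_nonneg x))
  refine ⟨|C| + 1, by positivity, fun x => abs_le.2 ⟨?_, h x⟩⟩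
  have h1 := hq.neg_le x
  have h2 := h (-x)
  rw [norm_neg] at h2
  linarith

theorem abs_sub_le :
    ∃ C : ℝ, 0 < C ∧ ∀ x y, |q x - q y| ≤ C * ‖x - y‖ := by
  obtain ⟨C, hC0, hC⟩ := hq.exists_abs_le
  refine ⟨C, hC0, fun x y => abs_le.2 ⟨?_, ?_⟩⟩
  · have h1 := hq.sub_le y x
    have h2 := (le_abs_self _).trans (hC (y - x))
    rw [norm_sub_rev] at h2
    linarith
  · exact (hq.sub_le x y).trans ((le_abs_self _).trans (hC (x - y)))

theorem continuous : Continuous q := by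
  obtain ⟨C, hC0, hC⟩ := hq.abs_sub_le
  have : LipschitzWith ⟨C, hC0.le⟩ q := LipschitzWith.of_dist_le_mul fun x y => by
    rw [Real.dist_eq, dist_eq_norm]; exact hC x y
  exact this.continuous

theorem exists_dual_le : ∃ φ : StrongDual ℝ X, ∀ x, φ x ≤ q x := by
  obtain ⟨φ, -, hφ⟩ := exists_extension_of_le_sublinear (⊥ : X →ₗ.[ℝ] ℝ) q hq.smul hq.add_le (by
    rintro ⟨x, hx⟩
    obtain rfl : x = 0 := (Submodule.mem_bot ℝ).1 hx
    rw [hq.map_zero]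
    exact le_of_eq (LinearPMap.map_zero _))
  obtain ⟨C, -, hC⟩ := hq.exists_abs_le
  refine ⟨φ.mkContinuous C fun x => abs_le.2 ⟨?_, ?_⟩, hφ⟩
  · have := (hφ (-x)).trans ((le_abs_self _).trans (hC (-x)))
    rw [norm_neg, _root_.map_neg] at this
    linarith
  · exact (hφ x).trans ((le_abs_self _).trans (hC x))

/-- The directional derivative of a sublinear functional at `x`. -/
noncomputable def _root_.sublinearTilt (q : X → ℝ) (x y : X) : ℝ :=
  ⨅ t : ℝ≥0, (q (y + (t : ℝ) • x) - t * q x)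

theorem tilt_bddBelow (x y : X) :
    BddBelow (Set.range fun t : ℝ≥0 => q (y + (t : ℝ) • x) - t * q x) := by
  refine ⟨-q (-y), ?_⟩
  rintro _ ⟨t, rfl⟩
  have := hq.add_le (y + (t : ℝ) • x) (-y)
  rw [add_neg_cancel_comm, hq.smul_of_nonneg t.coe_nonneg] at this
  simp only
  linarith

theorem tilt_le (x y : X) {t : ℝ} (ht : 0 ≤ t) :
    sublinearTilt q x y ≤ q (y + t • x) - t * q x :=
  ciInf_le (hq.tilt_bddBelow x y) ⟨t, ht⟩

theorem tilt_le_self (x y : X) : sublinearTilt q x y ≤ q y := by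
  have := hq.tilt_le x y le_rfl
  rwa [zero_smul, add_zero, zero_mul, sub_zero] at this

theorem tilt_neg_le (x : X) : sublinearTilt q x (-x) ≤ -q x := by
  have := hq.tilt_le x (-x) zero_le_one
  rwa [one_smul, neg_add_cancel, hq.map_zero, one_mul, zero_sub] at this

theorem tilt (x : X) : IsBddSublinear (sublinearTilt q x) := by
  have key : ∀ c : ℝ, 0 < c → ∀ y, sublinearTilt q x (c • y) ≤ c * sublinearTilt q x y := by
    intro c hc y
    rw [← div_le_iff₀' hc]
    refine le_ciInf fun t => ?_
    rw [div_le_iff₀' hc]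
    refine (hq.tilt_le x (c • y) (mul_nonneg hc.le t.coe_nonneg)).trans (le_of_eq ?_)
    rw [mul_smul, ← smul_add, hq.smul c hc]
    ring
  refine ⟨fun c hc y => le_antisymm (key c hc y) ?_, fun y z => ?_, ?_⟩
  · have := key c⁻¹ (inv_pos.2 hc) (c • y)
    rwa [inv_smul_smul₀ hc.ne', le_inv_mul_iff₀ hc] at this
  · refine le_ciInf_add_ciInf fun s t => ?_
    refine (hq.tilt_le x (y + z) (add_nonneg s.coe_nonneg t.coe_nonneg)).trans ?_
    have := hq.add_le (y + (s : ℝ) • x) (z + (t : ℝ) • x)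
    rw [add_add_add_comm, ← add_smul] at this
    linarith
  · obtain ⟨C, hC⟩ := hq.bound
    exact ⟨C, fun y => (hq.tilt_le_self x y).trans (hC y)⟩

theorem exists_support (x : X) : ∃ φ : StrongDual ℝ X, (∀ y, φ y ≤ q y) ∧ φ x = q x := by
  obtain ⟨φ, hφ⟩ := (hq.tilt x).exists_dual_le
  have h1 : ∀ y, φ y ≤ q y := fun y => (hφ y).trans (hq.tilt_le_self x y)
  refine ⟨φ, h1, le_antisymm (h1 x) ?_⟩
  have := (hφ (-x)).trans (hq.tilt_neg_le x)
  rw [_root_.map_neg] at this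
  linarith

/-- A sublinear functional with a unique supporting functional at `x` is Gâteaux differentiable
at `x`. -/
theorem exists_hasLineDerivAt {x : X}
    (huniq : ∀ φ ψ : StrongDual ℝ X, (∀ y, φ y ≤ q y) → (∀ y, ψ y ≤ q y) → φ x = q x → ψ x = q x →
      φ = ψ) :
    ∃ D : StrongDual ℝ X, ∀ h : X, HasLineDerivAt ℝ q (D h) x h := by
  obtain ⟨D, hD, hDx⟩ := hq.exists_support x
  refine ⟨D, fun h => ?_⟩
  have htilt : ∀ h, sublinearTilt q x h = D h := by
    intro h
    obtain ⟨φ, hφ, hφh⟩ := (hq.tilt x).exists_support h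
    have h1 : ∀ y, φ y ≤ q y := fun y => (hφ y).trans (hq.tilt_le_self x y)
    have h2 : φ x = q x := by
      refine le_antisymm (h1 x) ?_
      have := (hφ (-x)).trans (hq.tilt_neg_le x)
      rw [_root_.map_neg] at this
      linarith
    rw [← hφh, huniq φ D h1 hD h2 hDx]
  have hupper : ∀ h, ∀ ε > 0, ∃ s₀ > 0, ∀ s, 0 < s → s < s₀ → q (x + s • h) - q x ≤ s * (D h + ε) := by
    intro h ε hε
    obtain ⟨t, ht⟩ := exists_lt_of_ciInf_lt (show sublinearTilt q x h < D h + ε by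
      rw [htilt]; linarith)
    refine ⟨1 / (t + 1), by positivity, fun s hs hst => ?_⟩
    rw [lt_div_iff₀ (by positivity)] at hst
    have h1 : 0 ≤ 1 - s * t := by linarith
    have h2 : x + s • h = s • (h + (t : ℝ) • x) + (1 - s * t) • x := by
      rw [smul_add, smul_smul, sub_smul, one_smul]; abel
    have h3 := hq.add_le (s • (h + (t : ℝ) • x)) ((1 - s * t) • x)
    rw [← h2, hq.smul s hs, hq.smul_of_nonneg h1] at h3
    nlinarith
  have hlower : ∀ h s, s * D h ≤ q (x + s • h) - q x := by
    intro h s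
    have := hD (x + s • h)
    rw [map_add, map_smul, hDx, smul_eq_mul] at this
    linarith
  rw [HasLineDerivAt, hasDerivAt_iff_isLittleO_nhds_zero, Asymptotics.isLittleO_iff]
  intro ε hε
  obtain ⟨s₁, hs₁, h₁⟩ := hupper h ε hε
  obtain ⟨s₂, hs₂, h₂⟩ := hupper (-h) ε hε
  filter_upwards [Metric.ball_mem_nhds (0 : ℝ) (lt_min hs₁ hs₂)] with s hs
  rw [mem_ball_zero_iff, Real.norm_eq_abs, lt_min_iff] at hs
  simp only [zero_add, zero_smul, add_zero, smul_eq_mul, Real.norm_eq_abs]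
  have hl := hlower h s
  rw [abs_of_nonneg (by linarith)]
  rcases lt_trichotomy s 0 with h0 | rfl | h0
  · rw [abs_of_neg h0] at hs ⊢
    have := h₂ (-s) (by linarith) hs.2
    rw [smul_neg, neg_smul, neg_neg, _root_.map_neg] at this
    linarith
  · simp
  · rw [abs_of_pos h0] at hs ⊢
    have := h₁ s h0 hs.1
    linarith

end IsBddSublinear

theorem IsEquivalentNorm.isBddSublinear {p : Seminorm ℝ X} (hp : IsEquivalentNorm p) :
    IsBddSublinear fun x => p x := by
  obtain ⟨c, C, -, -, h⟩ := hp
  refine ⟨fun c hc x => ?_, fun x y => map_add_le_add p x y, C, fun x => (h x).2⟩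
  rw [map_smul_eq_mul, Real.norm_of_nonneg hc.le]

end Sublinear

/-! ### Strictly convex dual norms and smoothness -/

section DualNorm

variable {X : Type*} [NormedAddCommGroup X] [NormedSpace ℝ X]

/-- `N` is the norm on `X*` dual to `p`. -/
def IsDualTo (N : Seminorm ℝ (StrongDual ℝ X)) (p : Seminorm ℝ X) : Prop :=
  ∀ φ : StrongDual ℝ X, IsLUB {r : ℝ | ∃ x, p x ≤ 1 ∧ φ x = r} (N φ)

theorem IsEquivalentNorm.pos {p : Seminorm ℝ X} (hp : IsEquivalentNorm p) {x : X} (hx : x ≠ 0) :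
    0 < p x := by
  obtain ⟨c, C, hc, -, h⟩ := hp
  exact (mul_pos hc (norm_pos_iff.2 hx)).trans_le (h x).1

/-- The supporting functionals of a cone of functionals are unique when the dual norm is strictly
convex. -/
theorem IsStrictlyConvexNorm.eq_of_support {N : Seminorm ℝ (StrongDual ℝ X)}
    (hsc : IsStrictlyConvexNorm (X := StrongDual ℝ X) N)
    {P : StrongDual ℝ X → Prop} (hPadd : ∀ φ ψ, P φ → P ψ → P (φ + ψ)) {x : X} {r : ℝ} (hr : 0 < r)
    (hle : ∀ φ, P φ → φ x ≤ N φ * r) {φ ψ : StrongDual ℝ X} (hPφ : P φ) (hPψ : P ψ)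
    (hφ : N φ ≤ 1) (hψ : N ψ ≤ 1) (hφx : φ x = r) (hψx : ψ x = r) : φ = ψ := by
  have key : ∀ χ, P χ → ∀ a : ℝ, χ x = a * r → a ≤ N χ := by
    intro χ hχ a ha
    have := hle χ hχ
    rw [ha] at this
    exact le_of_mul_le_mul_right this hr
  have h1 : N φ = 1 := le_antisymm hφ (key φ hPφ 1 (by rw [hφx, one_mul]))
  have h2 : N ψ = 1 := le_antisymm hψ (key ψ hPψ 1 (by rw [hψx, one_mul]))
  have h3 : N (φ + ψ) = 2 := by
    refine le_antisymm ?_ (key _ (hPadd φ ψ hPφ hPψ) 2 ?_)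
    · have := map_add_le_add N φ ψ
      rw [h1, h2] at this
      linarith
    · rw [_root_.add_apply, hφx, hψx]; ring
  exact hsc φ ψ (h1.trans h2.symm) (by rw [h2, h3]; norm_num)

namespace IsDualTo

variable {N : Seminorm ℝ (StrongDual ℝ X)} {p : Seminorm ℝ X} (hNp : IsDualTo N p)
include hNp

theorem apply_le (hp : IsEquivalentNorm p) (φ : StrongDual ℝ X) (x : X) : φ x ≤ N φ * p x := by
  by_cases hx : x = 0
  · simp [hx]
  have h0 := hp.pos hx
  have h1 : φ ((p x)⁻¹ • x) ≤ N φ := (hNp φ).1 ⟨_, by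
    rw [map_smul_eq_mul, Real.norm_of_nonneg (inv_nonneg.2 h0.le), inv_mul_cancel₀ h0.ne'], rfl⟩
  rw [map_smul, smul_eq_mul, inv_mul_le_iff₀ h0] at h1
  rwa [mul_comm]

theorem le_one {φ : StrongDual ℝ X} (h : ∀ x, φ x ≤ p x) : N φ ≤ 1 :=
  (hNp φ).2 (by rintro _ ⟨x, hx, rfl⟩; exact (h x).trans hx)

theorem isGateauxSmoothNorm (hp : IsEquivalentNorm p)
    (hsc : IsStrictlyConvexNorm (X := StrongDual ℝ X) N) : IsGateauxSmoothNorm p := by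
  intro x hx
  refine hp.isBddSublinear.exists_hasLineDerivAt fun φ ψ hφ hψ hφx hψx => ?_
  exact hsc.eq_of_support (P := fun _ => True) (fun _ _ _ _ => trivial)
    (hp.pos hx) (fun χ _ => hNp.apply_le hp χ x) trivial trivial
    (hNp.le_one hφ) (hNp.le_one hψ) hφx hψx

end IsDualTo

end DualNorm

namespace HausdorffTree

open Set ZeroAtInftyContinuousMap

variable {Υ : Type*} [PartialOrder Υ] [TopologicalSpace Υ] [HausdorffTree Υ]

/-- The predual of a dual lattice norm is a lattice norm. -/
theorem isLatticeNorm_of_dual {N : Seminorm ℝ (StrongDual ℝ C₀(Υ, ℝ))} {p : Seminorm ℝ C₀(Υ, ℝ)}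
    (hp : IsEquivalentNorm p) (hNp : IsDualTo N p) (hN : IsDualSpaceLatticeNorm N) :
    IsLatticeNorm p := by
  intro f g hfg
  obtain ⟨φ, hφ, hφf⟩ := hp.isBddSublinear.exists_support f
  have hs : Summable fun t => SignType.sign (g t) * |mass φ t| :=
    Summable.of_norm_bounded (summable_mass φ).abs fun t => by
      rw [norm_mul, Real.norm_eq_abs |mass φ t|, abs_abs]
      refine mul_le_of_le_one_left (abs_nonneg _) ?_
      rcases lt_trichotomy (g t) 0 with h | h | h <;> simp [h]
  set ψ := ofMass _ hs with hψ
  have habs : ∀ t, |mass ψ t| ≤ |mass φ t| := by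
    intro t
    rw [hψ, mass_ofMass, abs_mul, abs_abs]
    refine mul_le_of_le_one_left (abs_nonneg _) ?_
    rcases lt_trichotomy (g t) 0 with h | h | h <;> simp [h]
  have hNψ : N ψ ≤ N φ := by
    refine hN ψ φ fun k hk => ?_
    rw [dualModulus_eq ψ hk, dualModulus_eq φ hk]
    exact (summable_mul (summable_mass ψ).abs k).tsum_le_tsum
      (fun t => mul_le_mul_of_nonneg_right (habs t) (hk t)) (summable_mul (summable_mass φ).abs k)
  have h1 : φ f ≤ ψ g := by
    rw [apply_eq_tsum φ, apply_eq_tsum ψ]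
    refine (summable_mul (summable_mass φ) f).tsum_le_tsum (fun t => ?_)
      (summable_mul (summable_mass ψ) g)
    rw [hψ, mass_ofMass]
    calc mass φ t * f t ≤ |mass φ t| * |f t| := by rw [← abs_mul]; exact le_abs_self _
      _ ≤ |mass φ t| * |g t| := mul_le_mul_of_nonneg_left (hfg t) (abs_nonneg _)
      _ = SignType.sign (g t) * |mass φ t| * g t := by rw [← sign_mul_self (g t)]; ring
  calc p f = φ f := hφf.symm
    _ ≤ ψ g := h1
    _ ≤ N ψ * p g := hNp.apply_le hp ψ g
    _ ≤ 1 * p g := mul_le_mul_of_nonneg_right (hNψ.trans (hNp.le_one hφ)) (apply_nonneg p g)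
    _ = p g := one_mul _

theorem exists_smooth_lattice_norm {N : Seminorm ℝ (StrongDual ℝ C₀(Υ, ℝ))}
    (hN : IsEquivalentDualNorm N) (hsc : IsStrictlyConvexNorm (X := StrongDual ℝ C₀(Υ, ℝ)) N)
    (hl : IsDualSpaceLatticeNorm N) :
    ∃ p : Seminorm ℝ C₀(Υ, ℝ), IsEquivalentNorm p ∧ IsGateauxSmoothNorm p ∧ IsLatticeNorm p := by
  obtain ⟨-, p, hp, hNp⟩ := hN
  exact ⟨p, hp, IsDualTo.isGateauxSmoothNorm hNp hp hsc, isLatticeNorm_of_dual hp hNp hl⟩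

end HausdorffTree

/-! ### Smooth monotone sublinear functionals -/

section Monotone

open ZeroAtInftyContinuousMap

variable {Ω : Type*} [TopologicalSpace Ω]

/-- Sublinear functionals on `C₀(Ω)` that are, on the positive cone, monotone, bounded below by
a multiple of the norm, and Gâteaux differentiable away from zero. -/
structure IsSmoothMonotone (q : C₀(Ω, ℝ) → ℝ) : Prop where
  sublinear : IsBddSublinear q
  mono : ∀ f g : C₀(Ω, ℝ), (∀ t, 0 ≤ f t) → (∀ t, f t ≤ g t) → q f ≤ q g
  lower : ∃ c : ℝ, 0 < c ∧ ∀ f : C₀(Ω, ℝ), (∀ t, 0 ≤ f t) → c * ‖f‖ ≤ q f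
  smooth : ∀ f : C₀(Ω, ℝ), (∀ t, 0 ≤ f t) → f ≠ 0 → ∀ h, ∃ d, HasLineDerivAt ℝ q d f h

theorem isSmoothMonotone_of_lattice {p : Seminorm ℝ C₀(Ω, ℝ)} (hp : IsEquivalentNorm p)
    (hs : IsGateauxSmoothNorm p) (hl : IsLatticeNorm p) : IsSmoothMonotone fun f => p f where
  sublinear := hp.isBddSublinear
  mono f g hf hfg := hl f g fun t => by
    rw [abs_of_nonneg (hf t), abs_of_nonneg ((hf t).trans (hfg t))]; exact hfg t
  lower := by
    obtain ⟨c, C, hc, -, h⟩ := hp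
    exact ⟨c, hc, fun f _ => (h f).1⟩
  smooth f _ hf0 h := by
    obtain ⟨D, hD⟩ := hs f hf0
    exact ⟨D h, hD h⟩

/-- Evaluation at a point. -/
noncomputable def evalDual (t : Ω) : StrongDual ℝ C₀(Ω, ℝ) :=
  LinearMap.mkContinuous
    { toFun := fun f => f t
      map_add' := fun _ _ => rfl
      map_smul' := fun _ _ => rfl } 1 fun f => by
    rw [one_mul]; exact f.abs_apply_le_norm t

theorem exists_isSmoothMonotone {N : Seminorm ℝ (StrongDual ℝ C₀(Ω, ℝ))}
    (hN : IsEquivalentDualNorm N) (hsc : IsStrictlyConvexNorm (X := StrongDual ℝ C₀(Ω, ℝ)) N) :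
    ∃ q : C₀(Ω, ℝ) → ℝ, IsSmoothMonotone q := by
  obtain ⟨⟨c, C, hc, hC, hcC⟩, p, hp, hNp⟩ := hN
  replace hNp : IsDualTo N p := hNp
  let P : StrongDual ℝ C₀(Ω, ℝ) → Prop := fun μ => ∀ f : C₀(Ω, ℝ), (∀ t, 0 ≤ f t) → 0 ≤ μ f
  have hPadd : ∀ φ ψ, P φ → P ψ → P (φ + ψ) := fun φ ψ hφ hψ f hf => add_nonneg (hφ f hf) (hψ f hf)
  have hPsmul : ∀ c : ℝ, 0 ≤ c → ∀ φ, P φ → P (c • φ) :=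
    fun c hc φ hφ f hf => mul_nonneg hc (hφ f hf)
  let S : C₀(Ω, ℝ) → Set ℝ := fun f => {r | ∃ μ, P μ ∧ N μ ≤ 1 ∧ μ f = r}
  let q : C₀(Ω, ℝ) → ℝ := fun f => sSup (S f)
  have hSne : ∀ f, (S f).Nonempty := fun f => ⟨0, 0, fun _ _ => le_rfl, by simp, rfl⟩
  have hSle : ∀ f, ∀ r ∈ S f, r ≤ p f := by
    rintro f _ ⟨μ, -, hμ, rfl⟩
    exact (hNp.apply_le hp μ f).trans (mul_le_of_le_one_left (apply_nonneg p f) hμ)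
  have hSb : ∀ f, BddAbove (S f) := fun f => ⟨p f, hSle f⟩
  have hle : ∀ {μ}, P μ → N μ ≤ 1 → ∀ f, μ f ≤ q f := fun hP hμ f => le_csSup (hSb f) ⟨_, hP, hμ, rfl⟩
  have hqle : ∀ {f r}, (∀ μ, P μ → N μ ≤ 1 → μ f ≤ r) → q f ≤ r := fun h =>
    csSup_le (hSne _) (by rintro _ ⟨μ, hP, hμ, rfl⟩; exact h μ hP hμ)
  have hqp : ∀ f, q f ≤ p f := fun f => csSup_le (hSne f) (hSle f)
  have hsub : IsBddSublinear q := by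
    have key : ∀ c : ℝ, 0 < c → ∀ f, q (c • f) ≤ c * q f := fun c hc f => hqle fun μ hP hμ => by
      rw [map_smul, smul_eq_mul]
      exact mul_le_mul_of_nonneg_left (hle hP hμ f) hc.le
    refine ⟨fun c hc f => le_antisymm (key c hc f) ?_, fun f g => hqle fun μ hP hμ => ?_, ?_⟩
    · have := key c⁻¹ (inv_pos.2 hc) (c • f)
      rwa [inv_smul_smul₀ hc.ne', le_inv_mul_iff₀ hc] at this
    · rw [map_add]; exact add_le_add (hle hP hμ f) (hle hP hμ g)
    · obtain ⟨C, hC⟩ := hp.isBddSublinear.bound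
      exact ⟨C, fun f => (hqp f).trans (hC f)⟩
  have hmono : ∀ f g : C₀(Ω, ℝ), (∀ t, f t ≤ g t) → q f ≤ q g := fun f g hfg =>
    hqle fun μ hP hμ => by
      have := hP (g - f) fun t => sub_nonneg.2 (hfg t)
      rw [map_sub, sub_nonneg] at this
      exact this.trans (hle hP hμ g)
  have hlow : ∀ f : C₀(Ω, ℝ), (∀ t, 0 ≤ f t) → C⁻¹ * ‖f‖ ≤ q f := by
    intro f hf
    rw [inv_mul_le_iff₀ hC]
    have hq0 : 0 ≤ q f := by
      have := hle (μ := 0) (fun _ _ => le_rfl) (by simp) f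
      simpa using this
    refine norm_le_of_forall (mul_nonneg hC.le hq0) fun t => ?_
    rw [abs_of_nonneg (hf t), ← inv_mul_le_iff₀ hC]
    refine hle (μ := C⁻¹ • evalDual t) (hPsmul _ (inv_nonneg.2 hC.le) _ fun g hg => hg t) ?_ f
    rw [map_smul_eq_mul, Real.norm_of_nonneg (inv_nonneg.2 hC.le), inv_mul_le_iff₀ hC, mul_one]
    refine (hcC _).2.trans (mul_le_of_le_one_right hC.le ?_)
    exact LinearMap.mkContinuous_norm_le _ zero_le_one _
  refine ⟨q, hsub, fun f g _ => hmono f g, ⟨C⁻¹, inv_pos.2 hC, hlow⟩, fun f hf hf0 h => ?_⟩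
  have hq0 : 0 < q f := (mul_pos (inv_pos.2 hC) (norm_pos_iff.2 hf0)).trans_le (hlow f hf)
  have hPq : ∀ φ : StrongDual ℝ C₀(Ω, ℝ), (∀ g, φ g ≤ q g) → P φ := by
    intro φ hφ g hg
    have h1 := hφ (-g)
    have h2 : q (-g) ≤ q 0 := hmono _ _ fun t => by simpa using hg t
    rw [hsub.map_zero] at h2
    rw [map_neg] at h1
    linarith
  have hleN : ∀ φ, P φ → φ f ≤ N φ * q f := by
    intro φ hφ
    rcases (apply_nonneg N φ).eq_or_lt with h0 | h0
    · have := hNp.apply_le hp φ f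
      rw [← h0, zero_mul] at this ⊢
      exact this
    · have := hle (μ := (N φ)⁻¹ • φ) (hPsmul _ (inv_nonneg.2 h0.le) _ hφ) (by
        rw [map_smul_eq_mul, Real.norm_of_nonneg (inv_nonneg.2 h0.le), inv_mul_cancel₀ h0.ne']) f
      rw [_root_.smul_apply, smul_eq_mul, inv_mul_le_iff₀ h0] at this
      exact this
  obtain ⟨D, hD⟩ := hsub.exists_hasLineDerivAt (x := f) fun φ ψ hφ hψ hφf hψf =>
    hsc.eq_of_support hPadd hq0 hleN (hPq φ hφ) (hPq ψ hψ)
      (hNp.le_one fun g => (hφ g).trans (hqp g)) (hNp.le_one fun g => (hψ g).trans (hqp g)) hφf hψf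
  exact ⟨D h, hD h⟩

end Monotone

/-! ### From smooth monotone functionals to maps into `Y` -/

namespace HausdorffTree

open Set ZeroAtInftyContinuousMap

section Calculus

variable {X : Type*} [NormedAddCommGroup X] [NormedSpace ℝ X] {q : X → ℝ}

/-- The largest `v` with `q (f + v • e) ≤ 1 + ε * v`. -/
theorem sSup_raise (hq : IsBddSublinear q) {f e : X} {b c ε : ℝ} (hεc : ε < c)
    (hb : q (f + b • e) ≤ 1 + ε * b) (hlow : ∀ v, b ≤ v → c * v ≤ q (f + v • e)) {S : Set ℝ}
    (hS : ∀ v, v ∈ S ↔ b ≤ v ∧ q (f + v • e) ≤ 1 + ε * v) :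
    b ≤ sSup S ∧ q (f + sSup S • e) = 1 + ε * sSup S ∧ ∀ v ∈ S, v ≤ sSup S := by
  have hcont : Continuous fun v : ℝ => q (f + v • e) := hq.continuous.comp (by fun_prop)
  have hbdd : BddAbove S := by
    refine ⟨1 / (c - ε), fun v hv => ?_⟩
    obtain ⟨h1, h2⟩ := (hS v).1 hv
    rw [le_div_iff₀ (by linarith)]
    linarith [hlow v h1]
  have hne : S.Nonempty := ⟨b, (hS b).2 ⟨le_rfl, hb⟩⟩
  have hcl : IsClosed S := by
    have : S = {v | b ≤ v} ∩ {v | q (f + v • e) ≤ 1 + ε * v} := by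
      ext v; exact hS v
    rw [this]
    exact (isClosed_le continuous_const continuous_id).inter
      (isClosed_le hcont (by fun_prop))
  have hmem := (hS _).1 (hcl.csSup_mem hne hbdd)
  refine ⟨hmem.1, le_antisymm hmem.2 ?_, fun v hv => le_csSup hbdd hv⟩
  by_contra! hlt
  have hev : ∀ᶠ v in nhds (sSup S), q (f + v • e) < 1 + ε * v :=
    hcont.continuousAt.eventually_lt (by fun_prop) hlt
  obtain ⟨v, hv1, hv2⟩ := ((hev.filter_mono nhdsWithin_le_nhds).and
    (self_mem_nhdsWithin (a := sSup S) (s := Ioi (sSup S)))).exists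
  exact absurd (le_csSup hbdd ((hS v).2 ⟨hmem.1.trans (le_of_lt hv2), hv1.le⟩)) (not_le.2 hv2)

end Calculus

section Functions

variable {Ω : Type*} [TopologicalSpace Ω]

open Classical in
/-- The extension of `q` to all functions by zero. -/
noncomputable def extendFun (q : C₀(Ω, ℝ) → ℝ) (f : Ω → ℝ) : ℝ :=
  if h : ∃ g : C₀(Ω, ℝ), ⇑g = f then q h.choose else 0

theorem extendFun_eq {q : C₀(Ω, ℝ) → ℝ} {f : Ω → ℝ} (g : C₀(Ω, ℝ)) (h : ⇑g = f) :
    extendFun q f = q g := by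
  have h' : ∃ g : C₀(Ω, ℝ), ⇑g = f := ⟨g, h⟩
  rw [extendFun, dif_pos h']
  exact congrArg q (DFunLike.coe_injective (h'.choose_spec.trans h.symm))

theorem mul_le_of_apply_eq {q : C₀(Ω, ℝ) → ℝ} {c : ℝ}
    (hc : ∀ f : C₀(Ω, ℝ), (∀ t, 0 ≤ f t) → c * ‖f‖ ≤ q f) (hc0 : 0 < c) {f : C₀(Ω, ℝ)} (hf : ∀ t, 0 ≤ f t) {u : Ω} {v : ℝ} (hv : f u = v) :
    c * v ≤ q f := by
  refine le_trans (mul_le_mul_of_nonneg_left ?_ hc0.le) (hc f hf)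
  rw [← hv]
  exact (le_abs_self _).trans (f.abs_apply_le_norm u)

theorem add_smul_add_smul (f e : C₀(Ω, ℝ)) (b s : ℝ) : f + b • e + s • e = f + (b + s) • e := by
  ext x
  simp only [ZeroAtInftyContinuousMap.add_apply, ZeroAtInftyContinuousMap.smul_apply, smul_eq_mul]
  ring

end Functions

variable {Υ : Type*} [PartialOrder Υ]

section Plateau

/-- The supremum of `F` over the strict predecessors of `u`. -/
noncomputable def prevSup (F : Υ → ℝ) (u : Υ) : ℝ := sSup (F '' Iio u)

open Classical in
/-- The function equal to `F` before `u` and to `v` on `[u, t]`. -/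
noncomputable def plateau (F : Υ → ℝ) (u t : Υ) (v : ℝ) (s : Υ) : ℝ :=
  if s < u then F s else if s ≤ t then v else 0

variable {F F' : Υ → ℝ} {u t s : Υ} {v : ℝ}

theorem prevSup_congr (h : ∀ s < u, F s = F' s) : prevSup F u = prevSup F' u :=
  congrArg sSup (image_congr h)

theorem plateau_congr (h : ∀ s < u, F s = F' s) : plateau F u t = plateau F' u t := by
  ext v s
  unfold plateau
  split_ifs with h1 <;> first | exact h s h1 | rfl

theorem plateau_of_le (hut : u ≤ t) (hs : s ≤ u) :
    plateau F u t (F u) s = F s := by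
  rcases hs.lt_or_eq with h | rfl
  · rw [plateau, if_pos h]
  · rw [plateau, if_neg (lt_irrefl _), if_pos hut]

theorem plateau_of_not_le (hs : ¬ s ≤ u) (hst : s ≤ t) :
    plateau F u t v s = v := by
  rw [plateau, if_neg (fun h => hs h.le), if_pos hst]

theorem plateau_off (hut : u ≤ t) (hst : ¬ s ≤ t) :
    plateau F u t v s = 0 := by
  rw [plateau, if_neg (fun h => hst (h.le.trans hut)), if_neg hst]

theorem plateau_nonneg (hF : ∀ s < u, 0 ≤ F s) (hv : 0 ≤ v) (s : Υ) :
    0 ≤ plateau F u t v s := by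
  unfold plateau
  split_ifs with h1
  · exact hF s h1
  · exact hv
  · exact le_rfl

end Plateau

section Definitions

variable [TopologicalSpace Υ]

/-- The condition for a new value at `u`. -/
def RaiseAt (q : C₀(Υ, ℝ) → ℝ) (ε : ℝ) (F : Υ → ℝ) (u : Υ) : Prop :=
  Iio u = ∅ ∨ (∃ w, IsGreatest (Iio u) w) ∧
    extendFun q ((Iio u).indicator F) = 1 + ε * prevSup F u

/-- The admissible values at `u`. -/
def raiseSet (q : C₀(Υ, ℝ) → ℝ) (ε : ℝ) (F : Υ → ℝ) (u t : Υ) : Set ℝ :=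
  {v | prevSup F u ≤ v ∧ extendFun q (plateau F u t v) ≤ 1 + ε * v}

open Classical in
/-- The value at `u` determined by the values before `u`. -/
noncomputable def nextValue (q : C₀(Υ, ℝ) → ℝ) (ε : ℝ) (t : Υ) (F : Υ → ℝ) (u : Υ) : ℝ :=
  if RaiseAt q ε F u then sSup (raiseSet q ε F u t) else prevSup F u

variable {q : C₀(Υ, ℝ) → ℝ} {ε : ℝ} {F F' : Υ → ℝ} {u t : Υ}

theorem raiseAt_congr (h : ∀ s < u, F s = F' s) : RaiseAt q ε F u ↔ RaiseAt q ε F' u := by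
  have h' : (Iio u).indicator F = (Iio u).indicator F' := indicator_congr (s := Iio u) h
  rw [RaiseAt, RaiseAt, prevSup_congr h, h']

theorem raiseSet_congr (h : ∀ s < u, F s = F' s) : raiseSet q ε F u t = raiseSet q ε F' u t := by
  rw [raiseSet, raiseSet, prevSup_congr h, plateau_congr h]

theorem nextValue_congr (h : ∀ s < u, F s = F' s) :
    nextValue q ε t F u = nextValue q ε t F' u := by
  rw [nextValue, nextValue, raiseSet_congr h, prevSup_congr h]
  classical exact if_congr (raiseAt_congr h) rfl rfl

variable [HausdorffTree Υ]

open Classical in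
variable (q ε t) in
/-- The increasing step function on `(0, t]` that is raised, as far as `q ≤ 1 + ε * v` permits,
each time that the constraint becomes tight. -/
noncomputable def climb : Υ → ℝ :=
  wellFounded_lt.fix fun u ih => nextValue q ε t (fun s => if h : s < u then ih s h else 0) u

theorem climb_eq (u : Υ) : climb q ε t u = nextValue q ε t (climb q ε t) u := by
  conv_lhs => rw [climb, WellFounded.fix_eq]
  exact nextValue_congr fun s hs => dif_pos hs

theorem climb_of_raiseAt (h : RaiseAt q ε (climb q ε t) u) :
    climb q ε t u = sSup (raiseSet q ε (climb q ε t) u t) := by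
  rw [climb_eq, nextValue, if_pos h]

theorem climb_of_not_raiseAt (h : ¬ RaiseAt q ε (climb q ε t) u) :
    climb q ε t u = prevSup (climb q ε t) u := by
  rw [climb_eq, nextValue, if_neg h]

end Definitions

section Climb

variable [TopologicalSpace Υ] [HausdorffTree Υ] {q : C₀(Υ, ℝ) → ℝ} {c ε : ℝ} {t : Υ}

variable (q ε t) in
/-- `climb` is increasing and positive up to `u`, and its truncation at `u` satisfies the
constraint with equality. -/
def GoodAt (u : Υ) : Prop :=
  (∀ s < u, climb q ε t s ≤ climb q ε t u) ∧ 0 < climb q ε t u ∧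
    ∃ h : C₀(Υ, ℝ), ⇑h = plateau (climb q ε t) u t (climb q ε t u) ∧
      q h = 1 + ε * climb q ε t u

variable (hq : IsSmoothMonotone q) (hc : ∀ f : C₀(Υ, ℝ), (∀ t, 0 ≤ f t) → c * ‖f‖ ≤ q f)
  (hc0 : 0 < c) (hε0 : 0 < ε) (hεc : ε < c)
include hq in
/-- The functions `plateau F u t v` at a point `u` which is not a limit. -/
theorem exists_plateau {u : Υ} (hut : u ≤ t) (hpred : ∀ s < u, GoodAt q ε t s)
    (hu : Iio u = ∅ ∨ ∃ w, IsGreatest (Iio u) w) :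
    ∃ f e : C₀(Υ, ℝ), (∀ s, 0 ≤ f s) ∧ (∀ s, 0 ≤ e s) ∧ f u = 0 ∧ e u = 1 ∧
      (∀ v : ℝ, ⇑(f + v • e) = plateau (climb q ε t) u t v) ∧
      ⇑f = (Iio u).indicator (climb q ε t) ∧ 0 ≤ prevSup (climb q ε t) u ∧
      q (f + prevSup (climb q ε t) u • e) ≤ 1 + ε * prevSup (climb q ε t) u ∧
      ((Iio u = ∅ ∧ prevSup (climb q ε t) u = 0) ∨
        ∃ w, IsGreatest (Iio u) w ∧ prevSup (climb q ε t) u = climb q ε t w ∧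
          q (f + prevSup (climb q ε t) u • e) = 1 + ε * prevSup (climb q ε t) u) := by
  classical
  set F := climb q ε t with hF
  rcases hu with hu | ⟨w, hw⟩
  · have hlt : ∀ s, ¬ s < u := fun s hs => by
      have : s ∈ Iio u := hs
      rw [hu] at this
      exact this
    have hb : prevSup F u = 0 := by rw [prevSup, hu, image_empty, Real.sSup_empty]
    refine ⟨0, ind t, fun _ => le_rfl, fun s => ?_, rfl, ind_of_le hut, fun v => ?_, ?_, hb.ge, ?_,
      Or.inl ⟨hu, hb⟩⟩
    · rw [ind_apply]; exact indicator_nonneg (fun _ _ => zero_le_one) s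
    · ext s
      rw [zero_add, ZeroAtInftyContinuousMap.smul_apply, plateau, if_neg (hlt s), smul_eq_mul]
      split_ifs with h
      · rw [ind_of_le h, mul_one]
      · rw [ind_of_not_le h, mul_zero]
    · rw [hu, indicator_empty]; rfl
    · rw [hb, zero_smul, add_zero, hq.sublinear.map_zero]; simp
  · have hwu : w < u := hw.1
    have hwt : w ≤ t := hwu.le.trans hut
    have hiff : ∀ s, s < u ↔ s ≤ w := fun s => ⟨fun h => hw.2 h, fun h => h.trans_lt hwu⟩
    obtain ⟨hw1, hw2, h, hh, hqh⟩ := hpred w hwu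
    have hb : prevSup F u = F w := by
      refine IsGreatest.csSup_eq ⟨⟨w, hwu, rfl⟩, ?_⟩
      rintro _ ⟨s, hs, rfl⟩
      rcases ((hiff s).1 hs).lt_or_eq with h' | rfl
      · exact hw1 s h'
      · exact le_rfl
    have he : ∀ s, (ind t - ind w) s = if s ≤ w then 0 else if s ≤ t then 1 else 0 := by
      intro s
      rw [ZeroAtInftyContinuousMap.sub_apply]
      split_ifs with h1 h2
      · rw [ind_of_le h1, ind_of_le (h1.trans hwt), sub_self]
      · rw [ind_of_le h2, ind_of_not_le h1, sub_zero]
      · rw [ind_of_not_le h2, ind_of_not_le h1, sub_zero]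
    have hf : ∀ s, (h - F w • (ind t - ind w)) s = if s ≤ w then F s else 0 := by
      intro s
      rw [ZeroAtInftyContinuousMap.sub_apply, ZeroAtInftyContinuousMap.smul_apply, he, hh, smul_eq_mul]
      split_ifs with h1 h2
      · rw [plateau_of_le hwt h1, mul_zero, sub_zero]
      · rw [plateau_of_not_le h1 h2, mul_one, sub_self]
      · rw [plateau_off hwt h2, mul_zero, sub_zero]
    have hqb : q (h - F w • (ind t - ind w) + prevSup F u • (ind t - ind w)) =
        1 + ε * prevSup F u := by
      rw [hb, sub_add_cancel, hqh]
    have huw : ¬ u ≤ w := not_le_of_gt hwu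
    refine ⟨h - F w • (ind t - ind w), ind t - ind w, fun s => ?_, fun s => ?_, ?_, ?_, fun v => ?_,
      ?_, ?_, hqb.le, Or.inr ⟨w, hw, hb, hqb⟩⟩
    · rw [hf]
      split_ifs with h1
      · exact (hpred s ((hiff s).2 h1)).2.1.le
      · exact le_rfl
    · rw [he]; split_ifs <;> norm_num
    · rw [hf, if_neg huw]
    · rw [he, if_neg huw, if_pos hut]
    · ext s
      rw [ZeroAtInftyContinuousMap.add_apply, ZeroAtInftyContinuousMap.smul_apply, hf, he, plateau,
        smul_eq_mul]
      simp only [hiff]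
      split_ifs <;> ring
    · ext s
      rw [hf, indicator_apply]
      simp only [mem_Iio, hiff]
    · rw [hb]; exact hw2.le

include hc hc0 hεc

theorem GoodAt.le {u : Υ} (hu : GoodAt q ε t u) (hut : u ≤ t) (hpred : ∀ s < u, GoodAt q ε t s) :
    climb q ε t u ≤ 1 / (c - ε) := by
  obtain ⟨h1, h2, h, h3, h4⟩ := hu
  have := mul_le_of_apply_eq (f := h) hc hc0 (fun s => by
    rw [h3]; exact plateau_nonneg (fun r hr => (hpred r hr).2.1.le) h2.le s) (u := u)
    (v := climb q ε t u) (by rw [h3, plateau_of_le hut le_rfl])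
  rw [le_div_iff₀ (by linarith)]
  linarith

include hq

theorem raise_spec {u : Υ} (hut : u ≤ t) (hpred : ∀ s < u, GoodAt q ε t s)
    (hu : Iio u = ∅ ∨ ∃ w, IsGreatest (Iio u) w) :
    let b := sSup (raiseSet q ε (climb q ε t) u t)
    prevSup (climb q ε t) u ≤ b ∧
      (∃ h : C₀(Υ, ℝ), ⇑h = plateau (climb q ε t) u t b ∧ q h = 1 + ε * b) ∧
      ∀ v ∈ raiseSet q ε (climb q ε t) u t, v ≤ b := by
  obtain ⟨f, e, hf0, he0, hfu, heu, hfe, hf, hb0, hb, -⟩ := exists_plateau hq hut hpred hu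
  have hS : ∀ v, v ∈ raiseSet q ε (climb q ε t) u t ↔
      prevSup (climb q ε t) u ≤ v ∧ q (f + v • e) ≤ 1 + ε * v := fun v => by
    rw [raiseSet, mem_ofPred_eq, extendFun_eq _ (hfe v)]
  obtain ⟨h1, h2, h3⟩ := sSup_raise hq.sublinear hεc hb (fun v hv => by
    have hv0 : 0 ≤ v := hb0.trans hv
    refine mul_le_of_apply_eq hc hc0 (fun s => ?_) (u := u) ?_
    · exact add_nonneg (hf0 s) (mul_nonneg hv0 (he0 s))
    · rw [ZeroAtInftyContinuousMap.add_apply, ZeroAtInftyContinuousMap.smul_apply, hfu, heu,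
        smul_eq_mul, mul_one, zero_add]) hS
  exact ⟨h1, ⟨_, hfe _, h2⟩, h3⟩

include hε0

/-- Raising is strict. -/
theorem prevSup_lt_of_raiseAt {u : Υ} (hut : u ≤ t) (hpred : ∀ s < u, GoodAt q ε t s)
    (hu : RaiseAt q ε (climb q ε t) u) : prevSup (climb q ε t) u < climb q ε t u := by
  have hu' : Iio u = ∅ ∨ ∃ w, IsGreatest (Iio u) w := hu.imp_right And.left
  obtain ⟨f, e, hf0, he0, hfu, heu, hfe, hf, hb0, hb, hcase⟩ :=
    exists_plateau hq hut hpred hu'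
  obtain ⟨h1, ⟨h, h2, h3⟩, h4⟩ := raise_spec hq hc hc0 hεc hut hpred hu'
  rw [climb_of_raiseAt hu]
  set b := prevSup (climb q ε t) u with hbdef
  set v := sSup (raiseSet q ε (climb q ε t) u t) with hv
  rcases hcase with ⟨hemp, hb'⟩ | ⟨w, hw, hbw, hqb⟩
  · refine h1.lt_of_ne fun hbv => ?_
    have hh : h = f + v • e := DFunLike.coe_injective (h2.trans (hfe v).symm)
    have hf' : f = 0 := by
      ext s; rw [hf, hemp, indicator_empty]; rfl
    rw [hh, ← hbv, hb', hf', zero_smul, add_zero, hq.sublinear.map_zero] at h3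
    linarith
  · have hwu : w < u := hw.1
    have hbpos : 0 < b := by rw [hbw]; exact (hpred w hwu).2.1
    have hqf : q f = 1 + ε * b := by
      rcases hu with hu | ⟨-, hu⟩
      · exact absurd (show w ∈ Iio u from hwu) (by rw [hu]; exact notMem_empty w)
      · rwa [extendFun_eq f hf] at hu
    set g := f + b • e with hg
    have hg0 : ∀ s, 0 ≤ g s := fun s => add_nonneg (hf0 s) (mul_nonneg hb0 (he0 s))
    have hgne : g ≠ 0 := fun h0 => by
      have : g u = b := by
        rw [hg, ZeroAtInftyContinuousMap.add_apply, ZeroAtInftyContinuousMap.smul_apply, hfu, heu,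
          smul_eq_mul, mul_one, zero_add]
      rw [h0] at this
      exact hbpos.ne this
    obtain ⟨d, hd⟩ := hq.smooth g hg0 hgne e
    have hconst : ∀ s ∈ Icc (-b) 0, q (g + s • e) = 1 + ε * b := by
      intro s hs
      have hgs : g + s • e = f + (b + s) • e := add_smul_add_smul f e b s
      have hbs : 0 ≤ b + s := by linarith [hs.1]
      refine le_antisymm ?_ ?_
      · rw [← hqb, hgs]
        refine hq.mono _ _ (fun r => add_nonneg (hf0 r) (mul_nonneg hbs (he0 r))) fun r => ?_
        exact add_le_add le_rfl (mul_le_mul_of_nonneg_right (by linarith [hs.2]) (he0 r))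
      · rw [← hqf, hgs]
        exact hq.mono _ _ hf0 fun r => le_add_of_nonneg_right (mul_nonneg hbs (he0 r))
    have hd0 : d = 0 := by
      have h5 : HasDerivWithinAt (fun s : ℝ => q (g + s • e)) d (Icc (-b) 0) 0 :=
        HasDerivAt.hasDerivWithinAt hd
      have h6 : HasDerivWithinAt (fun s : ℝ => q (g + s • e)) 0 (Icc (-b) 0) 0 :=
        (hasDerivWithinAt_const (0 : ℝ) (Icc (-b) 0) (1 + ε * b)).congr hconst
          (hconst 0 ⟨by linarith, le_rfl⟩)
      exact (uniqueDiffOn_Icc (by linarith) 0 ⟨by linarith, le_rfl⟩).eq_deriv _ h5 h6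
    rw [hd0, HasLineDerivAt, hasDerivAt_iff_isLittleO_nhds_zero, Asymptotics.isLittleO_iff] at hd
    obtain ⟨s, hs1, hs2⟩ := (((hd hε0).filter_mono nhdsWithin_le_nhds).and
      (self_mem_nhdsWithin (a := (0 : ℝ)) (s := Ioi 0))).exists
    simp only [zero_add, zero_smul, add_zero, smul_zero, sub_zero, Real.norm_eq_abs] at hs1
    have hs0 : 0 < s := hs2
    rw [abs_of_pos hs0, hqb] at hs1
    have h7 := (le_abs_self _).trans hs1
    have h8 : b + s ∈ raiseSet q ε (climb q ε t) u t := by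
      refine ⟨by linarith, ?_⟩
      rw [extendFun_eq _ (hfe (b + s)), ← add_smul_add_smul]
      change q (g + s • e) - (1 + ε * b) ≤ ε * s at h7
      linarith
    linarith [h4 _ h8]

theorem goodAt {u : Υ} (hut : u ≤ t) : GoodAt q ε t u := by
  induction u using WellFoundedLT.induction with
  | ind u ih =>
  have hpred : ∀ s < u, GoodAt q ε t s := fun s hs => ih s hs (hs.le.trans hut)
  set F := climb q ε t with hF
  have hbdd : BddAbove (F '' Iio u) := by
    refine ⟨1 / (c - ε), ?_⟩
    rintro _ ⟨s, hs, rfl⟩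
    exact (hpred s hs).le hc hc0 hεc (hs.le.trans hut) fun r hr => hpred r (hr.trans hs)
  have hle : ∀ s < u, F s ≤ prevSup F u := fun s hs => le_csSup hbdd ⟨s, hs, rfl⟩
  by_cases hR : RaiseAt q ε F u
  · have hlt := prevSup_lt_of_raiseAt hq hc hc0 hε0 hεc hut hpred hR
    have hu' : Iio u = ∅ ∨ ∃ w, IsGreatest (Iio u) w := hR.imp_right And.left
    obtain ⟨h1, h2, -⟩ := raise_spec hq hc hc0 hεc hut hpred hu'
    obtain ⟨-, -, -, -, -, -, -, -, hb0, -⟩ := exists_plateau hq hut hpred hu'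
    refine ⟨fun s hs => (hle s hs).trans hlt.le, hb0.trans_lt hlt, ?_⟩
    rw [climb_of_raiseAt hR]
    exact h2
  · have hFu : F u = prevSup F u := climb_of_not_raiseAt hR
    have hne : (Iio u).Nonempty := by
      by_contra hemp
      exact hR (Or.inl (not_nonempty_iff_eq_empty.1 hemp))
    have hmono : ∀ s < u, F s ≤ F u := fun s hs => hFu ▸ hle s hs
    obtain ⟨s₀, hs₀⟩ := hne
    have hpos : 0 < F u := (hpred s₀ hs₀).2.1.trans_le (hmono s₀ hs₀)
    refine ⟨hmono, hpos, ?_⟩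
    by_cases hw : ∃ w, IsGreatest (Iio u) w
    · obtain ⟨f, e, -, -, -, -, hfe, -, -, -, hcase⟩ :=
        exists_plateau hq hut hpred (Or.inr hw)
      rcases hcase with ⟨hemp, -⟩ | ⟨w, -, -, hqb⟩
      · exact absurd hs₀ (by rw [hemp]; exact notMem_empty _)
      · exact ⟨_, hfe _, by rw [← hF, hFu]; exact hqb⟩
    · have happ : ∀ δ > 0, ∃ h : C₀(Υ, ℝ), ∃ s < u, q h = 1 + ε * F s ∧ F u - δ < F s ∧
          ∀ x, |plateau F u t (F u) x - h x| ≤ δ := by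
        intro δ hδ
        obtain ⟨_, ⟨s, hs, rfl⟩, hsδ⟩ := exists_lt_of_lt_csSup (⟨_, s₀, hs₀, rfl⟩ : (F '' Iio u).Nonempty)
          (show F u - δ < sSup (F '' Iio u) by change _ < prevSup F u; linarith)
        obtain ⟨-, -, h, hh, hqh⟩ := hpred s hs
        refine ⟨h, s, hs, hqh, hsδ, fun x => ?_⟩
        have hst : s ≤ t := (le_of_lt hs).trans hut
        rw [hh, ← hF]
        by_cases hxs : x ≤ s
        · rw [plateau_of_le hst hxs, plateau_of_le hut (hxs.trans (le_of_lt hs)), sub_self, abs_zero]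
          exact hδ.le
        by_cases hxt : x ≤ t
        · rw [plateau_of_not_le hxs hxt]
          have hsx : s < x := (lt_or_le_of_le hst hxt).resolve_right hxs
          have hsu := hmono s hs
          by_cases hxu : x ≤ u
          · rw [plateau_of_le hut hxu]
            have h1 : F x ≤ F u := by
              rcases hxu.lt_or_eq with h | rfl
              · exact hmono x h
              · exact le_rfl
            have h2 : F s ≤ F x := by
              rcases hxu.lt_or_eq with h | rfl
              · exact (hpred x h).1 s hsx
              · exact hsu
            exact abs_le.2 ⟨by linarith, by linarith⟩
          · rw [plateau_of_not_le hxu hxt]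
            exact abs_le.2 ⟨by linarith, by linarith⟩
        · rw [plateau_off hst hxt, plateau_off hut hxt, sub_self, abs_zero]
          exact hδ.le
      have hcont : Continuous (plateau F u t (F u)) := by
        refine continuous_of_uniform_approx_of_continuous fun U hU => ?_
        obtain ⟨δ, hδ, hδU⟩ := Metric.mem_uniformity_dist.1 hU
        obtain ⟨h, -, -, -, -, hh⟩ := happ (δ / 2) (half_pos hδ)
        refine ⟨h, h.continuous, fun x => hδU ?_⟩
        rw [Real.dist_eq]
        exact (hh x).trans_lt (half_lt_self hδ)
      let g : C₀(Υ, ℝ) := ofIsCompact _ hcont (isCompact_Iic t) fun x hx => plateau_off hut hx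
      refine ⟨g, rfl, ?_⟩
      obtain ⟨C, hC0, hC⟩ := hq.sublinear.abs_sub_le
      have hclose : ∀ δ > 0, |q g - (1 + ε * F u)| ≤ (C + ε) * δ := by
        intro δ hδ
        obtain ⟨h, s, hs, hqh, hsδ, hh⟩ := happ δ hδ
        have h1 : |q g - q h| ≤ C * δ := (hC g h).trans
          (mul_le_mul_of_nonneg_left (norm_le_of_forall hδ.le fun x => hh x) hC0.le)
        have h2 : |q h - (1 + ε * F u)| ≤ ε * δ := by
          have := hmono s hs
          rw [hqh, abs_le]
          constructor <;> nlinarith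
        calc |q g - (1 + ε * F u)| ≤ |q g - q h| + |q h - (1 + ε * F u)| := abs_sub_le _ _ _
          _ ≤ (C + ε) * δ := by linarith
      by_contra hne
      have hpos' : 0 < |q g - (1 + ε * F u)| := abs_pos.2 (sub_ne_zero.2 hne)
      have := hclose (|q g - (1 + ε * F u)| / (2 * (C + ε))) (by positivity)
      have h2 : (C + ε) * (|q g - (1 + ε * F u)| / (2 * (C + ε))) = |q g - (1 + ε * F u)| / 2 := by
        field_simp
      linarith

end Climb

end HausdorffTree

namespace HausdorffTree

open Set ZeroAtInftyContinuousMap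

variable {Υ : Type*} [PartialOrder Υ] [TopologicalSpace Υ] [HausdorffTree Υ]
  {q : C₀(Υ, ℝ) → ℝ} {c ε : ℝ}

variable (hq : IsSmoothMonotone q) (hc : ∀ f : C₀(Υ, ℝ), (∀ t, 0 ≤ f t) → c * ‖f‖ ≤ q f)
  (hc0 : 0 < c) (hε0 : 0 < ε) (hεc : ε < c)
include hq hc hc0 hε0 hεc

theorem climb_mono {t r s : Υ} (hst : s ≤ t) (hrs : r ≤ s) :
    climb q ε t r ≤ climb q ε t s := by
  rcases hrs.lt_or_eq with h | rfl
  · exact (goodAt hq hc hc0 hε0 hεc hst).1 r h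
  · exact le_rfl

theorem climb_lt_of_raiseAt {t r s : Υ} (hst : s ≤ t) (hrs : r < s)
    (h : RaiseAt q ε (climb q ε t) s) : climb q ε t r < climb q ε t s := by
  have hpred : ∀ r < s, GoodAt q ε t r := fun r hr =>
    goodAt hq hc hc0 hε0 hεc (hr.le.trans hst)
  have hbdd : BddAbove (climb q ε t '' Iio s) := by
    refine ⟨climb q ε t s, ?_⟩
    rintro _ ⟨r, hr, rfl⟩
    exact climb_mono hq hc hc0 hε0 hεc hst (le_of_lt hr)
  exact lt_of_le_of_lt (le_csSup hbdd ⟨r, hrs, rfl⟩)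
    (prevSup_lt_of_raiseAt hq hc hc0 hε0 hεc hst hpred h)

theorem climb_anti {t t' s : Υ} (htt' : t ≤ t') (hst : s ≤ t)
    (hagree : ∀ r < s, climb q ε t r = climb q ε t' r) (h : RaiseAt q ε (climb q ε t) s) :
    climb q ε t' s ≤ climb q ε t s := by
  have h' : RaiseAt q ε (climb q ε t') s := (raiseAt_congr hagree).1 h
  have hlim : Iio s = ∅ ∨ ∃ w, IsGreatest (Iio s) w := h.imp_right And.left
  have hpred : ∀ r < s, GoodAt q ε t r := fun r hr => goodAt hq hc hc0 hε0 hεc (hr.le.trans hst)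
  have hpred' : ∀ r < s, GoodAt q ε t' r := fun r hr =>
    goodAt hq hc hc0 hε0 hεc (hr.le.trans (hst.trans htt'))
  obtain ⟨f, e, hf0, he0, -, -, hfe, -, hb0, -⟩ := exists_plateau hq hst hpred hlim
  obtain ⟨-, -, h3⟩ := raise_spec hq hc hc0 hεc hst hpred hlim
  obtain ⟨h1', ⟨g, hg, hqg⟩, -⟩ := raise_spec hq hc hc0 hεc (hst.trans htt') hpred' hlim
  rw [climb_of_raiseAt h]
  refine h3 _ ⟨?_, ?_⟩
  · rw [climb_of_raiseAt h', prevSup_congr hagree]; exact h1'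
  · have hv0 : 0 ≤ climb q ε t' s := (goodAt hq hc hc0 hε0 hεc (hst.trans htt')).2.1.le
    rw [extendFun_eq _ (hfe _)]
    rw [← climb_of_raiseAt h'] at hg hqg
    rw [← hqg]
    refine hq.mono _ _ (fun r => add_nonneg (hf0 r) (mul_nonneg hv0 (he0 r))) fun r => ?_
    rw [hfe, hg, plateau_congr hagree, plateau, plateau]
    split_ifs with h1 h2 h3 h4
    · exact le_rfl
    · exact le_rfl
    · exact absurd (h2.trans htt') h3
    · exact hv0
    · exact le_rfl

theorem exists_isFirstDiff_climb {t t' : Υ} (htt' : t < t') :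
    ∃ a, IsFirstDiff (climb q ε t '' Iic t) (climb q ε t' '' Iic t') a := by
  have hmono := fun {r s : Υ} (hst : s ≤ t) (hrs : r ≤ s) =>
    climb_mono hq hc hc0 hε0 hεc hst hrs
  have hmono' := fun {r s : Υ} (hst : s ≤ t') (hrs : r ≤ s) =>
    climb_mono hq hc hc0 hε0 hεc hst hrs
  by_cases hall : ∀ s ≤ t, climb q ε t s = climb q ε t' s
  · obtain ⟨u, ⟨htu, hut'⟩, humin⟩ := exists_isLeast (t := t') (S := Ioc t t') (fun _ h => h.2)
      ⟨t', htt', le_rfl⟩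
    have hgr : IsGreatest (Iio u) t := by
      refine ⟨htu, fun s hs => ?_⟩
      by_contra hst
      have hsu : s < u := hs
      have hst' : s ≤ t' := hsu.le.trans hut'
      have := humin ⟨(lt_or_le_of_le htt'.le hst').resolve_right hst, hst'⟩
      exact absurd this (not_le_of_gt hsu)
    have hiff : ∀ s, s < u ↔ s ≤ t := fun s => ⟨fun h => hgr.2 h, fun h => h.trans_lt htu⟩
    have hR : RaiseAt q ε (climb q ε t') u := by
      refine Or.inr ⟨⟨t, hgr⟩, ?_⟩
      obtain ⟨-, -, h, hh, hqh⟩ := goodAt (t := t) hq hc hc0 hε0 hεc le_rfl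
      have hb : prevSup (climb q ε t') u = climb q ε t t := by
        rw [hall t le_rfl]
        refine IsGreatest.csSup_eq ⟨⟨t, htu, rfl⟩, ?_⟩
        rintro _ ⟨s, hs, rfl⟩
        exact hmono' htt'.le ((hiff s).1 hs)
      rw [hb, ← hqh]
      refine extendFun_eq h ?_
      rw [hh]
      ext s
      by_cases hs : s ≤ t
      · rw [plateau_of_le le_rfl hs, indicator_of_mem (show s ∈ Iio u from (hiff s).2 hs),
          hall s hs]
      · rw [plateau_off le_rfl hs, indicator_of_notMem (s := Iio u) (fun h => hs ((hiff s).1 h))]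
    have hlt := climb_lt_of_raiseAt hq hc hc0 hε0 hεc hut' htu hR
    refine ⟨climb q ε t' u, ⟨u, hut', rfl⟩, ?_, fun a ha => ⟨?_, ?_⟩⟩
    · rintro ⟨s, hs, e⟩
      rw [hall s hs] at e
      exact absurd (hmono' htt'.le hs) (not_le.2 (e ▸ hlt))
    · rintro ⟨s, hs, rfl⟩
      exact ⟨s, le_trans hs htt'.le, (hall s hs).symm⟩
    · rintro ⟨s, hs, rfl⟩
      have hst : s ≤ t := (hiff s).1 ((lt_or_le_of_le hs hut').resolve_right
        fun h => absurd (hmono' hs h) (not_le.2 ha))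
      exact ⟨s, hst, hall s hst⟩
  · push Not at hall
    obtain ⟨s, ⟨hst, hne⟩, hsmin⟩ := exists_isLeast (t := t)
      (S := {s | s ≤ t ∧ climb q ε t s ≠ climb q ε t' s}) (fun _ h => h.1) hall
    have hagree : ∀ r < s, climb q ε t r = climb q ε t' r := by
      intro r hr
      by_contra h
      exact absurd (hsmin ⟨hr.le.trans hst, h⟩) (not_le_of_gt hr)
    have hst' : s ≤ t' := hst.trans htt'.le
    have hR : RaiseAt q ε (climb q ε t) s := by
      by_contra h
      have h' : ¬ RaiseAt q ε (climb q ε t') s := fun h' => h ((raiseAt_congr hagree).2 h')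
      exact hne (by rw [climb_of_not_raiseAt h, climb_of_not_raiseAt h', prevSup_congr hagree])
    have hR' : RaiseAt q ε (climb q ε t') s := (raiseAt_congr hagree).1 hR
    have hlt : climb q ε t' s < climb q ε t s :=
      (climb_anti hq hc hc0 hε0 hεc htt'.le hst hagree hR).lt_of_ne (Ne.symm hne)
    refine ⟨climb q ε t' s, ⟨s, hst', rfl⟩, ?_, fun a ha => ⟨?_, ?_⟩⟩
    · rintro ⟨r, hr, e⟩
      rcases lt_or_le_of_le hr hst with h | h
      · have := climb_lt_of_raiseAt hq hc hc0 hε0 hεc hst' h hR'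
        rw [← hagree r h, e] at this
        exact lt_irrefl _ this
      · exact absurd (hmono hr h) (not_le.2 (e ▸ hlt))
    · rintro ⟨r, hr, rfl⟩
      have hrs : r < s := (lt_or_le_of_le hr hst).resolve_right
        fun h => absurd (hmono hr h) (not_le.2 (ha.trans hlt))
      exact ⟨r, hrs.le.trans hst', (hagree r hrs).symm⟩
    · rintro ⟨r, hr, rfl⟩
      have hrs : r < s := (lt_or_le_of_le hr hst').resolve_right
        fun h => absurd (hmono' hr h) (not_le.2 ha)
      exact ⟨r, hrs.le.trans hst, hagree r hrs⟩

theorem exists_values_eq_climb (t : Υ) : ∃ x : OrderY, x.values = climb q ε t '' Iic t := by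
  refine OrderY.exists_values_eq ?_ ?_ ⟨_, t, le_rfl, rfl⟩
  · obtain ⟨-, -, h, hh, -⟩ := goodAt (t := t) hq hc hc0 hε0 hεc le_rfl
    have : climb q ε t '' Iic t = h '' Iic t := image_congr fun s hs => by
      rw [hh, plateau_of_le le_rfl hs]
    rw [this]
    exact (isCompact_Iic t).image h.continuous
  · rw [isWF_iff_no_descending_seq]
    intro f hf hmem
    choose g hg hgf using hmem
    obtain ⟨_, ⟨n, rfl⟩, hmin⟩ := exists_isLeast (t := t) (S := range g)
      (by rintro _ ⟨n, rfl⟩; exact hg n) ⟨_, 0, rfl⟩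
    have h1 := climb_mono hq hc hc0 hε0 hεc (hg (n + 1)) (hmin ⟨n + 1, rfl⟩)
    rw [hgf, hgf] at h1
    exact absurd h1 (not_le.2 (hf (Nat.lt_succ_self n)))

omit hc hc0 hε0 hεc in
theorem exists_orderY_of_isSmoothMonotone : ∃ ρ : Υ → OrderY, ∀ s t : Υ, s < t → ρ s < ρ t := by
  obtain ⟨c, hc0, hc⟩ := hq.lower
  choose ρ hρ using exists_values_eq_climb hq hc hc0 (half_pos hc0) (half_lt_self hc0)
  refine ⟨ρ, fun s t hst => ?_⟩
  obtain ⟨a, ha⟩ := exists_isFirstDiff_climb hq hc hc0 (half_pos hc0) (half_lt_self hc0) hst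
  rw [← hρ, ← hρ] at ha
  exact OrderY.lt_of_isFirstDiff ha

end HausdorffTree

/-! ### Square-summable families of functionals -/

section L2

open Filter Topology

variable {ι : Type*}

/-- The `ℓ²`-norm of a family of reals. -/
noncomputable def l2norm (a : ι → ℝ) : ℝ := √(∑' i, a i ^ 2)

theorem l2norm_nonneg (a : ι → ℝ) : 0 ≤ l2norm a := Real.sqrt_nonneg _

theorem l2norm_sq (a : ι → ℝ) : l2norm a ^ 2 = ∑' i, a i ^ 2 :=
  Real.sq_sqrt (tsum_nonneg fun i => sq_nonneg (a i))

theorem l2norm_le_l2norm {a b : ι → ℝ} (hb : Summable fun i => b i ^ 2) (ha₀ : ∀ i, 0 ≤ a i)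
    (hab : ∀ i, a i ≤ b i) : l2norm a ≤ l2norm b := by
  have h : ∀ i, a i ^ 2 ≤ b i ^ 2 := fun i => pow_le_pow_left₀ (ha₀ i) (hab i) 2
  exact Real.sqrt_le_sqrt
    ((Summable.of_nonneg_of_le (fun i => sq_nonneg _) h hb).tsum_le_tsum h hb)

theorem le_l2norm {a : ι → ℝ} (ha : Summable fun i => a i ^ 2) (i : ι) : a i ≤ l2norm a :=
  Real.le_sqrt_of_sq_le (ha.le_tsum i fun _ _ => sq_nonneg _)

theorem sum_mul_le_l2norm {a : ι → ℝ} (ha : Summable fun i => a i ^ 2) {T : Finset ι} {k : ι → ℝ}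
    (hk : ∑ i ∈ T, k i ^ 2 ≤ 1) : ∑ i ∈ T, k i * a i ≤ l2norm a := by
  refine (Real.sum_mul_le_sqrt_mul_sqrt T k a).trans ?_
  calc √(∑ i ∈ T, k i ^ 2) * √(∑ i ∈ T, a i ^ 2) ≤ 1 * l2norm a :=
        mul_le_mul (Real.sqrt_le_one.2 hk)
          (Real.sqrt_le_sqrt (ha.sum_le_tsum T fun _ _ => sq_nonneg _)) (Real.sqrt_nonneg _)
          zero_le_one
    _ = l2norm a := one_mul _

theorem exists_lt_sum_mul {a : ι → ℝ} (ha : Summable fun i => a i ^ 2) (ha₀ : ∀ i, 0 ≤ a i)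
    {r : ℝ} (hr : r < l2norm a) :
    ∃ (T : Finset ι) (k : ι → ℝ), (∀ i, 0 ≤ k i) ∧ ∑ i ∈ T, k i ^ 2 ≤ 1 ∧
      r < ∑ i ∈ T, k i * a i := by
  rcases lt_or_ge r 0 with h0 | h0
  · exact ⟨∅, 0, fun _ => le_rfl, by simp, by simpa using h0⟩
  have h1 : r ^ 2 < ∑' i, a i ^ 2 := by
    rw [← l2norm_sq]; exact pow_lt_pow_left₀ hr h0 two_ne_zero
  obtain ⟨T, hT⟩ := (ha.hasSum.eventually (lt_mem_nhds h1)).exists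
  set s := √(∑ i ∈ T, a i ^ 2) with hs
  have hs2 : s ^ 2 = ∑ i ∈ T, a i ^ 2 := Real.sq_sqrt (Finset.sum_nonneg fun i _ => sq_nonneg (a i))
  have hrs : r < s := Real.lt_sqrt_of_sq_lt hT
  have hs0 : 0 < s := h0.trans_lt hrs
  refine ⟨T, fun i => a i / s, fun i => div_nonneg (ha₀ i) hs0.le, ?_, ?_⟩
  · simp only [div_pow]
    rw [← Finset.sum_div, ← hs2, div_self (pow_pos hs0 2).ne']
  · have : ∑ i ∈ T, a i / s * a i = s := by
      calc ∑ i ∈ T, a i / s * a i = (∑ i ∈ T, a i ^ 2) / s := by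
            rw [Finset.sum_div]; exact Finset.sum_congr rfl fun i _ => by ring
        _ = s := by rw [← hs2]; field_simp
    rwa [this]

/-- `S` does not distinguish the two sequences asymptotically, and is asymptotically additive
on them. -/
def Agree {E : Type*} [Add E] (S : E → ℝ) (x y : ℕ → E) : Prop :=
  Tendsto (fun n => S (x n) - S (y n)) atTop (𝓝 0) ∧
    Tendsto (fun n => S (x n) + S (y n) - S (x n + y n)) atTop (𝓝 0)

theorem tendsto_zero_of_sq_le {u E : ℕ → ℝ} (hE : Tendsto E atTop (𝓝 0)) (h : ∀ n, u n ^ 2 ≤ E n) :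
    Tendsto u atTop (𝓝 0) := by
  have h1 : Tendsto (fun n => √(E n)) atTop (𝓝 0) := by
    have := (Real.continuous_sqrt.tendsto 0).comp hE
    rwa [Real.sqrt_zero] at this
  exact squeeze_zero_norm (fun n => by
    rw [Real.norm_eq_abs]; exact Real.abs_le_sqrt (h n)) h1

variable {E : Type*} [Add E] {x y : ℕ → E}

theorem Agree.of_l2norm {S : ι → E → ℝ} (hS₀ : ∀ i z, 0 ≤ S i z)
    (hadd : ∀ i z w, S i (z + w) ≤ S i z + S i w) (hsum : ∀ z, Summable fun i => S i z ^ 2)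
    {M : ℝ} (hx : ∀ n, l2norm (fun i => S i (x n)) ≤ M) (hy : ∀ n, l2norm (fun i => S i (y n)) ≤ M)
    (h : Agree (fun z => l2norm fun i => S i z) x y) (i : ι) : Agree (S i) x y := by
  obtain ⟨h1, h2⟩ := h
  set A : ℕ → ℝ := fun n => l2norm fun i => S i (x n) with hA
  set B : ℕ → ℝ := fun n => l2norm fun i => S i (y n) with hB
  set C : ℕ → ℝ := fun n => l2norm fun i => S i (x n + y n) with hC
  have hterm : ∀ n j, 0 ≤ 2 * S j (x n) ^ 2 + 2 * S j (y n) ^ 2 - S j (x n + y n) ^ 2 := by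
    intro n j
    nlinarith [hadd j (x n) (y n), hS₀ j (x n), hS₀ j (y n), hS₀ j (x n + y n),
      sq_nonneg (S j (x n) - S j (y n))]
  have hsumn : ∀ n, Summable fun j =>
      2 * S j (x n) ^ 2 + 2 * S j (y n) ^ 2 - S j (x n + y n) ^ 2 := fun n =>
    (((hsum _).mul_left 2).add ((hsum _).mul_left 2)).sub (hsum _)
  have htot : ∀ n, ∑' j, (2 * S j (x n) ^ 2 + 2 * S j (y n) ^ 2 - S j (x n + y n) ^ 2) =
      2 * A n ^ 2 + 2 * B n ^ 2 - C n ^ 2 := by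
    intro n
    rw [(((hsum _).mul_left 2).add ((hsum _).mul_left 2)).tsum_sub (hsum _),
      ((hsum _).mul_left 2).tsum_add ((hsum _).mul_left 2), tsum_mul_left, tsum_mul_left,
      l2norm_sq, l2norm_sq, l2norm_sq]
  have hle : ∀ n, 2 * S i (x n) ^ 2 + 2 * S i (y n) ^ 2 - S i (x n + y n) ^ 2 ≤
      2 * A n ^ 2 + 2 * B n ^ 2 - C n ^ 2 := fun n => by
    rw [← htot]
    exact (hsumn n).le_tsum i fun j _ => hterm n j
  have hCAB : ∀ n, C n ≤ A n + B n := by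
    intro n
    refine le_of_forall_lt fun r hr => ?_
    obtain ⟨T, k, hk0, hk1, hrT⟩ := exists_lt_sum_mul (hsum _) (fun j => hS₀ j _) hr
    refine hrT.trans_le ?_
    calc ∑ j ∈ T, k j * S j (x n + y n) ≤ ∑ j ∈ T, (k j * S j (x n) + k j * S j (y n)) :=
          Finset.sum_le_sum fun j _ => by
            rw [← mul_add]; exact mul_le_mul_of_nonneg_left (hadd j _ _) (hk0 j)
      _ ≤ A n + B n := by
          rw [Finset.sum_add_distrib]
          exact add_le_add (sum_mul_le_l2norm (hsum _) hk1) (sum_mul_le_l2norm (hsum _) hk1)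
  have hE : Tendsto (fun n => (A n - B n) ^ 2 + (A n + B n - C n) * (4 * M)) atTop (𝓝 0) := by
    have := (h1.pow 2).add (h2.mul_const (4 * M))
    simpa using this
  have hbound : ∀ n, 2 * A n ^ 2 + 2 * B n ^ 2 - C n ^ 2 ≤
      (A n - B n) ^ 2 + (A n + B n - C n) * (4 * M) := by
    intro n
    have h3 : 0 ≤ A n + B n - C n := by linarith [hCAB n]
    have h4 : A n + B n + C n ≤ 4 * M := by linarith [hCAB n, hx n, hy n]
    nlinarith [mul_le_mul_of_nonneg_left h4 h3]
  constructor
  · refine tendsto_zero_of_sq_le hE fun n => ?_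
    refine le_trans ?_ ((hle n).trans (hbound n))
    nlinarith [hadd i (x n) (y n), hS₀ i (x n), hS₀ i (y n), hS₀ i (x n + y n)]
  · refine tendsto_zero_of_sq_le hE fun n => ?_
    refine le_trans ?_ ((hle n).trans (hbound n))
    nlinarith [hadd i (x n) (y n), hS₀ i (x n), hS₀ i (y n), hS₀ i (x n + y n),
      mul_nonneg (sub_nonneg.2 (hadd i (x n) (y n))) (hS₀ i (x n + y n)),
      sq_nonneg (S i (x n) - S i (y n))]

theorem Agree.of_add {S T : E → ℝ} (hS : Agree S x y) (h : Agree (fun z => S z + T z) x y) :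
    Agree T x y := by
  constructor
  · have := h.1.sub hS.1
    simp only [sub_zero] at this
    exact this.congr fun n => by ring
  · have := h.2.sub hS.2
    simp only [sub_zero] at this
    exact this.congr fun n => by ring

theorem Agree.of_mul {S : E → ℝ} {w : ℝ} (hw : w ≠ 0) (h : Agree (fun z => w * S z) x y) :
    Agree S x y := by
  constructor
  · have := h.1.const_mul w⁻¹
    simp only [mul_zero] at this
    exact this.congr fun n => by field_simp
  · have := h.2.const_mul w⁻¹
    simp only [mul_zero] at this
    exact this.congr fun n => by field_simp

theorem Agree.of_const {S : E → ℝ} {x y : E} (h : Agree S (fun _ => x) fun _ => y) :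
    S x = S y ∧ S x + S y = S (x + y) := by
  constructor
  · exact sub_eq_zero.1 (tendsto_nhds_unique tendsto_const_nhds h.1)
  · exact sub_eq_zero.1 (tendsto_nhds_unique tendsto_const_nhds h.2)

end L2

/-! ### Suprema of evaluation functionals -/

section EvalSup

variable {X : Type*} [NormedAddCommGroup X] [NormedSpace ℝ X]

/-- `S` is non-negative and a supremum of evaluations at points of `X`. -/
structure IsEvalSup (S : StrongDual ℝ X → ℝ) : Prop where
  nonneg : ∀ μ, 0 ≤ S μ
  exists_lt : ∀ μ r, r < S μ → ∃ f : X, r < μ f ∧ ∀ ν : StrongDual ℝ X, ν f ≤ S ν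

namespace IsEvalSup

variable {S : StrongDual ℝ X → ℝ}

theorem add_le (hS : IsEvalSup S) (μ ν : StrongDual ℝ X) : S (μ + ν) ≤ S μ + S ν := by
  refine le_of_forall_lt fun r hr => ?_
  obtain ⟨f, hf, hle⟩ := hS.exists_lt _ r hr
  exact hf.trans_le (add_le_add (hle μ) (hle ν))

theorem map_smul (hS : IsEvalSup S) {c : ℝ} (hc : 0 < c) (μ : StrongDual ℝ X) :
    S (c • μ) = c * S μ := by
  have key : ∀ {c : ℝ}, 0 < c → ∀ μ, S (c • μ) ≤ c * S μ := by
    intro c hc μ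
    refine le_of_forall_lt fun r hr => ?_
    obtain ⟨f, hf, hle⟩ := hS.exists_lt _ r hr
    exact hf.trans_le (mul_le_mul_of_nonneg_left (hle μ) hc.le)
  refine le_antisymm (key hc μ) ?_
  have := key (inv_pos.2 hc) (c • μ)
  rwa [inv_smul_smul₀ hc.ne', le_inv_mul_iff₀ hc] at this

theorem map_zero (hS : IsEvalSup S) : S 0 = 0 := by
  refine le_antisymm (le_of_forall_lt fun r hr => ?_) (hS.nonneg 0)
  obtain ⟨f, hf, -⟩ := hS.exists_lt _ r hr
  simpa using hf

theorem const_mul (hS : IsEvalSup S) {w : ℝ} (hw : 0 < w) : IsEvalSup fun μ => w * S μ where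
  nonneg μ := mul_nonneg hw.le (hS.nonneg μ)
  exists_lt μ r hr := by
    obtain ⟨f, hf, hle⟩ := hS.exists_lt μ (w⁻¹ * r) (by rwa [inv_mul_lt_iff₀ hw])
    refine ⟨w • f, ?_, fun ν => ?_⟩
    · rwa [_root_.map_smul, smul_eq_mul, ← inv_mul_lt_iff₀ hw]
    · rw [_root_.map_smul, smul_eq_mul]; exact mul_le_mul_of_nonneg_left (hle ν) hw.le

theorem comp_neg (hS : IsEvalSup S) : IsEvalSup fun μ => S (-μ) where
  nonneg μ := hS.nonneg _
  exists_lt μ r hr := by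
    obtain ⟨f, hf, hle⟩ := hS.exists_lt _ r hr
    exact ⟨-f, by simpa using hf, fun ν => by simpa using hle (-ν)⟩

theorem l2norm {ι : Type*} {S : ι → StrongDual ℝ X → ℝ} (hS : ∀ i, IsEvalSup (S i))
    (hsum : ∀ μ, Summable fun i => S i μ ^ 2) : IsEvalSup fun μ => l2norm fun i => S i μ where
  nonneg μ := l2norm_nonneg _
  exists_lt μ r hr := by
    obtain ⟨T, k, hk0, hk1, hrT⟩ := exists_lt_sum_mul (hsum μ) (fun i => (hS i).nonneg μ) hr
    have hK : 0 ≤ ∑ i ∈ T, k i := Finset.sum_nonneg fun i _ => hk0 i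
    set δ := (∑ i ∈ T, k i * S i μ - r) / (∑ i ∈ T, k i + 1) with hδ
    have hδ0 : 0 < δ := div_pos (by linarith) (by linarith)
    choose f hf hle using fun i => (hS i).exists_lt μ (S i μ - δ) (by linarith)
    refine ⟨∑ i ∈ T, k i • f i, ?_, fun ν => ?_⟩
    · have h1 : ∑ i ∈ T, k i * (S i μ - δ) ≤ μ (∑ i ∈ T, k i • f i) := by
        rw [map_sum]
        exact Finset.sum_le_sum fun i _ => by
          rw [_root_.map_smul, smul_eq_mul]; exact mul_le_mul_of_nonneg_left (hf i).le (hk0 i)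
      have h2 : ∑ i ∈ T, k i * (S i μ - δ) = ∑ i ∈ T, k i * S i μ - (∑ i ∈ T, k i) * δ := by
        rw [Finset.sum_mul, ← Finset.sum_sub_distrib]
        exact Finset.sum_congr rfl fun i _ => by ring
      have h3 : (∑ i ∈ T, k i + 1) * δ = ∑ i ∈ T, k i * S i μ - r := by
        rw [hδ]; field_simp
      linarith
    · rw [map_sum]
      refine le_trans (Finset.sum_le_sum fun i _ => ?_) (sum_mul_le_l2norm (hsum ν) hk1)
      rw [_root_.map_smul, smul_eq_mul]
      exact mul_le_mul_of_nonneg_left (hle i ν) (hk0 i)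

/-- The seminorm given by a symmetric supremum of evaluations. -/
noncomputable def toSeminorm (hS : IsEvalSup S) (hneg : ∀ μ, S (-μ) = S μ) :
    Seminorm ℝ (StrongDual ℝ X) :=
  Seminorm.of S hS.add_le fun c μ => by
    rcases lt_trichotomy c 0 with h | rfl | h
    · have hc : (-c) • μ = -(c • μ) := by ext f; simp
      rw [Real.norm_of_nonpos h.le, ← hS.map_smul (by linarith), hc, hneg]
    · rw [zero_smul, hS.map_zero, norm_zero, zero_mul]
    · rw [Real.norm_of_nonneg h.le, hS.map_smul h]

end IsEvalSup

/-- An equivalent norm on `X*` that is a supremum of evaluations is a dual norm. -/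
theorem isEquivalentDualNorm_of_isEvalSup {N : Seminorm ℝ (StrongDual ℝ X)}
    (hN : IsEquivalentNorm N) (h : IsEvalSup fun μ => N μ) : IsEquivalentDualNorm N := by
  refine ⟨hN, ?_⟩
  obtain ⟨c, C, hc, hC, hcC⟩ := hN
  let P : X → Set ℝ := fun f => {r | ∃ φ : StrongDual ℝ X, N φ ≤ 1 ∧ φ f = r}
  have hPb : ∀ f, ∀ r ∈ P f, r ≤ c⁻¹ * ‖f‖ := by
    rintro f _ ⟨φ, hφ, rfl⟩
    refine (le_abs_self _).trans ((φ.le_opNorm f).trans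
      (mul_le_mul_of_nonneg_right ?_ (norm_nonneg f)))
    rw [← mul_one c⁻¹, le_inv_mul_iff₀ hc]
    exact (hcC φ).1.trans hφ
  have hPbdd : ∀ f, BddAbove (P f) := fun f => ⟨_, hPb f⟩
  have hPne : ∀ f, (P f).Nonempty := fun f => ⟨0, 0, by simp, rfl⟩
  have hle : ∀ {φ : StrongDual ℝ X}, N φ ≤ 1 → ∀ f, φ f ≤ sSup (P f) := fun hφ f =>
    le_csSup (hPbdd f) ⟨_, hφ, rfl⟩
  have hsup : ∀ {f : X} {r : ℝ}, (∀ φ : StrongDual ℝ X, N φ ≤ 1 → φ f ≤ r) → sSup (P f) ≤ r :=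
    fun h => csSup_le (hPne _) (by rintro _ ⟨φ, hφ, rfl⟩; exact h φ hφ)
  let p : Seminorm ℝ X := Seminorm.ofSMulLE (fun f => sSup (P f))
    (le_antisymm (hsup fun φ _ => by simp) (by simpa using hle (φ := 0) (by simp) 0))
    (fun f g => hsup fun φ hφ => by
      rw [map_add]; exact add_le_add (hle hφ f) (hle hφ g))
    (fun a f => hsup fun φ hφ => by
      rw [map_smul, smul_eq_mul]
      rcases le_total 0 a with ha | ha
      · rw [Real.norm_of_nonneg ha]; exact mul_le_mul_of_nonneg_left (hle hφ f) ha
      · rw [Real.norm_of_nonpos ha]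
        have := hle (φ := -φ) (by rwa [map_neg_eq_map]) f
        have h2 := mul_le_mul_of_nonneg_left this (neg_nonneg.2 ha)
        simpa using h2)
  have hp : ∀ f, p f = sSup (P f) := fun f => rfl
  refine ⟨p, ⟨C⁻¹, c⁻¹, inv_pos.2 hC, inv_pos.2 hc, fun f => ⟨?_, ?_⟩⟩, fun φ => ⟨?_, fun u hu => ?_⟩⟩
  · obtain ⟨g, hg1, hgf⟩ := exists_dual_vector'' ℝ f
    rw [hp]
    have h1 : N (C⁻¹ • g) ≤ 1 := by
      rw [map_smul_eq_mul, Real.norm_of_nonneg (inv_nonneg.2 hC.le), inv_mul_le_iff₀ hC]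
      exact (hcC g).2.trans (mul_le_mul_of_nonneg_left hg1 hC.le)
    have := hle h1 f
    rw [_root_.smul_apply, hgf, smul_eq_mul] at this
    exact this
  · exact csSup_le (hPne f) (hPb f)
  · rintro _ ⟨f, hf, rfl⟩
    rcases (apply_nonneg N φ).eq_or_lt with h0 | h0
    · have h1 : ‖φ‖ ≤ 0 := by
        have := (hcC φ).1
        rw [← h0] at this
        exact nonpos_of_mul_nonpos_right this hc
      rw [norm_le_zero_iff.1 h1]
      simp
    · have h1 : N ((N φ)⁻¹ • φ) ≤ 1 := by
        rw [map_smul_eq_mul, Real.norm_of_nonneg (inv_nonneg.2 h0.le), inv_mul_cancel₀ h0.ne']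
      have := (hle h1 f).trans hf
      rwa [_root_.smul_apply, smul_eq_mul, inv_mul_le_iff₀ h0, mul_one] at this
  · by_contra! hlt
    obtain ⟨f, hf, hle'⟩ := h.exists_lt φ u hlt
    have : p f ≤ 1 := hsup fun ψ hψ => (hle' ψ).trans hψ
    exact absurd (hu ⟨f, this, rfl⟩) (not_le.2 hf)

/-- A criterion for p-UR norms. -/
theorem isPURNorm_of_family {N : Seminorm ℝ X} {ι : Type*} (L : ι → X →ₗ[ℝ] ℝ)
    (hL : ∀ i, ∃ C : ℝ, ∀ x, |L i x| ≤ C * ‖x‖) (hsep : ∀ x, (∀ i, L i x = 0) → x = 0)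
    (h : ∀ x y : ℕ → X, (∀ n, N (x n) = 1) → (∀ n, N (y n) = 1) →
      Filter.Tendsto (fun n => N (x n + y n)) Filter.atTop (nhds 2) →
      ∀ i, Filter.Tendsto (fun n => L i (x n) - L i (y n)) Filter.atTop (nhds 0)) :
    IsPURNorm N := by
  choose C hC using hL
  let f : ι → StrongDual ℝ X := fun i => (L i).mkContinuous (C i) (hC i)
  refine ⟨Submodule.span ℝ (Set.range f), fun x hx => ?_, fun x y hx hy hxy g hg => ?_⟩
  · by_contra! hcon
    exact hx (hsep x fun i => hcon (f i) (Submodule.subset_span ⟨i, rfl⟩))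
  · induction hg using Submodule.span_induction with
    | mem g hg =>
      obtain ⟨i, rfl⟩ := hg
      exact (h x y hx hy hxy i).congr fun n => (map_sub (L i) _ _).symm
    | zero => simp
    | add g g' _ _ hg hg' => simpa using hg.add hg'
    | smul a g _ hg => simpa using hg.const_mul a

/-- Countably many functionals, each a supremum of evaluations, combine to a dual norm. -/
theorem exists_isEquivalentDualNorm_of_family {ι : Type*} [Encodable ι]
    {S : ι → StrongDual ℝ X → ℝ} (hS : ∀ i, IsEvalSup (S i)) (hle : ∀ i μ, S i μ ≤ ‖μ‖) (i₀ : ι)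
    (hi₀ : ∀ μ, ‖μ‖ ≤ S i₀ μ + S i₀ (-μ)) :
    ∃ N : Seminorm ℝ (StrongDual ℝ X), IsEquivalentDualNorm N ∧
      (∀ μ ν, (∀ i, S i μ ≤ S i ν ∧ S i (-μ) ≤ S i (-ν)) → N μ ≤ N ν) ∧
      ∀ (x y : ℕ → StrongDual ℝ X) (M : ℝ), (∀ n, N (x n) ≤ M) → (∀ n, N (y n) ≤ M) →
        Agree (fun μ => N μ) x y →
        ∀ i, Agree (S i) x y ∧ Agree (S i) (fun n => -x n) (fun n => -y n) := by
  let w : ι → ℝ := fun i => (1 / 2) ^ Encodable.encode i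
  have hw : ∀ i, 0 < w i := fun i => by positivity
  have hwsum : Summable fun i => w i ^ 2 := by
    refine Summable.of_nonneg_of_le (fun i => sq_nonneg _) (fun i => ?_)
      (summable_geometric_two_encode (ι := ι))
    rw [sq]
    exact mul_le_of_le_one_left (hw i).le (pow_le_one₀ (by norm_num) (by norm_num))
  let W : Bool × ι → ℝ := fun j => w j.2
  have hWsum : Summable fun j => W j ^ 2 :=
    (summable_prod_of_nonneg fun j => sq_nonneg _).2 ⟨fun _ => hwsum, (hasSum_fintype _).summable⟩
  let T : Bool × ι → StrongDual ℝ X → ℝ := fun j μ =>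
    w j.2 * (if j.1 then S j.2 (-μ) else S j.2 μ)
  have hT : ∀ j, IsEvalSup (T j) := by
    rintro ⟨b, i⟩
    cases b
    · exact (hS i).const_mul (hw i)
    · exact (hS i).comp_neg.const_mul (hw i)
  have hTle : ∀ j μ, T j μ ≤ ‖μ‖ * W j := by
    rintro ⟨b, i⟩ μ
    rw [mul_comm ‖μ‖]
    refine mul_le_mul_of_nonneg_left ?_ (hw i).le
    cases b
    · exact hle i μ
    · exact (hle i (-μ)).trans_eq (norm_neg μ)
  have hWμ : ∀ μ : StrongDual ℝ X, Summable fun j => (‖μ‖ * W j) ^ 2 := fun μ => by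
    simp only [mul_pow]; exact hWsum.mul_left _
  have hTsum : ∀ μ, Summable fun j => T j μ ^ 2 := fun μ =>
    Summable.of_nonneg_of_le (fun j => sq_nonneg _)
      (fun j => pow_le_pow_left₀ ((hT j).nonneg μ) (hTle j μ) 2) (hWμ μ)
  have hE := IsEvalSup.l2norm hT hTsum
  have hneg : ∀ μ, l2norm (fun j => T j (-μ)) = l2norm fun j => T j μ := by
    intro μ
    rw [l2norm, l2norm]
    congr 1
    rw [← (Equiv.boolNot.prodCongr (Equiv.refl ι)).tsum_eq fun j => T j μ ^ 2]
    refine tsum_congr ?_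
    rintro ⟨b, i⟩
    cases b <;> simp [T]
  have heq : IsEquivalentNorm (hE.toSeminorm hneg) := by
    refine ⟨w i₀ / 2, l2norm W + 1, half_pos (hw i₀), by linarith [l2norm_nonneg W],
      fun μ => ⟨?_, ?_⟩⟩
    · have h1 : w i₀ * S i₀ μ ≤ hE.toSeminorm hneg μ := le_l2norm (hTsum μ) (false, i₀)
      have h2 : w i₀ * S i₀ (-μ) ≤ hE.toSeminorm hneg μ := le_l2norm (hTsum μ) (true, i₀)
      have h3 := mul_le_mul_of_nonneg_left (hi₀ μ) (hw i₀).le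
      linarith
    · have h1 : hE.toSeminorm hneg μ ≤ l2norm fun j => ‖μ‖ * W j :=
        l2norm_le_l2norm (hWμ μ) (fun j => (hT j).nonneg μ) fun j => hTle j μ
      have h2 : l2norm (fun j => ‖μ‖ * W j) = ‖μ‖ * l2norm W := by
        rw [l2norm, l2norm]
        simp only [mul_pow]
        rw [tsum_mul_left, Real.sqrt_mul (sq_nonneg _), Real.sqrt_sq (norm_nonneg μ)]
      rw [h2] at h1
      nlinarith [norm_nonneg μ]
  refine ⟨hE.toSeminorm hneg, isEquivalentDualNorm_of_isEvalSup heq hE, fun μ ν h => ?_,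
    fun x y M hx hy hxy i => ?_⟩
  · refine l2norm_le_l2norm (hTsum ν) (fun j => (hT j).nonneg μ) ?_
    rintro ⟨b, i⟩
    refine mul_le_mul_of_nonneg_left ?_ (hw i).le
    cases b
    · exact (h i).1
    · exact (h i).2
  · have key := fun j => Agree.of_l2norm (fun j => (hT j).nonneg) (fun j => (hT j).add_le) hTsum
      hx hy hxy j
    refine ⟨(key (false, i)).of_mul (hw i).ne', ?_⟩
    have := Agree.of_mul (S := fun μ => S i (-μ)) (hw i).ne' (key (true, i))
    refine ⟨this.1, this.2.congr fun n => ?_⟩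
    have hadd : -(x n + y n) = -x n + -y n := neg_add _ _
    simp only [hadd]

end EvalSup

/-! ### Layers of disjoint sets -/

section Layers

open Set Filter Topology

variable {X : Type*} [TopologicalSpace X]

/-- A family of pairwise disjoint sets, each of which is relatively open in the complement of a
remainder with open union. -/
structure Layer (X : Type*) [TopologicalSpace X] where
  rest : Set X
  cells : Set (Set X)
  isOpen_rest : IsOpen rest
  isOpen_union : ∀ D ∈ cells, IsOpen (D ∪ rest)
  disjoint_rest : ∀ D ∈ cells, Disjoint D rest
  pairwise : ∀ D ∈ cells, ∀ D' ∈ cells, D ≠ D' → Disjoint D D'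

namespace Layer

/-- The layer with the whole space as its only cell. -/
def top : Layer X where
  rest := ∅
  cells := {univ}
  isOpen_rest := isOpen_empty
  isOpen_union D hD := by rw [mem_singleton_iff.1 hD, univ_union]; exact isOpen_univ
  disjoint_rest D _ := disjoint_empty D
  pairwise D hD D' hD' h := absurd ((mem_singleton_iff.1 hD).trans (mem_singleton_iff.1 hD').symm) h

/-- The common refinement of two layers. -/
def inter (K L : Layer X) : Layer X where
  rest := K.rest ∪ L.rest
  cells := image2 (· ∩ ·) K.cells L.cells
  isOpen_rest := K.isOpen_rest.union L.isOpen_rest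
  isOpen_union := by
    rintro _ ⟨D, hD, D', hD', rfl⟩
    have h : D ∩ D' ∪ (K.rest ∪ L.rest) = (D ∪ K.rest ∪ L.rest) ∩ (D' ∪ L.rest ∪ K.rest) := by
      ext x; simp only [mem_union, mem_inter_iff]; tauto
    rw [h]
    exact ((K.isOpen_union D hD).union L.isOpen_rest).inter
      ((L.isOpen_union D' hD').union K.isOpen_rest)
  disjoint_rest := by
    rintro _ ⟨D, hD, D', hD', rfl⟩
    exact disjoint_union_right.2 ⟨(K.disjoint_rest D hD).mono_left inter_subset_left,
      (L.disjoint_rest D' hD').mono_left inter_subset_right⟩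
  pairwise := by
    rintro _ ⟨D, hD, D', hD', rfl⟩ _ ⟨C, hC, C', hC', rfl⟩ h
    by_cases h1 : D = C
    · have h2 : D' ≠ C' := fun h2 => h (by rw [h1, h2])
      exact (L.pairwise D' hD' C' hC' h2).mono inter_subset_right inter_subset_right
    · exact (K.pairwise D hD C hC h1).mono inter_subset_left inter_subset_left

/-- The points lying in exactly `k` members of a family of open sets, sorted by those members. -/
def ofOpens (𝒰 : Set (Set X)) (h𝒰 : ∀ U ∈ 𝒰, IsOpen U) (k : ℕ) : Layer X where
  rest := ⋃ F ∈ {F : Finset (Set X) | (F : Set (Set X)) ⊆ 𝒰 ∧ F.card = k + 1}, ⋂ U ∈ F, U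
  cells := (fun F : Finset (Set X) => {x | ∀ U ∈ 𝒰, x ∈ U ↔ U ∈ F}) ''
    {F : Finset (Set X) | (F : Set (Set X)) ⊆ 𝒰 ∧ F.card = k}
  isOpen_rest := isOpen_biUnion fun F hF => isOpen_biInter_finset fun U hU => h𝒰 U (hF.1 hU)
  isOpen_union := by
    classical
    rintro _ ⟨F, hF, rfl⟩
    have h : {x | ∀ U ∈ 𝒰, x ∈ U ↔ U ∈ F} ∪
        (⋃ F ∈ {F : Finset (Set X) | (F : Set (Set X)) ⊆ 𝒰 ∧ F.card = k + 1}, ⋂ U ∈ F, U) =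
        (⋂ U ∈ F, U) ∪
        (⋃ F ∈ {F : Finset (Set X) | (F : Set (Set X)) ⊆ 𝒰 ∧ F.card = k + 1}, ⋂ U ∈ F, U) := by
      refine subset_antisymm (union_subset_union_left _ fun x hx => mem_iInter₂.2 fun U hU =>
        (hx U (hF.1 hU)).2 hU) (union_subset (fun x hx => ?_) subset_union_right)
      by_cases h : ∀ U ∈ 𝒰, x ∈ U ↔ U ∈ F
      · exact Or.inl h
      · right
        have hx' : ∀ U ∈ F, x ∈ U := fun U hU => mem_iInter₂.1 hx U hU
        obtain ⟨U, hU, hxU, hUF⟩ : ∃ U ∈ 𝒰, x ∈ U ∧ U ∉ F := by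
          by_contra! hcon
          exact h fun U hU => ⟨hcon U hU, hx' U⟩
        refine mem_iUnion₂.2 ⟨insert U F, ⟨?_, ?_⟩, mem_iInter₂.2 fun V hV => ?_⟩
        · rw [Finset.coe_insert]; exact insert_subset hU hF.1
        · rw [Finset.card_insert_of_notMem hUF, hF.2]
        · rcases Finset.mem_insert.1 hV with rfl | hV
          · exact hxU
          · exact hx' V hV
    rw [h]
    exact (isOpen_biInter_finset fun U hU => h𝒰 U (hF.1 hU)).union
      (isOpen_biUnion fun F hF => isOpen_biInter_finset fun U hU => h𝒰 U (hF.1 hU))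
  disjoint_rest := by
    rintro _ ⟨F, hF, rfl⟩
    refine disjoint_left.2 fun x hx hx' => ?_
    obtain ⟨G, hG, hxG⟩ := mem_iUnion₂.1 hx'
    have : G ⊆ F := fun U hU => (hx U (hG.1 hU)).1 (mem_iInter₂.1 hxG U hU)
    have := Finset.card_le_card this
    rw [hF.2, hG.2] at this
    omega
  pairwise := by
    rintro _ ⟨F, hF, rfl⟩ _ ⟨G, hG, rfl⟩ h
    refine disjoint_left.2 fun x hx hx' => h ?_
    have : F = G := Finset.ext fun U =>
      ⟨fun hU => (hx' U (hF.1 hU)).1 ((hx U (hF.1 hU)).2 hU),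
        fun hU => (hx U (hG.1 hU)).1 ((hx' U (hG.1 hU)).2 hU)⟩
    rw [this]

/-- The common refinement of finitely many of the layers given by a sequence of families of
open sets. -/
def ofWord (𝒰 : ℕ → Set (Set X)) (h𝒰 : ∀ n, ∀ U ∈ 𝒰 n, IsOpen U) : List (ℕ × ℕ) → Layer X
  | [] => top
  | a :: l => (ofOpens (𝒰 a.1) (h𝒰 a.1) a.2).inter (ofWord 𝒰 h𝒰 l)

theorem exists_separating_cell {𝒰 : ℕ → Set (Set X)} (h𝒰 : ∀ n, ∀ U ∈ 𝒰 n, IsOpen U)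
    (hsep : ∀ x y : X, x ≠ y → ∃ n, ∃ U ∈ 𝒰 n, (∃ z, U ∩ {x, y} = {z}) ∧
      ({V | V ∈ 𝒰 n ∧ x ∈ V}.Finite ∨ {V | V ∈ 𝒰 n ∧ y ∈ V}.Finite)) {x y : X} (hxy : x ≠ y) :
    ∃ n k, ∃ D ∈ (ofOpens (𝒰 n) (h𝒰 n) k).cells, x ∈ D ∧ y ∉ D ∨ x ∉ D ∧ y ∈ D := by
  obtain ⟨n, U, hU, ⟨z, hz⟩, hfin⟩ := hsep x y hxy
  have hU' : x ∈ U ∧ y ∉ U ∨ x ∉ U ∧ y ∈ U := by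
    by_cases hx : x ∈ U
    · by_cases hy : y ∈ U
      · have h1 : x ∈ U ∩ {x, y} := ⟨hx, by simp⟩
        have h2 : y ∈ U ∩ {x, y} := ⟨hy, by simp⟩
        rw [hz] at h1 h2
        exact absurd (h1.trans h2.symm) hxy
      · exact Or.inl ⟨hx, hy⟩
    · by_cases hy : y ∈ U
      · exact Or.inr ⟨hx, hy⟩
      · have h1 : z ∈ U ∩ {x, y} := by rw [hz]; rfl
        rcases h1.2 with rfl | h
        · exact absurd h1.1 hx
        · rw [mem_singleton_iff.1 h] at h1; exact absurd h1.1 hy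
  have key : ∀ {a b : X}, (a ∈ U ∧ b ∉ U ∨ a ∉ U ∧ b ∈ U) → {V | V ∈ 𝒰 n ∧ a ∈ V}.Finite →
      ∃ k, ∃ D ∈ (ofOpens (𝒰 n) (h𝒰 n) k).cells, a ∈ D ∧ b ∉ D := by
    intro a b hab hfin
    have hmem : ∀ V, V ∈ hfin.toFinset ↔ V ∈ 𝒰 n ∧ a ∈ V := fun V => hfin.mem_toFinset
    refine ⟨hfin.toFinset.card, _, ⟨hfin.toFinset, ⟨fun V hV => ((hmem V).1 hV).1, rfl⟩, rfl⟩,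
      fun V hV => ⟨fun h => (hmem V).2 ⟨hV, h⟩, fun h => ((hmem V).1 h).2⟩, fun hb => ?_⟩
    have := (hb U hU).trans (hmem U)
    tauto
  rcases hfin with h | h
  · obtain ⟨k, D, hD, h⟩ := key hU' h
    exact ⟨n, k, D, hD, Or.inl h⟩
  · obtain ⟨k, D, hD, h⟩ := key (a := y) (b := x) (by tauto) h
    exact ⟨n, k, D, hD, Or.inr ⟨h.2, h.1⟩⟩

theorem eq_zero_of_forall_finset {X : Type*} {m : X → ℝ} (hm : Summable m) {t₀ : X}
    (h : ∀ S : Finset X, t₀ ∉ S → ∃ C : Set X, t₀ ∈ C ∧ (∀ s ∈ S, s ∉ C) ∧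
      ∑' t, C.indicator m t = 0) : m t₀ = 0 := by
  classical
  by_contra ht₀
  have hpos : 0 < |m t₀| := abs_pos.2 ht₀
  obtain ⟨S, htS, hS⟩ : ∃ S : Finset X, t₀ ∈ S ∧ ∑' t, |m t| - |m t₀| < ∑ t ∈ S, |m t| := by
    obtain ⟨S, hS⟩ := (hm.abs.hasSum.eventually
      (lt_mem_nhds (sub_lt_self (∑' t, |m t|) hpos))).exists
    exact ⟨insert t₀ S, Finset.mem_insert_self _ _, hS.trans_le
      (Finset.sum_le_sum_of_subset_of_nonneg (Finset.subset_insert _ _) fun _ _ _ => abs_nonneg _)⟩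
  obtain ⟨C, htC, hSC, hC0⟩ := h (S.erase t₀) (S.notMem_erase t₀)
  obtain ⟨g, hg⟩ : ∃ g : X → ℝ, ∀ t, g t = C.indicator m t - ({t₀} : Set X).indicator m t :=
    ⟨_, fun _ => rfl⟩
  have hgsum : Summable g := ((hm.indicator C).sub (hm.indicator {t₀})).congr fun t => (hg t).symm
  have hsingle : ∑' t, ({t₀} : Set X).indicator m t = m t₀ := by
    rw [tsum_eq_single t₀ fun s hs => indicator_of_notMem (s := {t₀}) hs m,
      indicator_of_mem (mem_singleton t₀)]
  have hgt : ∑' t, g t = - m t₀ := by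
    rw [tsum_congr hg, (hm.indicator _).tsum_sub (hm.indicator _), hC0, hsingle, zero_sub]
  have hgle : ∀ t, |g t| ≤ |m t| - (S : Set X).indicator (fun t => |m t|) t := by
    intro t
    by_cases ht : t = t₀
    · subst ht
      rw [hg, indicator_of_mem htC, indicator_of_mem (mem_singleton t),
        indicator_of_mem (Finset.mem_coe.2 htS), sub_self, sub_self, abs_zero]
    · have h1 : g t = C.indicator m t := by
        rw [hg, indicator_of_notMem (s := {t₀}) ht, sub_zero]
      rw [h1]
      by_cases htS' : t ∈ S
      · rw [indicator_of_notMem (hSC t (Finset.mem_erase.2 ⟨ht, htS'⟩)), abs_zero,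
          indicator_of_mem (Finset.mem_coe.2 htS'), sub_self]
      · rw [indicator_of_notMem (fun h => htS' (Finset.mem_coe.1 h)), sub_zero]
        by_cases htC' : t ∈ C
        · rw [indicator_of_mem htC']
        · rw [indicator_of_notMem htC', abs_zero]; exact abs_nonneg _
  have h1 : ∑' t, |g t| ≤ ∑' t, |m t| - ∑ t ∈ S, |m t| := by
    refine (hgsum.abs.tsum_le_tsum hgle (hm.abs.sub (hm.abs.indicator _))).trans_eq ?_
    rw [hm.abs.tsum_sub (hm.abs.indicator _), sum_eq_tsum_indicator]
  have h2 : |∑' t, g t| ≤ ∑' t, |g t| := by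
    have := norm_tsum_le_tsum_norm hgsum.norm
    simpa only [Real.norm_eq_abs] using this
  rw [hgt, abs_neg] at h2
  linarith

/-- A summable family is determined by its sums over the cells of all layers. -/
theorem eq_zero_of_forall_tsum_cell {𝒰 : ℕ → Set (Set X)} (h𝒰 : ∀ n, ∀ U ∈ 𝒰 n, IsOpen U)
    (hsep : ∀ x y : X, x ≠ y → ∃ n, ∃ U ∈ 𝒰 n, (∃ z, U ∩ {x, y} = {z}) ∧
      ({V | V ∈ 𝒰 n ∧ x ∈ V}.Finite ∨ {V | V ∈ 𝒰 n ∧ y ∈ V}.Finite)) {m : X → ℝ} (hm : Summable m)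
    (h : ∀ l, ∀ D ∈ (ofWord 𝒰 h𝒰 l).cells, ∑' t, D.indicator m t = 0) : m = 0 := by
  classical
  by_contra hne
  obtain ⟨t₀, ht₀⟩ := Function.ne_iff.1 hne
  let Q : Set X → Prop := fun C =>
    ∀ l, ∀ D ∈ (ofWord 𝒰 h𝒰 l).cells, ∑' t, (C ∩ D).indicator m t = 0
  have hinter : ∀ {C n k D}, D ∈ (ofOpens (𝒰 n) (h𝒰 n) k).cells → Q C → Q (C ∩ D) := by
    intro C n k D hD hC l E hE
    rw [inter_assoc]
    exact hC ((n, k) :: l) _ ⟨D, hD, E, hE, rfl⟩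
  have hdiff : ∀ {C n k D}, D ∈ (ofOpens (𝒰 n) (h𝒰 n) k).cells → Q C → Q (C \ D) := by
    intro C n k D hD hC l E hE
    have h1 := hC l E hE
    have h2 := hinter hD hC l E hE
    have h3 : (C ∩ E).indicator m = fun t =>
        (C ∩ D ∩ E).indicator m t + ((C \ D) ∩ E).indicator m t := by
      ext t
      simp only [indicator, mem_inter_iff, Set.mem_sdiff]
      by_cases t ∈ C <;> by_cases t ∈ D <;> by_cases t ∈ E <;> simp [*]
    rw [h3, (hm.indicator _).tsum_add (hm.indicator _), h2, zero_add] at h1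
    exact h1
  have hcell : ∀ S : Finset X, t₀ ∉ S → ∃ C, Q C ∧ t₀ ∈ C ∧ ∀ s ∈ S, s ∉ C := by
    intro S
    induction S using Finset.induction_on with
    | empty => exact fun _ => ⟨univ, fun l D hD => by rw [univ_inter]; exact h l D hD, mem_univ _,
        by simp⟩
    | insert s S _ ih =>
      intro hS
      rw [Finset.mem_insert, not_or] at hS
      obtain ⟨C, hC, htC, hSC⟩ := ih hS.2
      obtain ⟨n, k, D, hD, ⟨h1, h2⟩ | ⟨h1, h2⟩⟩ := exists_separating_cell h𝒰 hsep hS.1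
      · refine ⟨C ∩ D, hinter hD hC, ⟨htC, h1⟩, fun r hr hrC => ?_⟩
        rcases Finset.mem_insert.1 hr with rfl | hr
        · exact h2 hrC.2
        · exact hSC r hr hrC.1
      · refine ⟨C \ D, hdiff hD hC, ⟨htC, h1⟩, fun r hr hrC => ?_⟩
        rcases Finset.mem_insert.1 hr with rfl | hr
        · exact hrC.2 h2
        · exact hSC r hr hrC.1
  refine ht₀ (eq_zero_of_forall_finset hm fun S hS => ?_)
  obtain ⟨C, hC, htC, hSC⟩ := hcell S hS
  refine ⟨C, htC, hSC, ?_⟩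
  have := hC [] univ rfl
  rwa [inter_univ] at this

end Layer

end Layers

/-! ### Functionals attached to a layer -/

theorem Set.indicator_one_nonneg {X : Type*} (A : Set X) (t : X) : 0 ≤ A.indicator (fun _ => (1 : ℝ)) t :=
  Set.indicator_nonneg (fun _ _ => zero_le_one) t

theorem Set.indicator_one_le_one {X : Type*} (A : Set X) (t : X) : A.indicator (fun _ => (1 : ℝ)) t ≤ 1 :=
  Set.indicator_le_self' (f := fun _ => (1 : ℝ)) (fun _ _ => zero_le_one) t

namespace Layer

open Set Filter Topology

variable {X : Type*} [TopologicalSpace X]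

/-- The weight with value `1` on the remainder and `k D` on the cell `D`. -/
noncomputable def weight (L : Layer X) (T : Finset L.cells) (k : L.cells → ℝ) (t : X) : ℝ :=
  L.rest.indicator (fun _ => 1) t + ∑ D ∈ T, k D * (D : Set X).indicator (fun _ => 1) t

section Weight

variable {L : Layer X} {T : Finset L.cells} {k : L.cells → ℝ}

theorem weight_of_mem_rest {t : X} (ht : t ∈ L.rest) : L.weight T k t = 1 := by
  rw [weight, indicator_of_mem ht, Finset.sum_eq_zero, add_zero]
  intro D _
  rw [indicator_of_notMem fun h => disjoint_left.1 (L.disjoint_rest D D.2) h ht, mul_zero]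

theorem weight_of_mem {D : L.cells} (hD : D ∈ T) {t : X} (ht : t ∈ (D : Set X)) :
    L.weight T k t = k D := by
  rw [weight, indicator_of_notMem fun h => disjoint_left.1 (L.disjoint_rest D D.2) ht h,
    Finset.sum_eq_single_of_mem D hD, indicator_of_mem ht, mul_one, zero_add]
  intro E _ hne
  rw [indicator_of_notMem fun h => disjoint_left.1
    (L.pairwise E E.2 D D.2 fun h => hne (Subtype.ext h)) h ht, mul_zero]

theorem weight_of_forall_notMem {t : X} (ht : t ∉ L.rest)
    (h : ∀ D ∈ T, t ∉ (D : Set X)) : L.weight T k t = 0 := by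
  rw [weight, indicator_of_notMem ht, Finset.sum_eq_zero, add_zero]
  intro D hD
  rw [indicator_of_notMem (h D hD), mul_zero]

theorem weight_nonneg (hk : ∀ D, 0 ≤ k D) (t : X) : 0 ≤ L.weight T k t :=
  add_nonneg (indicator_one_nonneg _ t)
    (Finset.sum_nonneg fun D _ => mul_nonneg (hk D) (indicator_one_nonneg _ t))

theorem weight_cases (L : Layer X) (T : Finset L.cells) (t : X) :
    t ∈ L.rest ∨ (∃ D ∈ T, t ∈ (D : Set X)) ∨ (t ∉ L.rest ∧ ∀ D ∈ T, t ∉ (D : Set X)) := by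
  by_cases h1 : t ∈ L.rest
  · exact Or.inl h1
  · by_cases h2 : ∃ D ∈ T, t ∈ (D : Set X)
    · exact Or.inr (Or.inl h2)
    · push Not at h2
      exact Or.inr (Or.inr ⟨h1, h2⟩)

theorem weight_le_one (hk : ∀ D ∈ T, k D ≤ 1) (t : X) : L.weight T k t ≤ 1 := by
  rcases weight_cases L T t with h | ⟨D, hD, h⟩ | ⟨h1, h2⟩
  · rw [weight_of_mem_rest h]
  · rw [weight_of_mem hD h]; exact hk D hD
  · rw [weight_of_forall_notMem h1 h2]; exact zero_le_one

theorem lowerSemicontinuous_weight (hk₀ : ∀ D, 0 ≤ k D) (hk : ∀ D ∈ T, k D ≤ 1) :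
    LowerSemicontinuous (L.weight T k) := by
  intro t r hr
  rcases weight_cases L T t with h | ⟨D, hD, h⟩ | ⟨h1, h2⟩
  · rw [weight_of_mem_rest h] at hr
    filter_upwards [L.isOpen_rest.mem_nhds h] with s hs
    rwa [weight_of_mem_rest hs]
  · rw [weight_of_mem hD h] at hr
    filter_upwards [(L.isOpen_union D D.2).mem_nhds (Or.inl h)] with s hs
    rcases hs with hs | hs
    · rwa [weight_of_mem hD hs]
    · rw [weight_of_mem_rest hs]; exact hr.trans_le (hk D hD)
  · rw [weight_of_forall_notMem h1 h2] at hr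
    exact Eventually.of_forall fun s => hr.trans_le (weight_nonneg hk₀ s)

end Weight

end Layer

namespace HausdorffTree

open Set Filter Topology ZeroAtInftyContinuousMap

/-- The positive part plus `κ` times the negative part. -/
def asymAbs (κ x : ℝ) : ℝ := max x (-(κ * x))

section Gauge

variable {κ : ℝ}

theorem asymAbs_eq (hκ : 0 ≤ κ) (x : ℝ) : asymAbs κ x = x⁺ + κ * x⁻ := by
  rcases le_total 0 x with h | h
  · rw [asymAbs, max_eq_left (by nlinarith), posPart_of_nonneg h, negPart_of_nonneg h]; ring
  · rw [asymAbs, max_eq_right (by nlinarith), posPart_of_nonpos h, negPart_of_nonpos h]; ring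

theorem asymAbs_nonneg (hκ : 0 ≤ κ) (x : ℝ) : 0 ≤ asymAbs κ x := by
  rw [asymAbs_eq hκ]
  exact add_nonneg (posPart_nonneg x) (mul_nonneg hκ (negPart_nonneg x))

theorem asymAbs_le_abs (hκ : 0 ≤ κ) (hκ1 : κ ≤ 1) (x : ℝ) : asymAbs κ x ≤ |x| := by
  rw [asymAbs_eq hκ, ← posPart_add_negPart]
  exact add_le_add_right (mul_le_of_le_one_left (negPart_nonneg x) hκ1) _

theorem asymAbs_add_le (x y : ℝ) : asymAbs κ (x + y) ≤ asymAbs κ x + asymAbs κ y := by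
  refine max_le (add_le_add (le_max_left _ _) (le_max_left _ _)) ?_
  rw [mul_add, neg_add]
  exact add_le_add (le_max_right _ _) (le_max_right _ _)

theorem abs_le_asymAbs_add (hκ : 0 ≤ κ) (x : ℝ) : |x| ≤ asymAbs κ x + asymAbs κ (-x) := by
  rcases abs_cases x with ⟨h, -⟩ | ⟨h, -⟩ <;> rw [h]
  · exact (le_max_left _ _).trans (le_add_of_nonneg_right (asymAbs_nonneg hκ _))
  · exact (le_max_left _ _).trans (le_add_of_nonneg_left (asymAbs_nonneg hκ _))

theorem mul_le_mul_asymAbs {x f h : ℝ} (h₀ : 0 ≤ h) (h₁ : -(κ * h) ≤ f) (h₂ : f ≤ h) :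
    x * f ≤ h * asymAbs κ x := by
  rcases le_total 0 x with hx | hx
  · exact (mul_le_mul_of_nonneg_left h₂ hx).trans
      ((mul_comm x h).trans_le (mul_le_mul_of_nonneg_left (le_max_left _ _) h₀))
  · refine (mul_le_mul_of_nonpos_left h₁ hx).trans (le_trans (le_of_eq ?_)
      (mul_le_mul_of_nonneg_left (le_max_right x (-(κ * x))) h₀))
    ring

end Gauge

variable {Υ : Type*} [PartialOrder Υ] [TopologicalSpace Υ] [HausdorffTree Υ]

/-- The sum of the asymmetric moduli of the masses, weighted by `h`. -/
noncomputable def weightedVar (κ : ℝ) (h : Υ → ℝ) (μ : StrongDual ℝ C₀(Υ, ℝ)) : ℝ :=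
  ∑' t, h t * asymAbs κ (mass μ t)

section WeightedVar

variable {κ : ℝ} (hκ : 0 ≤ κ) (hκ1 : κ ≤ 1)
include hκ hκ1

theorem summable_asymAbs (μ : StrongDual ℝ C₀(Υ, ℝ)) : Summable fun t => asymAbs κ (mass μ t) :=
  Summable.of_nonneg_of_le (fun _ => asymAbs_nonneg hκ _) (fun _ => asymAbs_le_abs hκ hκ1 _)
    (summable_mass μ).abs

theorem summable_weightedVar {h : Υ → ℝ} (h₀ : ∀ t, 0 ≤ h t) (h₁ : ∀ t, h t ≤ 1)
    (μ : StrongDual ℝ C₀(Υ, ℝ)) : Summable fun t => h t * asymAbs κ (mass μ t) :=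
  Summable.of_nonneg_of_le (fun t => mul_nonneg (h₀ t) (asymAbs_nonneg hκ _))
    (fun t => mul_le_of_le_one_left (asymAbs_nonneg hκ _) (h₁ t)) (summable_asymAbs hκ hκ1 μ)

theorem weightedVar_le_norm {h : Υ → ℝ} (h₀ : ∀ t, 0 ≤ h t) (h₁ : ∀ t, h t ≤ 1)
    (μ : StrongDual ℝ C₀(Υ, ℝ)) : weightedVar κ h μ ≤ ‖μ‖ := by
  rw [norm_eq_tsum]
  exact (summable_weightedVar hκ hκ1 h₀ h₁ μ).tsum_le_tsum
    (fun t => (mul_le_of_le_one_left (asymAbs_nonneg hκ _) (h₁ t)).trans (asymAbs_le_abs hκ hκ1 _))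
    (summable_mass μ).abs

theorem weightedVar_add_le {h : Υ → ℝ} (h₀ : ∀ t, 0 ≤ h t) (h₁ : ∀ t, h t ≤ 1)
    (μ ν : StrongDual ℝ C₀(Υ, ℝ)) :
    weightedVar κ h (μ + ν) ≤ weightedVar κ h μ + weightedVar κ h ν := by
  have hs := summable_weightedVar hκ hκ1 h₀ h₁
  rw [weightedVar, weightedVar, weightedVar, ← (hs μ).tsum_add (hs ν)]
  refine (hs (μ + ν)).tsum_le_tsum (fun t => ?_) ((hs μ).add (hs ν))
  rw [← mul_add, mass_add]
  exact mul_le_mul_of_nonneg_left (asymAbs_add_le _ _) (h₀ t)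

theorem isEvalSup_weightedVar {h : Υ → ℝ} (hl : LowerSemicontinuous h) (h₀ : ∀ t, 0 ≤ h t)
    (h₁ : ∀ t, h t ≤ 1) : IsEvalSup (weightedVar κ h) where
  nonneg μ := tsum_nonneg fun t => mul_nonneg (h₀ t) (asymAbs_nonneg hκ _)
  exists_lt μ r hr := by
    have hl' : LowerSemicontinuous fun t => κ * h t :=
      (continuous_const_mul κ).comp_lowerSemicontinuous hl fun _ _ h => mul_le_mul_of_nonneg_left h hκ
    obtain ⟨f, hf, hrf⟩ := exists_lt_tsum (summable_mass μ) hl hl' h₀ (fun t => mul_nonneg hκ (h₀ t))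
      h₁ (fun t => mul_le_one₀ hκ1 (h₀ t) (h₁ t)) (c := r) (by
        refine hr.trans_le (le_of_eq (tsum_congr fun t => ?_))
        rw [asymAbs_eq hκ]; ring)
    refine ⟨f, by rwa [apply_eq_tsum], fun ν => ?_⟩
    rw [apply_eq_tsum]
    exact (summable_mul (summable_mass ν) f).tsum_le_tsum
      (fun t => mul_le_mul_asymAbs (h₀ t) (hf t).1 (hf t).2) (summable_weightedVar hκ hκ1 h₀ h₁ ν)

end WeightedVar

/-- The variation on a set. -/
noncomputable def setVar (κ : ℝ) (A : Set Υ) : StrongDual ℝ C₀(Υ, ℝ) → ℝ :=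
  weightedVar κ (A.indicator fun _ => 1)

theorem setVar_eq (κ : ℝ) (A : Set Υ) (μ : StrongDual ℝ C₀(Υ, ℝ)) :
    setVar κ A μ = ∑' t, A.indicator (fun t => asymAbs κ (mass μ t)) t :=
  tsum_congr fun t => by
    by_cases ht : t ∈ A
    · rw [indicator_of_mem ht, indicator_of_mem ht, one_mul]
    · rw [indicator_of_notMem ht, indicator_of_notMem ht, zero_mul]

/-- The variation on the remainder of a layer plus the quadratic mean of the variations on its
cells. -/
noncomputable def layerVar (κ : ℝ) (L : Layer Υ) (μ : StrongDual ℝ C₀(Υ, ℝ)) : ℝ :=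
  setVar κ L.rest μ + l2norm fun D : L.cells => setVar κ (D : Set Υ) μ

theorem setVar_nonneg {κ : ℝ} (hκ : 0 ≤ κ) (A : Set Υ) (μ : StrongDual ℝ C₀(Υ, ℝ)) : 0 ≤ setVar κ A μ :=
  tsum_nonneg fun t => mul_nonneg (indicator_one_nonneg A t) (asymAbs_nonneg hκ _)

section LayerVar

variable {κ : ℝ} (hκ : 0 ≤ κ) (hκ1 : κ ≤ 1)
include hκ hκ1

theorem setVar_le_norm (A : Set Υ) (μ : StrongDual ℝ C₀(Υ, ℝ)) : setVar κ A μ ≤ ‖μ‖ :=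
  weightedVar_le_norm hκ hκ1 (indicator_one_nonneg A) (indicator_one_le_one A) μ

theorem weightedVar_weight {L : Layer Υ} {T : Finset L.cells} {k : L.cells → ℝ}
    (μ : StrongDual ℝ C₀(Υ, ℝ)) :
    weightedVar κ (L.weight T k) μ =
      setVar κ L.rest μ + ∑ D ∈ T, k D * setVar κ (D : Set Υ) μ := by
  have hs : ∀ A : Set Υ, Summable fun t => A.indicator (fun _ => (1 : ℝ)) t * asymAbs κ (mass μ t) :=
    fun A => summable_weightedVar hκ hκ1 (indicator_one_nonneg A) (indicator_one_le_one A) μ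
  simp only [setVar, weightedVar, Layer.weight, add_mul, Finset.sum_mul, mul_assoc]
  rw [(hs _).tsum_add (summable_sum fun D (_ : D ∈ T) => (hs D).mul_left (k D)),
    Summable.tsum_finsetSum fun D (_ : D ∈ T) => (hs D).mul_left (k D)]
  simp only [tsum_mul_left]

theorem summable_setVar_sq (L : Layer Υ) (μ : StrongDual ℝ C₀(Υ, ℝ)) :
    Summable fun D : L.cells => setVar κ (D : Set Υ) μ ^ 2 := by
  have h : Summable fun D : L.cells => setVar κ (D : Set Υ) μ := by
    refine summable_of_sum_le (c := ‖μ‖) (fun D => setVar_nonneg hκ _ μ) fun T => ?_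
    have h1 := weightedVar_le_norm hκ hκ1 (Layer.weight_nonneg (L := L) (T := T) (k := fun _ => 1)
      fun _ => zero_le_one) (Layer.weight_le_one fun _ _ => le_rfl) μ
    rw [weightedVar_weight hκ hκ1] at h1
    simp only [one_mul] at h1
    linarith [setVar_nonneg hκ L.rest μ]
  refine Summable.of_nonneg_of_le (fun D => sq_nonneg _) (fun D => ?_) (h.mul_left ‖μ‖)
  rw [sq]
  exact mul_le_mul_of_nonneg_right (setVar_le_norm hκ hκ1 _ μ) (setVar_nonneg hκ _ μ)

theorem isEvalSup_setVar {A : Set Υ} (hA : IsOpen A) : IsEvalSup (setVar κ A) :=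
  isEvalSup_weightedVar hκ hκ1 (hA.lowerSemicontinuous_indicator zero_le_one)
    (indicator_one_nonneg A) (indicator_one_le_one A)

theorem exists_weight {L : Layer Υ} {μ : StrongDual ℝ C₀(Υ, ℝ)} {r : ℝ}
    (hr : r < layerVar κ L μ) :
    ∃ (T : Finset L.cells) (k : L.cells → ℝ), (∀ D, 0 ≤ k D) ∧ (∀ D ∈ T, k D ≤ 1) ∧
      ∑ D ∈ T, k D ^ 2 ≤ 1 ∧ r < weightedVar κ (L.weight T k) μ := by
  obtain ⟨T, k, hk₀, hk, hT⟩ := exists_lt_sum_mul (summable_setVar_sq hκ hκ1 L μ)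
    (fun D => setVar_nonneg hκ _ μ) (sub_lt_iff_lt_add'.2 hr)
  refine ⟨T, k, hk₀, fun D hD => ?_, hk, ?_⟩
  · have h1 := (Finset.single_le_sum (f := fun D => k D ^ 2) (fun _ _ => sq_nonneg _) hD).trans hk
    exact (sq_le_one_iff₀ (hk₀ D)).1 h1
  · rw [weightedVar_weight hκ hκ1]; linarith

theorem isEvalSup_layerVar (L : Layer Υ) : IsEvalSup (layerVar κ L) where
  nonneg μ := add_nonneg (setVar_nonneg hκ _ μ) (l2norm_nonneg _)
  exists_lt μ r hr := by
    obtain ⟨T, k, hk₀, hk₁, hk, hT⟩ := exists_weight hκ hκ1 hr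
    obtain ⟨f, hf, hle⟩ := (isEvalSup_weightedVar hκ hκ1 (Layer.lowerSemicontinuous_weight hk₀ hk₁)
      (Layer.weight_nonneg hk₀) (Layer.weight_le_one hk₁)).exists_lt μ r hT
    refine ⟨f, hf, fun ν => (hle ν).trans ?_⟩
    rw [weightedVar_weight hκ hκ1]
    exact add_le_add_right (sum_mul_le_l2norm (summable_setVar_sq hκ hκ1 L ν) hk) _

theorem layerVar_le_norm (L : Layer Υ) (μ : StrongDual ℝ C₀(Υ, ℝ)) : layerVar κ L μ ≤ ‖μ‖ := by
  refine le_of_forall_lt fun r hr => ?_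
  obtain ⟨T, k, hk₀, hk₁, -, hT⟩ := exists_weight hκ hκ1 hr
  exact hT.trans_le (weightedVar_le_norm hκ hκ1 (Layer.weight_nonneg hk₀) (Layer.weight_le_one hk₁) μ)

theorem agree_setVar {L : Layer Υ} {x y : ℕ → StrongDual ℝ C₀(Υ, ℝ)} {M : ℝ}
    (hx : ∀ n, ‖x n‖ ≤ M) (hy : ∀ n, ‖y n‖ ≤ M) (h : Agree (setVar κ L.rest) x y)
    (h' : Agree (layerVar κ L) x y) (D : L.cells) : Agree (setVar κ (D : Set Υ)) x y := by
  have hle : ∀ μ : StrongDual ℝ C₀(Υ, ℝ), ‖μ‖ ≤ M →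
      l2norm (fun D : L.cells => setVar κ (D : Set Υ) μ) ≤ M := fun μ hμ => by
    have := layerVar_le_norm hκ hκ1 L μ
    rw [layerVar] at this
    linarith [setVar_nonneg hκ L.rest μ]
  exact Agree.of_l2norm (S := fun (D : L.cells) μ => setVar κ (D : Set Υ) μ)
    (fun D μ => setVar_nonneg hκ _ μ)
    (fun D μ ν => weightedVar_add_le hκ hκ1 (indicator_one_nonneg _) (indicator_one_le_one _) μ ν)
    (summable_setVar_sq hκ hκ1 L) (fun n => hle _ (hx n)) (fun n => hle _ (hy n)) (h.of_add h') D

end LayerVar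

end HausdorffTree

/-! ### Norms on the dual of `C₀(Υ)` for Gruenhage trees -/

namespace HausdorffTree

open Set Filter Topology ZeroAtInftyContinuousMap

variable {Υ : Type*} [PartialOrder Υ] [TopologicalSpace Υ] [HausdorffTree Υ]

theorem mass_neg (μ : StrongDual ℝ C₀(Υ, ℝ)) : mass (-μ) = -mass μ := by
  refine mass_eq_of_forall (summable_mass μ).neg fun f => ?_
  simp only [neg_mul]
  rw [tsum_neg, ← apply_eq_tsum]
  rfl

theorem setVar_mono {κ : ℝ} (hκ : 0 ≤ κ) (hκ1 : κ ≤ 1) (A : Set Υ) {μ ν : StrongDual ℝ C₀(Υ, ℝ)}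
    (h : ∀ t, asymAbs κ (mass μ t) ≤ asymAbs κ (mass ν t)) : setVar κ A μ ≤ setVar κ A ν :=
  (summable_weightedVar hκ hκ1 (indicator_one_nonneg A) (indicator_one_le_one A) μ).tsum_le_tsum
    (fun t => mul_le_mul_of_nonneg_left (h t) (indicator_one_nonneg A t))
    (summable_weightedVar hκ hκ1 (indicator_one_nonneg A) (indicator_one_le_one A) ν)

theorem norm_le_setVar_univ_add {κ : ℝ} (hκ : 0 ≤ κ) (hκ1 : κ ≤ 1) (μ : StrongDual ℝ C₀(Υ, ℝ)) :
    ‖μ‖ ≤ setVar κ univ μ + setVar κ univ (-μ) := by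
  simp only [setVar_eq, indicator_univ]
  rw [norm_eq_tsum, ← (summable_asymAbs hκ hκ1 μ).tsum_add (summable_asymAbs hκ hκ1 (-μ))]
  refine (summable_mass μ).abs.tsum_le_tsum (fun t => ?_)
    ((summable_asymAbs hκ hκ1 μ).add (summable_asymAbs hκ hκ1 (-μ)))
  rw [mass_neg]
  exact abs_le_asymAbs_add hκ _

/-- The norm built from the variations on the cells of the layers. -/
theorem exists_layer_norm {κ : ℝ} (hκ : 0 ≤ κ) (hκ1 : κ ≤ 1) (𝒰 : ℕ → Set (Set Υ))
    (h𝒰 : ∀ n, ∀ U ∈ 𝒰 n, IsOpen U) :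
    ∃ N : Seminorm ℝ (StrongDual ℝ C₀(Υ, ℝ)), IsEquivalentDualNorm N ∧
      (∀ μ ν, (∀ t, asymAbs κ (mass μ t) ≤ asymAbs κ (mass ν t)) →
        (∀ t, asymAbs κ (-mass μ t) ≤ asymAbs κ (-mass ν t)) → N μ ≤ N ν) ∧
      ∀ (x y : ℕ → StrongDual ℝ C₀(Υ, ℝ)) (M : ℝ), (∀ n, N (x n) ≤ M) → (∀ n, N (y n) ≤ M) →
        Agree (fun μ => N μ) x y → ∀ l, ∀ D ∈ (Layer.ofWord 𝒰 h𝒰 l).cells,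
          Agree (setVar κ D) x y ∧ Agree (setVar κ D) (fun n => -x n) (fun n => -y n) := by
  let S : List (ℕ × ℕ) × Bool → StrongDual ℝ C₀(Υ, ℝ) → ℝ := fun j =>
    if j.2 then layerVar κ (Layer.ofWord 𝒰 h𝒰 j.1) else setVar κ (Layer.ofWord 𝒰 h𝒰 j.1).rest
  have hS : ∀ j, IsEvalSup (S j) := by
    rintro ⟨l, b⟩
    cases b
    · exact isEvalSup_setVar hκ hκ1 (Layer.isOpen_rest _)
    · exact isEvalSup_layerVar hκ hκ1 _
  have hle : ∀ j μ, S j μ ≤ ‖μ‖ := by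
    rintro ⟨l, b⟩ μ
    cases b
    · exact setVar_le_norm hκ hκ1 _ μ
    · exact layerVar_le_norm hκ hκ1 _ μ
  have huniv : ∀ μ, setVar κ univ μ ≤ S ([], true) μ := by
    intro μ
    have h1 := le_l2norm (summable_setVar_sq hκ hκ1 (Layer.top (X := Υ)) μ) ⟨univ, rfl⟩
    exact h1.trans (le_add_of_nonneg_left (setVar_nonneg hκ _ μ))
  obtain ⟨N, hN, hmono, hagree⟩ := exists_isEquivalentDualNorm_of_family hS hle ([], true)
    fun μ => (norm_le_setVar_univ_add hκ hκ1 μ).trans (add_le_add (huniv μ) (huniv (-μ)))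
  have hSmono : ∀ j μ ν, (∀ t, asymAbs κ (mass μ t) ≤ asymAbs κ (mass ν t)) → S j μ ≤ S j ν := by
    rintro ⟨l, b⟩ μ ν h
    cases b
    · exact setVar_mono hκ hκ1 _ h
    · exact add_le_add (setVar_mono hκ hκ1 _ h) (l2norm_le_l2norm (summable_setVar_sq hκ hκ1 _ ν)
        (fun D => setVar_nonneg hκ _ μ) fun D => setVar_mono hκ hκ1 _ h)
  refine ⟨N, hN, fun μ ν h h' => hmono μ ν fun j => ⟨hSmono j μ ν h, hSmono j _ _ ?_⟩,
    fun x y M hx hy hxy l D hD => ?_⟩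
  · simpa only [mass_neg, Pi.neg_apply] using h'
  · obtain ⟨c, C, hc, -, hcC⟩ := hN.1
    have hb : ∀ μ, N μ ≤ M → ‖μ‖ ≤ c⁻¹ * M := fun μ hμ => by
      rw [le_inv_mul_iff₀ hc]; exact (hcC μ).1.trans hμ
    have hb' : ∀ μ, N μ ≤ M → ‖-μ‖ ≤ c⁻¹ * M := fun μ hμ => hb _ (by rwa [map_neg_eq_map])
    have h1 := hagree x y M hx hy hxy (l, false)
    have h2 := hagree x y M hx hy hxy (l, true)
    exact ⟨agree_setVar hκ hκ1 (fun n => hb _ (hx n)) (fun n => hb _ (hy n)) h1.1 h2.1 ⟨D, hD⟩,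
      agree_setVar hκ hκ1 (fun n => hb' _ (hx n)) (fun n => hb' _ (hy n)) h1.2 h2.2 ⟨D, hD⟩⟩

theorem exists_isPURNorm (hG : IsGruenhage Υ) : ∃ N : Seminorm ℝ (StrongDual ℝ C₀(Υ, ℝ)),
    IsEquivalentDualNorm N ∧ IsPURNorm (X := StrongDual ℝ C₀(Υ, ℝ)) N := by
  obtain ⟨𝒰, h𝒰, hsep⟩ := hG
  obtain ⟨N, hN, -, hagree⟩ := exists_layer_norm le_rfl zero_le_one 𝒰 h𝒰
  have hs : ∀ (A : Set Υ) (μ : StrongDual ℝ C₀(Υ, ℝ)), Summable (A.indicator (mass μ)) :=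
    fun A μ => (summable_mass μ).indicator A
  let L : ((l : List (ℕ × ℕ)) × (Layer.ofWord 𝒰 h𝒰 l).cells) → StrongDual ℝ C₀(Υ, ℝ) →ₗ[ℝ] ℝ :=
    fun i =>
    { toFun := fun μ => ∑' t, (i.2 : Set Υ).indicator (mass μ) t
      map_add' := fun μ ν => by
        rw [← (hs _ μ).tsum_add (hs _ ν), mass_add]
        exact tsum_congr fun t => congrFun (indicator_add _ _ _) t
      map_smul' := fun c μ => by
        rw [mass_smul, RingHom.id_apply, smul_eq_mul, ← tsum_mul_left]
        exact tsum_congr fun t => congrFun (indicator_const_smul _ c (mass μ)) t }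
  have hL : ∀ i μ, L i μ = setVar 0 (i.2 : Set Υ) μ - setVar 0 (i.2 : Set Υ) (-μ) := by
    intro i μ
    rw [setVar_eq, setVar_eq, ← ((summable_asymAbs le_rfl zero_le_one μ).indicator _).tsum_sub
      ((summable_asymAbs le_rfl zero_le_one (-μ)).indicator _)]
    refine tsum_congr fun t => ?_
    by_cases ht : t ∈ (i.2 : Set Υ)
    · rw [indicator_of_mem ht, indicator_of_mem ht, indicator_of_mem ht, mass_neg, asymAbs_eq le_rfl,
        asymAbs_eq le_rfl, Pi.neg_apply, posPart_neg, zero_mul, zero_mul, add_zero, add_zero,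
        posPart_sub_negPart]
    · rw [indicator_of_notMem ht, indicator_of_notMem ht, indicator_of_notMem ht, sub_zero]
  refine ⟨N, hN, isPURNorm_of_family (X := StrongDual ℝ C₀(Υ, ℝ)) L
    (fun i => ⟨2, fun μ => ?_⟩) (fun μ hμ => ?_) fun x y hx hy hxy i => ?_⟩
  · have h1 := setVar_le_norm le_rfl zero_le_one (i.2 : Set Υ) μ
    have h2 := setVar_le_norm le_rfl zero_le_one (i.2 : Set Υ) (-μ)
    have h3 : ‖-μ‖ = ‖μ‖ := ContinuousLinearMap.opNorm_neg μ
    have h4 := setVar_nonneg (κ := 0) le_rfl (i.2 : Set Υ) μ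
    have h5 := setVar_nonneg (κ := 0) le_rfl (i.2 : Set Υ) (-μ)
    rw [hL, abs_le]
    constructor <;> linarith
  · have h0 : mass μ = 0 := Layer.eq_zero_of_forall_tsum_cell h𝒰 hsep (summable_mass μ)
      fun l D hD => hμ ⟨l, D, hD⟩
    ext f
    rw [apply_eq_tsum, h0]
    simp
  · have hA : Agree (fun μ => N μ) x y := by
      refine ⟨?_, ?_⟩
      · simp only [hx, hy, sub_self]; exact tendsto_const_nhds
      · have := hxy.const_sub 2
        simp only [hx, hy]
        norm_num at this ⊢
        exact this
    obtain ⟨h1, h2⟩ := hagree x y 1 (fun n => (hx n).le) (fun n => (hy n).le) hA i.1 i.2 i.2.2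
    have := h1.1.sub h2.1
    simp only [sub_zero] at this
    refine this.congr fun n => ?_
    rw [hL, hL]
    ring

theorem abs_mass_le_of_dualModulus_le {μ ν : StrongDual ℝ C₀(Υ, ℝ)}
    (h : ∀ f : C₀(Υ, ℝ), (∀ t, 0 ≤ f t) → dualModulus μ f ≤ dualModulus ν f) (t : Υ) :
    |mass μ t| ≤ |mass ν t| := by
  by_contra! hlt
  set m : Υ → ℝ := fun t => |mass μ t| - |mass ν t| with hm
  have hsum : Summable m := (summable_mass μ).abs.sub (summable_mass ν).abs
  have hpos : 0 < ∑' t, (1 * (m t)⁺ + 0 * (m t)⁻) := by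
    have hs : Summable fun t => 1 * (m t)⁺ + 0 * (m t)⁻ := by
      refine Summable.of_nonneg_of_le (fun t => ?_) (fun t => ?_) hsum.abs
      · rw [one_mul, zero_mul, add_zero]; exact posPart_nonneg _
      · rw [one_mul, zero_mul, add_zero, ← posPart_add_negPart]
        exact le_add_of_nonneg_right (negPart_nonneg _)
    refine hs.tsum_pos (fun t => ?_) t ?_
    · rw [one_mul, zero_mul, add_zero]; exact posPart_nonneg _
    · rw [one_mul, zero_mul, add_zero]; exact posPart_pos (sub_pos.2 hlt)
  obtain ⟨f, hf, hlt⟩ := exists_lt_tsum hsum (a := fun _ => 1) (b := fun _ => 0)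
    lowerSemicontinuous_const lowerSemicontinuous_const (fun _ => zero_le_one) (fun _ => le_rfl)
    (B := 1) (fun _ => le_rfl) (fun _ => zero_le_one) hpos
  have hf0 : ∀ t, 0 ≤ f t := fun t => by simpa using (hf t).1
  have h1 := h f hf0
  rw [dualModulus_eq μ hf0, dualModulus_eq ν hf0, ← sub_nonpos,
    ← (summable_mul (summable_mass μ).abs f).tsum_sub (summable_mul (summable_mass ν).abs f)] at h1
  simp only [hm, sub_mul] at hlt
  exact absurd hlt (not_lt.2 h1)

theorem asymAbs_one (x : ℝ) : asymAbs 1 x = |x| := by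
  rw [asymAbs, one_mul]; rfl

theorem exists_strictlyConvex_lattice_norm (hG : IsGruenhage Υ) :
    ∃ N : Seminorm ℝ (StrongDual ℝ C₀(Υ, ℝ)), IsEquivalentDualNorm N ∧
      IsStrictlyConvexNorm (X := StrongDual ℝ C₀(Υ, ℝ)) N ∧ IsDualSpaceLatticeNorm N := by
  obtain ⟨𝒰, h𝒰, hsep⟩ := hG
  obtain ⟨N, hN, hmono, hagree⟩ := exists_layer_norm zero_le_one le_rfl 𝒰 h𝒰
  refine ⟨N, hN, fun x y hxy hxy' => ?_, fun μ ν h => ?_⟩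
  · have hA : Agree (fun μ => N μ) (fun _ => x) fun _ => y := by
      refine ⟨?_, ?_⟩
      · simp only [hxy, sub_self]; exact tendsto_const_nhds
      · have : N x + N y - N (x + y) = 0 := by linarith
        simp only [this]; exact tendsto_const_nhds
    have key := fun l D hD => (hagree _ _ (N y) (fun _ => hxy.le) (fun _ => le_rfl) hA l D hD).1.of_const
    have hs := fun μ : StrongDual ℝ C₀(Υ, ℝ) => (summable_mass μ).abs
    have hsv : ∀ (D : Set Υ) (μ : StrongDual ℝ C₀(Υ, ℝ)),
        setVar 1 D μ = ∑' t, D.indicator (fun t => |mass μ t|) t := fun D μ => by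
      simp only [setVar_eq, asymAbs_one]
    have h1 := Layer.eq_zero_of_forall_tsum_cell h𝒰 hsep ((hs x).sub (hs y)) fun l D hD => by
      have h := (key l D hD).1
      rw [hsv, hsv, ← sub_eq_zero, ← ((hs x).indicator D).tsum_sub ((hs y).indicator D)] at h
      rw [← h]
      exact tsum_congr fun t => congrFun (indicator_sub _ _ _) t
    have h2 := Layer.eq_zero_of_forall_tsum_cell h𝒰 hsep (((hs x).add (hs y)).sub (hs (x + y)))
      fun l D hD => by
      have h := (key l D hD).2
      rw [hsv, hsv, hsv, ← sub_eq_zero, ← ((hs x).indicator D).tsum_add ((hs y).indicator D),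
        ← (((hs x).indicator D).add ((hs y).indicator D)).tsum_sub ((hs (x + y)).indicator D)] at h
      rw [← h]
      refine tsum_congr fun t => ?_
      by_cases ht : t ∈ D
      · simp only [indicator_of_mem ht]
      · simp only [indicator_of_notMem ht, add_zero, sub_zero]
    refine mass_injective (funext fun t => ?_)
    have e1 : |mass x t| - |mass y t| = 0 := congrFun h1 t
    have e2 : |mass x t| + |mass y t| - |mass (x + y) t| = 0 := congrFun h2 t
    rw [mass_add, Pi.add_apply] at e2
    rcases abs_eq_abs.1 (sub_eq_zero.1 e1) with h | h
    · exact h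
    · rw [h, neg_add_cancel, abs_zero, abs_neg] at e2
      have : mass y t = 0 := abs_nonpos_iff.1 (by linarith [abs_nonneg (mass y t)])
      rw [h, this, neg_zero]
  · have hle := abs_mass_le_of_dualModulus_le h
    refine hmono μ ν (fun t => ?_) fun t => ?_
    · rw [asymAbs_one, asymAbs_one]; exact hle t
    · rw [asymAbs_one, asymAbs_one, abs_neg, abs_neg]; exact hle t

end HausdorffTree

theorem IsPURNorm.isStrictlyConvexNorm {X : Type*} [NormedAddCommGroup X] [NormedSpace ℝ X]
    {N : Seminorm ℝ X} (hN : IsEquivalentNorm N) (h : IsPURNorm N) : IsStrictlyConvexNorm N := by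
  obtain ⟨F, hF, hlim⟩ := h
  obtain ⟨c, C, hc, -, hcC⟩ := hN
  intro x y hxy hxy'
  have h0 : ∀ z, N z = 0 → z = 0 := fun z hz => by
    have := (hcC z).1
    rw [hz] at this
    exact norm_le_zero_iff.1 (nonpos_of_mul_nonpos_right this hc)
  rcases (apply_nonneg N y).eq_or_lt with hy | hy
  · rw [h0 y hy.symm, h0 x (hxy.trans hy.symm)]
  by_contra hne
  obtain ⟨f, hf, hfne⟩ := hF (x - y) (sub_ne_zero.2 hne)
  have hsc : ∀ z, N ((N y)⁻¹ • z) = (N y)⁻¹ * N z := fun z => by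
    rw [map_smul_eq_mul, Real.norm_of_nonneg (inv_nonneg.2 hy.le)]
  have h1 : Filter.Tendsto (fun _ : ℕ => N ((N y)⁻¹ • x + (N y)⁻¹ • y)) Filter.atTop (nhds 2) := by
    have : N ((N y)⁻¹ • x + (N y)⁻¹ • y) = 2 := by
      rw [← smul_add, hsc, show N (x + y) = 2 * N y by linarith]
      field_simp
    rw [this]; exact tendsto_const_nhds
  have h2 := hlim (fun _ => (N y)⁻¹ • x) (fun _ => (N y)⁻¹ • y)
    (fun _ => by rw [hsc, hxy, inv_mul_cancel₀ hy.ne'])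
    (fun _ => by rw [hsc, inv_mul_cancel₀ hy.ne']) h1 f hf
  have h3 := tendsto_nhds_unique tendsto_const_nhds h2
  rw [← smul_sub, map_smul, smul_eq_mul] at h3
  exact hfne ((mul_eq_zero.1 h3).resolve_left (inv_ne_zero hy.ne'))

theorem mainTheorem3 {Υ : Type*} [PartialOrder Υ] [τ : TopologicalSpace Υ]
    (hτ : τ = treeTopology Υ) (htree : IsOrderTree Υ) (hHaus : IsHausdorffOrder Υ) :
    List.TFAE [
      ∃ N : Seminorm ℝ (StrongDual ℝ C₀(Υ, ℝ)), IsEquivalentDualNorm N ∧ IsPURNorm (X := StrongDual ℝ C₀(Υ, ℝ)) N,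
      ∃ N : Seminorm ℝ (StrongDual ℝ C₀(Υ, ℝ)),
        IsEquivalentDualNorm N ∧ IsStrictlyConvexNorm (X := StrongDual ℝ C₀(Υ, ℝ)) N ∧ IsDualSpaceLatticeNorm N,
      ∃ N : Seminorm ℝ C₀(Υ, ℝ),
        IsEquivalentNorm N ∧ IsGateauxSmoothNorm N ∧ IsLatticeNorm N,
      ∃ N : Seminorm ℝ (StrongDual ℝ C₀(Υ, ℝ)),
        IsEquivalentDualNorm N ∧ IsStrictlyConvexNorm (X := StrongDual ℝ C₀(Υ, ℝ)) N,
      ∃ ρ : Υ → OrderY, ∀ s t : Υ, s < t → ρ s < ρ t,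
      IsGruenhage Υ] := by
  have : HausdorffTree Υ := ⟨hτ, htree, hHaus⟩
  tfae_have 1 → 4 := fun ⟨N, hN, hpur⟩ =>
    ⟨N, hN, IsPURNorm.isStrictlyConvexNorm (X := StrongDual ℝ C₀(Υ, ℝ)) hN.1 hpur⟩
  tfae_have 2 → 3 := fun ⟨N, hN, hsc, hl⟩ => HausdorffTree.exists_smooth_lattice_norm hN hsc hl
  tfae_have 3 → 5 := fun ⟨p, hp, hs, hl⟩ =>
    HausdorffTree.exists_orderY_of_isSmoothMonotone
      (isSmoothMonotone_of_lattice hp hs hl)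
  tfae_have 4 → 5 := fun ⟨N, hN, hsc⟩ =>
    have ⟨_, hq⟩ := exists_isSmoothMonotone hN hsc
    HausdorffTree.exists_orderY_of_isSmoothMonotone hq
  tfae_have 5 → 6 := fun ⟨ρ, hρ⟩ => HausdorffTree.isGruenhage_of_orderY ρ hρ
  tfae_have 6 → 1 := HausdorffTree.exists_isPURNorm
  tfae_have 6 → 2 := HausdorffTree.exists_strictlyConvex_lattice_norm
  tfae_finish
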